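/- An operator system is a closed unital self-adjoint linear subspace $X$ of a nonzero unital $C^*$-algebra; $X_{\mathrm{sa}}$ is its real space of self-adjoint elements, and $UCP_n(X)$ is the set of unital completely positive maps $X\to M_n=M_n(\mathbb{C})$. A Lip-normed operator system is a pair $(X,L)$ where $L$ is a (finite) semi-norm on a dense real linear subspace $\mathcal{D}(L)\ni 1$ of $X_{\mathrm{sa}}$ such that (a) $L(a)=0$ if and only if $a\in\mathbb{R}1$; (b) the metric $\rho_L(\mu,\nu)=\sup\{|\mu(a)-\nu(a)| : a\in\mathcal{D}(L),\ L(a)\le 1\}$ on the state space of the order-unit space $\mathcal{D}(L)$ induces the weak$^*$ topology; (c) $\{a\in\mathcal{D}(L) : L(a)\le 1\}$ is closed in $X_{\mathrm{sa}}$. For $n\ge 1$ put $\rho_{L,n}(\varphi,\psi)=\sup\{\|\varphi(x)-\psi(x)\| : x\in\mathcal{D}(L),\ L(x)\le 1\}$ for $\varphi,\psi\in UCP_n(X)$. For Lip-normed operator systems $(X,L_X)$ and $(Y,L_Y)$ let $\mathcal{M}(L_X,L_Y)$ be the set of semi-norms $L$ with domain $\mathcal{D}(L_X)\oplus\mathcal{D}(L_Y)$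 such that $(X\oplus Y,L)$ is a Lip-normed operator system, $L_X(x)=\inf_{y\in\mathcal{D}(L_Y)}L(x,y)$ for all $x\in\mathcal{D}(L_X)$, and $L_Y(y)=\inf_{x\in\mathcal{D}(L_X)}L(x,y)$ for all $y\in\mathcal{D}(L_Y)$. The complete distance is $$\mathrm{dist}_s(X,Y)=\inf_{L\in\mathcal{M}(L_X,L_Y)}\ \sup_{n\ge 1}\ \mathrm{dist}_H^{\rho_{L,n}}\big(UCP_n(X),UCP_n(Y)\big),$$ where $\mathrm{dist}_H^{\rho_{L,n}}$ is Hausdorff distance with respect to $\rho_{L,n}$, and $UCP_n(X)$ and $UCP_n(Y)$ are regarded as subsets of $UCP_n(X\oplus Y)$ by composition with the two coordinate projections. Let $\mathcal{R}$ be the set of Lip-normed operator systems, with $(X,L_X)$ and $(Y,L_Y)$ identified when there is a unital complete order isomorphism $\Phi:X\to Y$ such that $\Phi(\mathcal{D}(L_X))=\mathcal{D}(L_Y)$ and $L_Y(\Phi(x))=L_X(x)$ for all $x\in\mathcal{D}(L_X)$. For $\varepsilon>0$ let $\mathrm{Afn}_L(\varepsilon)$ be the smallest integer $k$ such that there is a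 Lip-normed operator system $(Y,L_Y)$ with $Y$ an operator subsystem of $M_k$ and $\mathrm{dist}_s(X,Y)\le\varepsilon$ (and $\infty$ if there is none), and let $\mathcal{R}_{\mathrm{fa}}\subseteq\mathcal{R}$ be the set of classes of those $(X,L)$ with $\mathrm{Afn}_L(\varepsilon)<\infty$ for all $\varepsilon>0$. Then $\mathrm{dist}_s$ is a (well-defined, finite) metric on $\mathcal{R}$, and its subspace $\mathcal{R}_{\mathrm{fa}}$ is separable. -/

import Mathlib

open scoped ENNReal Matrix.Norms.L2Operator

universe u v

noncomputable section

/-- Positivity in a C⋆-algebra; for `Matrix (Fin m) (Fin m) A` the star is the conjugate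
transpose, so that this is positivity in the C⋆-algebra `M_m(A)`. -/
def IsPos {R : Type*} [Mul R] [Star R] (a : R) : Prop := ∃ b : R, a = star b * b

/-- The extended distance `sup_i d(f i, g i)` between points `f`, `g` that are evaluated at `i`. -/
@[reducible] def supPseudoEMetric {α ι E : Type*} [PseudoEMetricSpace E] (ev : α → ι → E) :
    PseudoEMetricSpace α where
  edist f g := ⨆ i, edist (ev f i) (ev g i)
  edist_self f := by simp
  edist_comm f g := by simp only [edist_comm]
  edist_triangle f g h := iSup_le fun i =>
    (edist_triangle (ev f i) (ev g i) (ev h i)).trans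
      (add_le_add (le_iSup (fun j => edist (ev f j) (ev g j)) i)
        (le_iSup (fun j => edist (ev g j) (ev h j)) i))

/-- A (concrete, nonzero) operator system: a closed unital self-adjoint linear subspace of a
unital C⋆-algebra. -/
structure OperatorSystem (A : Type u) [CStarAlgebra A] where
  carrier : Submodule ℂ A
  isClosed : IsClosed (carrier : Set A)
  star_mem : ∀ x ∈ carrier, star x ∈ carrier
  one_mem : (1 : A) ∈ carrier
  one_ne_zero : (1 : A) ≠ 0

namespace OperatorSystem

variable {A : Type u} [CStarAlgebra A] {B : Type v} [CStarAlgebra B]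

/-- The real vector space of self-adjoint elements of `X`. -/
def sa (X : OperatorSystem A) : Submodule ℝ A :=
  X.carrier.restrictScalars ℝ ⊓ selfAdjoint.submodule ℝ A

/-- The direct sum `X ⊕ Y`, inside the C⋆-algebra `A × B`. -/
def prod (X : OperatorSystem A) (Y : OperatorSystem B) : OperatorSystem (A × B) where
  carrier := X.carrier.prod Y.carrier
  isClosed := X.isClosed.prod Y.isClosed
  star_mem _ hx := ⟨X.star_mem _ hx.1, Y.star_mem _ hx.2⟩
  one_mem := ⟨X.one_mem, Y.one_mem⟩
  one_ne_zero h := X.one_ne_zero (congrArg Prod.fst h)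

/-- Complete positivity of a linear map from `X` to (an operator system in) `B`. -/
def IsCP (X : OperatorSystem A) (φ : X.carrier →ₗ[ℂ] B) : Prop :=
  ∀ (m : ℕ) (x : Matrix (Fin m) (Fin m) X.carrier),
    IsPos (x.map (fun a => (a : A))) → IsPos (x.map (fun a => φ a))

/-- The matrix state space `UCP_n(X)`. -/
def UCP (X : OperatorSystem A) (n : ℕ) : Type u :=
  {φ : X.carrier →ₗ[ℂ] Matrix (Fin n) (Fin n) ℂ // φ ⟨1, X.one_mem⟩ = 1 ∧ X.IsCP φ}

/-- `φ ↦ φ ∘ π₁`, the inclusion of `UCP_n(X)` into `UCP_n(X ⊕ Y)`. -/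
def UCP.inl {X : OperatorSystem A} {n : ℕ} (Y : OperatorSystem B) (φ : X.UCP n) :
    (X.prod Y).UCP n :=
  ⟨φ.1 ∘ₗ (LinearMap.fst ℂ A B).restrict (p := (X.prod Y).carrier) (q := X.carrier)
      (fun _ hz => hz.1), φ.2.1, by
    rintro m z ⟨b, hb⟩
    refine φ.2.2 m (z.map fun a => ⟨a.1.1, a.2.1⟩) ⟨b.map Prod.fst, ?_⟩
    ext i j
    have h := congrArg Prod.fst (congrFun (congrFun hb i) j)
    simpa [Matrix.mul_apply, Matrix.star_apply, Prod.fst_sum] using h⟩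

/-- `ψ ↦ ψ ∘ π₂`, the inclusion of `UCP_n(Y)` into `UCP_n(X ⊕ Y)`. -/
def UCP.inr {Y : OperatorSystem B} {n : ℕ} (X : OperatorSystem A) (ψ : Y.UCP n) :
    (X.prod Y).UCP n :=
  ⟨ψ.1 ∘ₗ (LinearMap.snd ℂ A B).restrict (p := (X.prod Y).carrier) (q := Y.carrier)
      (fun _ hz => hz.2), ψ.2.1, by
    rintro m z ⟨b, hb⟩
    refine ψ.2.2 m (z.map fun a => ⟨a.1.2, a.2.2⟩) ⟨b.map Prod.snd, ?_⟩
    ext i j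
    have h := congrArg Prod.snd (congrFun (congrFun hb i) j)
    simpa [Matrix.mul_apply, Matrix.star_apply, Prod.snd_sum] using h⟩

end OperatorSystem

/-- The state space of a unital real subspace `D` of self-adjoint elements, considered as an
order-unit space. -/
def OrderUnitState {A : Type u} [CStarAlgebra A] (D : Submodule ℝ A) : Type u :=
  {μ : D →ₗ[ℝ] ℝ // (∀ d : D, (d : A) = 1 → μ d = 1) ∧ ∀ d : D, IsPos (d : A) → 0 ≤ μ d}

/-- The weak⋆ topology on the state space: pointwise convergence on `D`. -/
@[reducible] def OrderUnitState.weakStar {A : Type u} [CStarAlgebra A] (D : Submodule ℝ A) :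
    TopologicalSpace (OrderUnitState D) :=
  TopologicalSpace.induced (fun μ (d : D) => μ.1 d) Pi.topologicalSpace

/-- The metric `ρ_L(μ, ν) = sup {|μ(a) - ν(a)| : L(a) ≤ 1}` on the state space. -/
@[reducible] def OrderUnitState.rho {A : Type u} [CStarAlgebra A] (D : Submodule ℝ A)
    (L : Seminorm ℝ D) : PseudoEMetricSpace (OrderUnitState D) :=
  supPseudoEMetric (fun μ (a : {a : D // L a ≤ 1}) => μ.1 a.1)

/-- A closed Lip-norm on a dense order-unit subspace `dom` of `X_sa`, so that `(X, L)` is a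
Lip-normed operator system. -/
structure LipNorm {A : Type u} [CStarAlgebra A] (X : OperatorSystem A) where
  dom : Submodule ℝ A
  dom_le : dom ≤ X.sa
  one_mem : (1 : A) ∈ dom
  dense : (X.sa : Set A) ⊆ closure (dom : Set A)
  L : Seminorm ℝ dom
  eq_zero_iff : ∀ a : dom, L a = 0 ↔ ∃ r : ℝ, (a : A) = r • (1 : A)
  induces_weakStar :
    (OrderUnitState.rho dom L).toUniformSpace.toTopologicalSpace = OrderUnitState.weakStar dom
  isClosed : IsClosed {x : A | ∃ h : x ∈ dom, L ⟨x, h⟩ ≤ 1}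

/-- The metric `ρ_{L,n}(φ, ψ) = sup {‖φ(x) - ψ(x)‖ : L(x) ≤ 1}` on `UCP_n(X)`. -/
@[reducible] def LipNorm.ucpMetric {A : Type u} [CStarAlgebra A] {X : OperatorSystem A}
    (L : LipNorm X) (n : ℕ) : PseudoEMetricSpace (X.UCP n) :=
  supPseudoEMetric (fun φ (x : {a : L.dom // L.L a ≤ 1}) => φ.1 ⟨x.1.1, (L.dom_le x.1.2).1⟩)

section Distance

variable {A : Type u} [CStarAlgebra A] {B : Type v} [CStarAlgebra B]
  {X : OperatorSystem A} {Y : OperatorSystem B}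

/-- `𝓜(L_X, L_Y)`: the closed Lip-norms on `𝓓(L_X) ⊕ 𝓓(L_Y)` which induce `L_X` and `L_Y` via
the quotient maps. -/
def admissible (LX : LipNorm X) (LY : LipNorm Y) : Set (LipNorm (X.prod Y)) :=
  {L | L.dom = LX.dom.prod LY.dom ∧
    (∀ x : LX.dom, IsGLB {r : ℝ | ∃ z : L.dom, (z : A × B).1 = x ∧ L.L z = r} (LX.L x)) ∧
    (∀ y : LY.dom, IsGLB {r : ℝ | ∃ z : L.dom, (z : A × B).2 = y ∧ L.L z = r} (LY.L y))}

/-- The Hausdorff distance between `UCP_n(X)` and `UCP_n(Y)` with respect to `ρ_{L,n}`. -/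
def ucpHausdorff (L : LipNorm (X.prod Y)) (n : ℕ) : ℝ≥0∞ :=
  letI := L.ucpMetric n
  Metric.hausdorffEDist (Set.range fun φ : X.UCP n => φ.inl Y)
    (Set.range fun ψ : Y.UCP n => ψ.inr X)

/-- The complete distance `dist_s`. -/
def completeDist (LX : LipNorm X) (LY : LipNorm Y) : ℝ≥0∞ :=
  ⨅ L ∈ admissible LX LY, ⨆ n : ℕ+, ucpHausdorff L n

end Distance

/-- `Afn_L(ε)`: the smallest `k` such that some Lip-normed operator system `(Y, L_Y)` with
`Y ⊆ M_k` has complete distance at most `ε` from `(X, L)`, and `⊤` if there is none. -/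
def afn {A : Type u} [CStarAlgebra A] {X : OperatorSystem A} (L : LipNorm X) (ε : ℝ) : ℕ∞ :=
  ⨅ (k : ℕ) (_ : ∃ (Y : OperatorSystem (Matrix (Fin k) (Fin k) ℂ)) (LY : LipNorm Y),
    completeDist L LY ≤ ENNReal.ofReal ε), (k : ℕ∞)

/-- A Lip-normed operator system. -/
structure LipNormedOperatorSystem : Type (u + 1) where
  algebra : Type u
  [cstar : CStarAlgebra algebra]
  X : OperatorSystem algebra
  L : LipNorm X

attribute [instance] LipNormedOperatorSystem.cstar

namespace LipNormedOperatorSystem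

/-- The existence of a bi-Lip-isometric unital complete order isomorphism. -/
def Iso (S T : LipNormedOperatorSystem.{u}) : Prop :=
  ∃ Φ : S.X.carrier ≃ₗ[ℂ] T.X.carrier,
    Φ ⟨1, S.X.one_mem⟩ = ⟨1, T.X.one_mem⟩ ∧
    S.X.IsCP (T.X.carrier.subtype ∘ₗ Φ.toLinearMap) ∧
    T.X.IsCP (S.X.carrier.subtype ∘ₗ Φ.symm.toLinearMap) ∧
    (∀ (x : S.X.carrier) (hx : (x : S.algebra) ∈ S.L.dom),
      ∃ hy : (Φ x : T.algebra) ∈ T.L.dom, T.L.L ⟨Φ x, hy⟩ = S.L.L ⟨x, hx⟩) ∧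
    (∀ (y : T.X.carrier) (hy : (y : T.algebra) ∈ T.L.dom),
      ∃ hx : (Φ.symm y : S.algebra) ∈ S.L.dom, S.L.L ⟨Φ.symm y, hx⟩ = T.L.L ⟨y, hy⟩)

theorem Iso.refl (S : LipNormedOperatorSystem.{u}) : S.Iso S :=
  ⟨LinearEquiv.refl ℂ _, rfl, fun _ _ h => h, fun _ _ h => h,
    fun _ hx => ⟨hx, rfl⟩, fun _ hy => ⟨hy, rfl⟩⟩

theorem Iso.symm {S T : LipNormedOperatorSystem.{u}} : S.Iso T → T.Iso S := by
  rintro ⟨Φ, h1, h2, h3, h4, h5⟩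
  exact ⟨Φ.symm, by rw [← h1, LinearEquiv.symm_apply_apply], h3, h2, h5, h4⟩

theorem Iso.trans {S T U : LipNormedOperatorSystem.{u}} : S.Iso T → T.Iso U → S.Iso U := by
  rintro ⟨Φ, h1, h2, h3, h4, h5⟩ ⟨Ψ, k1, k2, k3, k4, k5⟩
  refine ⟨Φ.trans Ψ, by rw [LinearEquiv.trans_apply, h1, k1],
    fun m x hx => k2 m (x.map Φ) (h2 m x hx), fun m y hy => h3 m (y.map Ψ.symm) (k3 m y hy), ?_, ?_⟩
  · intro x hx
    obtain ⟨hy, e⟩ := h4 x hx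
    obtain ⟨hz, e'⟩ := k4 (Φ x) hy
    exact ⟨hz, e'.trans e⟩
  · intro z hz
    obtain ⟨hy, e⟩ := k5 z hz
    obtain ⟨hx, e'⟩ := h5 (Ψ.symm z) hy
    exact ⟨hx, e'.trans e⟩

instance setoid : Setoid LipNormedOperatorSystem.{u} :=
  ⟨Iso, Iso.refl, Iso.symm, Iso.trans⟩

end LipNormedOperatorSystem

/-- `𝓡`: the Lip-normed operator systems up to bi-Lip-isometric unital complete order
isomorphism. -/
def LipSpace : Type (u + 1) := Quotient LipNormedOperatorSystem.setoid.{u}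

/-- The class of a Lip-normed operator system in `𝓡`. -/
def LipSpace.mk (S : LipNormedOperatorSystem.{u}) : LipSpace.{u} := Quotient.mk _ S

/-- `𝓡_fa`: the subset of `𝓡` of the finitely approximable Lip-normed operator systems. -/
def LipSpace.fa : Set LipSpace.{u} :=
  {q | ∃ S : LipNormedOperatorSystem.{u}, LipSpace.mk S = q ∧ ∀ ε : ℝ, 0 < ε → afn S.L ε ≠ ⊤}

end

/-!
The complete distance is studied through the unit balls of Lip-norms rather than through the
semi-norms themselves. `LipBall` isolates the convex sets that arise as unit balls `U` of closed
Lip-norms with domain `D`; the condition on the weak⋆ topology amounts to the total boundedness of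
`U` modulo the scalars, since `U ∩ {‖x‖ ≤ R}` is compact for a Lip-norm (`isCompact_ball_inter`,
by Arzelà–Ascoli on the weak⋆ compact state space). Membership in `𝓜(L_X, L_Y)` says that the
coordinate projections of `U` are, up to closure, the unit balls of `L_X` and `L_Y`
(`mem_admissible_iff`), and most admissible Lip-norms used here come from bridges: real linear maps
`T` on `𝓓(L_X) ⊕ 𝓓(L_Y)` that kill `(1, 1)` and not `(1, 0)`, added to the requirement
`L_X(x), L_Y(y) ≤ 1` as `‖T(x, y)‖ ≤ 1` (`exists_admissible_of_bridge`).

*Metric.* The distance is finite by a bridge that compares two states. It is symmetric because unit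
balls can be swapped. For the triangle inequality, unit balls are composed as relations,
`{(x, z) : ∃ y, (x, y) ∈ U, (y, z) ∈ V}`; compactness of bounded parts of the balls makes this set
closed (`exists_admissible_comp`). Isomorphic systems have distance zero by the bridges
`(x, y) ↦ ε⁻¹ (Φ x - y)`.

*Distance zero implies isomorphism.* Let `L k` be admissible with Hausdorff distances tending to
zero. Ultralimits of elements of the unit balls of `L k` span a closed subspace of `X ⊕ Y`
(`limitGraph`). Along it, every matrix state of `Y` is a limit of matrix states of `X` and
conversely (`exists_tendsto_ucp`). Since matrix states detect the norm up to a constant and detect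
matrix positivity (`isPos_of_forall_ucp`), this subspace is the graph of a complete order
isomorphism, and compactness of bounded parts of the unit balls shows that the isomorphism carries
one unit ball onto the other.

*Separability.* For two systems inside the same C⋆-algebra, matrix states extend by Arveson's
theorem (`UCP.exists_extension`), so the bridge `(x, y) ↦ δ⁻¹ (x - y)` bounds the complete distance
by the Hausdorff distance of bounded parts of the unit balls
(`completeDist_le_of_edist_ballCompacts_lt`). The compact subsets of `M_k` form a separable space,
hence the systems inside matrix algebras, and with them everything that they approximate, are
covered by countably many sets of small diameter.

Matrix states are handled through the duality between completely positive maps into `M_n` and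
functionals on `M_n(A)` that are positive (`cpMap`), which reduces Arveson's extension theorem to
the Riesz extension theorem for real functionals, and the detection of positivity to the existence
of states attaining the norm of a positive element of `M_n(A)`.
-/

universe w

noncomputable section

/-! ### Positivity in a C⋆-algebra -/

theorem isPos_iff_nonneg {R : Type*} [CStarAlgebra R] [PartialOrder R] [StarOrderedRing R] {a : R} :
    IsPos a ↔ 0 ≤ a :=
  CStarAlgebra.nonneg_iff_eq_star_mul_self.symm

theorem IsPos.isSelfAdjoint {R : Type*} [Semiring R] [StarRing R] {a : R} (h : IsPos a) :
    IsSelfAdjoint a := by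
  obtain ⟨b, rfl⟩ := h
  exact IsSelfAdjoint.star_mul_self b

theorem isPos_zero {R : Type*} [NonUnitalNonAssocSemiring R] [StarRing R] : IsPos (0 : R) :=
  ⟨0, by simp⟩

theorem isPos_one {R : Type*} [Semiring R] [StarRing R] : IsPos (1 : R) := ⟨1, by simp⟩

theorem IsPos.smul {R : Type*} [Ring R] [StarRing R] [Algebra ℝ R] [StarModule ℝ R] {a : R}
    (ha : IsPos a) {r : ℝ} (hr : 0 ≤ r) : IsPos (r • a) := by
  obtain ⟨b, rfl⟩ := ha
  refine ⟨√r • b, ?_⟩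
  rw [star_smul (√r) b, star_trivial (√r), smul_mul_smul_comm, Real.mul_self_sqrt hr]

section CStar

variable {R : Type*} [CStarAlgebra R]

theorem IsPos.add {a b : R} (ha : IsPos a) (hb : IsPos b) : IsPos (a + b) := by
  let _ := CStarAlgebra.spectralOrder R
  have := CStarAlgebra.spectralOrderedRing R
  rw [isPos_iff_nonneg] at *
  exact add_nonneg ha hb

theorem isPos_sum {ι : Type*} (s : Finset ι) (f : ι → R) (h : ∀ i ∈ s, IsPos (f i)) :
    IsPos (∑ i ∈ s, f i) := by
  let _ := CStarAlgebra.spectralOrder R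
  have := CStarAlgebra.spectralOrderedRing R
  rw [isPos_iff_nonneg]
  exact Finset.sum_nonneg fun i hi => isPos_iff_nonneg.1 (h i hi)

theorem isPos_smul_one_add {a : R} (ha : IsSelfAdjoint a) {r : ℝ} (hr : ‖a‖ ≤ r) :
    IsPos (r • (1 : R) + a) := by
  let _ := CStarAlgebra.spectralOrder R
  have := CStarAlgebra.spectralOrderedRing R
  rw [isPos_iff_nonneg]
  have h := ha.neg_algebraMap_norm_le_self
  rw [Algebra.algebraMap_eq_smul_one] at h
  have h2 : ‖a‖ • (1 : R) ≤ r • (1 : R) := smul_le_smul_of_nonneg_right hr zero_le_one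
  calc (0 : R) ≤ ‖a‖ • (1 : R) + a := by
        have := add_le_add_right h (‖a‖ • (1 : R))
        simpa [add_comm] using this
    _ ≤ _ := by gcongr

theorem isPos_smul_one_sub {a : R} (ha : IsSelfAdjoint a) {r : ℝ} (hr : ‖a‖ ≤ r) :
    IsPos (r • (1 : R) - a) := by
  simpa [sub_eq_add_neg] using isPos_smul_one_add ha.neg (r := r) (by simpa using hr)

theorem norm_le_of_isPos {a : R} {r : ℝ} (hr : 0 ≤ r) (h1 : IsPos (r • (1 : R) + a))
    (h2 : IsPos (r • (1 : R) - a)) : ‖a‖ ≤ r := by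
  let _ := CStarAlgebra.spectralOrder R
  have := CStarAlgebra.spectralOrderedRing R
  rcases subsingleton_or_nontrivial R with hR | hR
  · rw [Subsingleton.elim a 0, norm_zero]; exact hr
  have ha : IsSelfAdjoint a := by
    have h3 : IsSelfAdjoint (r • (1 : R)) := by
      rw [isSelfAdjoint_iff, star_smul, star_one, star_trivial]
    simpa using h1.isSelfAdjoint.sub h3
  rw [isPos_iff_nonneg] at h1 h2
  rw [← Algebra.algebraMap_eq_smul_one] at h1 h2
  have h2' : a ≤ algebraMap ℝ R r := sub_nonneg.1 h2
  have h1' : algebraMap ℝ R (-r) ≤ a := by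
    rw [map_neg, neg_le_iff_add_nonneg, add_comm]; exact h1
  rw [le_algebraMap_iff_spectrum_le ha] at h2'
  rw [algebraMap_le_iff_le_spectrum ha] at h1'
  rcases CStarAlgebra.norm_or_neg_norm_mem_spectrum ha with h | h
  · exact h2' _ h
  · have := h1' _ h
    linarith

theorem isPos_of_norm_sub_le {a : R} (ha : IsSelfAdjoint a) {r : ℝ}
    (h : ‖r • (1 : R) - a‖ ≤ r) : IsPos a := by
  have h3 : IsSelfAdjoint (r • (1 : R)) := by
    rw [isSelfAdjoint_iff, star_smul, star_one, star_trivial]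
  simpa using isPos_smul_one_sub (h3.sub ha) h

theorem norm_le_of_isPos_of_isPos_sub {a : R} {r : ℝ} (hr : 0 ≤ r) (h1 : IsPos a)
    (h2 : IsPos (r • (1 : R) - a)) : ‖a‖ ≤ r :=
  norm_le_of_isPos hr ((isPos_one.smul hr).add h1) h2

theorem isClosed_isPos : IsClosed {a : R | IsPos a} := by
  let _ := CStarAlgebra.spectralOrder R
  have := CStarAlgebra.spectralOrderedRing R
  simp only [isPos_iff_nonneg]
  exact CStarAlgebra.isClosed_nonneg

end CStar

/-! ### Positive functionals -/

/-- A real linear functional which is nonnegative at every element with positive real part.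
Such functionals are the real parts of the positive complex linear functionals. -/
def IsPosFunctional {R : Type*} [Ring R] [StarRing R] [Module ℝ R] (g : R →ₗ[ℝ] ℝ) : Prop :=
  ∀ x : R, IsPos (x + star x) → 0 ≤ g x

namespace IsPosFunctional

variable {R : Type*} [Ring R] [StarRing R] [Algebra ℝ R] {g : R →ₗ[ℝ] ℝ}

theorem map_star (hg : IsPosFunctional g) (x : R) : g (star x) = g x := by
  have h1 : 0 ≤ g (x - star x) := hg _ (by simpa using isPos_zero)
  have h2 : 0 ≤ g (star x - x) := hg _ (by simpa using isPos_zero)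
  rw [map_sub] at h1 h2
  linarith

theorem add (hg : IsPosFunctional g) {f : R →ₗ[ℝ] ℝ} (hf : IsPosFunctional f) :
    IsPosFunctional (g + f) := fun x hx => add_nonneg (hg x hx) (hf x hx)

theorem smul (hg : IsPosFunctional g) {r : ℝ} (hr : 0 ≤ r) :
    IsPosFunctional (r • g) := fun x hx => mul_nonneg hr (hg x hx)

theorem nonneg [StarModule ℝ R] (hg : IsPosFunctional g) {x : R} (hx : IsPos x) : 0 ≤ g x := by
  refine hg x ?_
  rw [hx.isSelfAdjoint.star_eq, ← two_smul ℝ]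
  exact hx.smul zero_le_two

end IsPosFunctional

section CStar
variable {R : Type*} [CStarAlgebra R]

/-- Adding `1` to a positive element shifts its norm by exactly `1`; a norming functional of `b + 1`
must therefore attain the norm at `1`, which makes it a state. -/
theorem norm_add_one_of_isPos [Nontrivial R] {b : R} (hb : IsPos b) : ‖b + 1‖ = ‖b‖ + 1 := by
  refine le_antisymm ((norm_add_le _ _).trans (by simp)) ?_
  have h1 : IsPos (‖b + 1‖ • (1 : R) - (b + 1)) :=
    isPos_smul_one_sub (hb.add isPos_one).isSelfAdjoint le_rfl
  have h0 : (1 : ℝ) ≤ ‖b + 1‖ := by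
    rw [← norm_one (α := R)]
    refine norm_le_of_isPos_of_isPos_sub (norm_nonneg _) isPos_one ?_
    convert h1.add hb using 1
    abel
  have := norm_le_of_isPos_of_isPos_sub (r := ‖b + 1‖ - 1) (by linarith) hb
    (by convert h1 using 1; rw [sub_smul, one_smul]; abel)
  linarith

/-- Every positive element attains its norm at some state. -/
theorem exists_state_of_isPos [Nontrivial R] {b : R} (hb : IsPos b) :
    ∃ g : R →ₗ[ℝ] ℝ, IsPosFunctional g ∧ g 1 = 1 ∧ g b = ‖b‖ := by
  obtain ⟨f, hf, hfb⟩ := exists_dual_vector'' ℝ (b + 1)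
  have hle : ∀ x, f x ≤ ‖x‖ := fun x =>
    (le_abs_self _).trans ((f.le_opNorm x).trans (mul_le_of_le_one_left (norm_nonneg _) hf))
  have h1 := hle 1
  have h2 := hle b
  rw [norm_one] at h1
  simp only [norm_add_one_of_isPos hb, map_add, RCLike.ofReal_real_eq_id, id] at hfb
  have hf1 : f 1 = 1 := by linarith
  -- A functional of norm at most `1` with `f 1 = 1` is positive, as `‖‖x‖ • 1 - x‖ ≤ ‖x‖` for `0 ≤
  -- x`.
  have hpos : ∀ x : R, IsPos x → 0 ≤ f x := by
    intro x hx
    have h3 := hle (‖x‖ • (1 : R) - x)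
    have h4 : ‖‖x‖ • (1 : R) - x‖ ≤ ‖x‖ :=
      norm_le_of_isPos_of_isPos_sub (norm_nonneg _) (isPos_smul_one_sub hx.isSelfAdjoint le_rfl)
        (by simpa using hx)
    rw [map_sub, map_smul, hf1, smul_eq_mul, mul_one] at h3
    linarith
  -- Symmetrizing makes `f` nonnegative at every element with positive real part.
  refine ⟨(2⁻¹ : ℝ) • (f.toLinearMap + f.toLinearMap ∘ₗ (starLinearEquiv ℝ (A := R)).toLinearMap),
    fun x hx => ?_, ?_, ?_⟩
  · have := hpos _ hx
    rw [map_add] at this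
    simp only [LinearMap.smul_apply, LinearMap.add_apply, LinearMap.comp_apply, smul_eq_mul]
    exact mul_nonneg (by norm_num) this
  · simp [hf1]; norm_num
  · simp [hb.isSelfAdjoint.star_eq]; linarith

/-- A self-adjoint element at which all positive functionals are nonnegative is positive. -/
theorem exists_posFunctional_neg {a : R} (ha : IsSelfAdjoint a) (hn : ¬ IsPos a) :
    ∃ g : R →ₗ[ℝ] ℝ, IsPosFunctional g ∧ g a < 0 := by
  rcases subsingleton_or_nontrivial R with hR | hR
  · exact absurd (Subsingleton.elim a 0 ▸ isPos_zero) hn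
  obtain ⟨g, hg, h1, h2⟩ := exists_state_of_isPos (isPos_smul_one_sub ha le_rfl)
  refine ⟨g, hg, ?_⟩
  by_contra! h
  refine hn (isPos_of_norm_sub_le ha (r := ‖a‖) ?_)
  rw [← h2, map_sub, map_smul, h1, smul_eq_mul, mul_one]
  linarith

/-- The norm of `a` is attained at a state where the larger of `‖a‖ ± a` attains its norm, which is
at least `2 ‖a‖`. -/
theorem exists_state_norm_le [Nontrivial R] {a : R} (ha : IsSelfAdjoint a) :
    ∃ g : R →ₗ[ℝ] ℝ, IsPosFunctional g ∧ g 1 = 1 ∧ ‖a‖ ≤ |g a| := by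
  have hp := isPos_smul_one_add ha le_rfl
  have hm := isPos_smul_one_sub ha le_rfl
  rcases le_total ‖‖a‖ • (1 : R) + a‖ ‖‖a‖ • (1 : R) - a‖ with h | h
  all_goals
    have key : ∀ s : ℝ, ‖‖a‖ • (1 : R) + a‖ ≤ s → ‖‖a‖ • (1 : R) - a‖ ≤ s → 2 * ‖a‖ ≤ s := by
      intro s h1 h2
      have h3 : ‖a‖ + ‖a‖ ≤ s + s := by
        refine le_trans ?_ (add_le_add h1 h2)
        rw [← two_mul]
        calc 2 * ‖a‖ = ‖(‖a‖ • (1 : R) + a) - (‖a‖ • (1 : R) - a)‖ := by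
              rw [show (‖a‖ • (1 : R) + a) - (‖a‖ • (1 : R) - a) = (2 : ℝ) • a by
                rw [two_smul]; abel, norm_smul]; simp
          _ ≤ _ := norm_sub_le _ _
      have h5 := isPos_smul_one_sub hp.isSelfAdjoint h1
      have h6 := isPos_smul_one_sub hm.isSelfAdjoint h2
      have h4 := norm_le_of_isPos (a := a) (r := s - ‖a‖) (by linarith)
        (by convert h6 using 1; rw [sub_smul]; abel) (by convert h5 using 1; rw [sub_smul]; abel)
      linarith
  · obtain ⟨g, hg, h1, h2⟩ := exists_state_of_isPos hm
    refine ⟨g, hg, h1, ?_⟩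
    have := key _ h le_rfl
    rw [← h2, map_sub, map_smul, h1, smul_eq_mul, mul_one] at this
    exact le_trans (by linarith) (neg_le_abs _)
  · obtain ⟨g, hg, h1, h2⟩ := exists_state_of_isPos hp
    refine ⟨g, hg, h1, ?_⟩
    have := key _ le_rfl h
    rw [← h2, map_add, map_smul, h1, smul_eq_mul, mul_one] at this
    exact le_trans (by linarith) (le_abs_self _)

end CStar

/-! ### Positivity of matrices over a C⋆-algebra -/

section Matrix

variable {A : Type*} [CStarAlgebra A] {m : ℕ}

-- `Matrix (Fin m) (Fin m) A` is the C⋆-algebra `CStarMatrix (Fin m) (Fin m) A` up to definitional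
-- unfolding, so that the results for C⋆-algebras transfer.

theorem Matrix.isPos_add {a b : Matrix (Fin m) (Fin m) A} (ha : IsPos a) (hb : IsPos b) :
    IsPos (a + b) := by
  let _ := CStarAlgebra.spectralOrder A
  have := CStarAlgebra.spectralOrderedRing A
  exact IsPos.add (R := CStarMatrix (Fin m) (Fin m) A) ha hb

theorem Matrix.isPos_sum {ι : Type*} (s : Finset ι) (f : ι → Matrix (Fin m) (Fin m) A)
    (h : ∀ i ∈ s, IsPos (f i)) : IsPos (∑ i ∈ s, f i) := by
  let _ := CStarAlgebra.spectralOrder A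
  have := CStarAlgebra.spectralOrderedRing A
  exact _root_.isPos_sum (R := CStarMatrix (Fin m) (Fin m) A) s f h

theorem Matrix.exists_isPos_smul_one_add {a : Matrix (Fin m) (Fin m) A} (ha : IsSelfAdjoint a) :
    ∃ r : ℝ, IsPos (r • (1 : Matrix (Fin m) (Fin m) A) + a) := by
  let _ := CStarAlgebra.spectralOrder A
  have := CStarAlgebra.spectralOrderedRing A
  exact ⟨_, isPos_smul_one_add (R := CStarMatrix (Fin m) (Fin m) A) ha le_rfl⟩

theorem Matrix.exists_posFunctional_neg {a : Matrix (Fin m) (Fin m) A} (ha : IsSelfAdjoint a)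
    (hn : ¬ IsPos a) :
    ∃ g : Matrix (Fin m) (Fin m) A →ₗ[ℝ] ℝ, IsPosFunctional g ∧ g a < 0 := by
  let _ := CStarAlgebra.spectralOrder A
  have := CStarAlgebra.spectralOrderedRing A
  exact _root_.exists_posFunctional_neg (R := CStarMatrix (Fin m) (Fin m) A) ha hn

theorem Matrix.isClosed_isPos : IsClosed {a : Matrix (Fin m) (Fin m) A | IsPos a} := by
  let _ := CStarAlgebra.spectralOrder A
  have := CStarAlgebra.spectralOrderedRing A
  exact _root_.isClosed_isPos (R := CStarMatrix (Fin m) (Fin m) A)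

end Matrix

/-! ### Positivity of block matrices -/

section Block

open Matrix
open scoped ComplexOrder

theorem Matrix.isPos_iff_posSemidef {n : ℕ} {M : Matrix (Fin n) (Fin n) ℂ} :
    IsPos M ↔ M.PosSemidef := by
  open scoped MatrixOrder in
  rw [← Matrix.nonneg_iff_posSemidef, CStarAlgebra.nonneg_iff_eq_star_mul_self]
  rfl

theorem Matrix.posSemidef_of_forall_dotProduct_nonneg {ι : Type*} [Fintype ι] [DecidableEq ι]
    {M : Matrix ι ι ℂ} (h : ∀ v : ι → ℂ, 0 ≤ star v ⬝ᵥ M *ᵥ v) : M.PosSemidef := by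
  refine Matrix.PosSemidef.of_dotProduct_mulVec_nonneg ?_ h
  rw [← Matrix.isSymmetric_toEuclideanLin_iff, LinearMap.isSymmetric_iff_inner_map_self_real]
  intro v
  have h1 : inner ℂ (Matrix.toEuclideanLin M v) v = star (star v.ofLp ⬝ᵥ M *ᵥ v.ofLp) := by
    rw [EuclideanSpace.inner_eq_star_dotProduct, Matrix.toLpLin_apply,
      Matrix.star_dotProduct, star_star]
    exact dotProduct_comm _ _
  rw [h1]
  have := (Complex.nonneg_iff.1 (h v.ofLp)).2
  rw [RCLike.star_def, Complex.conj_conj, eq_comm]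
  exact Complex.conj_eq_iff_im.2 this.symm

theorem isPos_iff_comp_posSemidef {m n : ℕ}
    {Z : Matrix (Fin m) (Fin m) (Matrix (Fin n) (Fin n) ℂ)} :
    IsPos Z ↔ (Matrix.comp _ _ _ _ _ Z).PosSemidef := by
  open scoped MatrixOrder in
  rw [← Matrix.nonneg_iff_posSemidef, CStarAlgebra.nonneg_iff_eq_star_mul_self]
  constructor
  · rintro ⟨b, rfl⟩
    refine ⟨Matrix.compRingEquiv _ _ _ b, ?_⟩
    rw [← Matrix.compRingEquiv_apply, map_mul]
    rfl
  · rintro ⟨b, hb⟩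
    refine ⟨(Matrix.compRingEquiv _ _ _).symm b, ?_⟩
    apply (Matrix.compRingEquiv _ _ _).injective
    rw [map_mul, Matrix.compRingEquiv_apply, hb, RingEquiv.apply_symm_apply]
    rfl

/-- The pairing of `Z` with the vector `∑ i, e_i ⊗ e_i`. -/
theorem IsPos.sum_nonneg {n : ℕ} {Z : Matrix (Fin n) (Fin n) (Matrix (Fin n) (Fin n) ℂ)}
    (hZ : IsPos Z) : 0 ≤ ∑ i, ∑ j, Z i j i j := by
  have := (isPos_iff_comp_posSemidef.1 hZ).dotProduct_mulVec_nonneg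
    (fun p => if p.1 = p.2 then 1 else 0)
  simpa [dotProduct, mulVec, Fintype.sum_prod_type, apply_ite] using this

/-- For rectangular `E`, the matrix `Eᴴ E` is the sum over the rows of `E` of products `star b * b`
with a square matrix `b` that has this row as its only nonzero row. -/
theorem isPos_conjTranspose_mul_self {A : Type*} [CStarAlgebra A] {m n : ℕ}
    (E : Matrix (Fin m) (Fin n) A) : IsPos (Eᴴ * E) := by
  rcases n with _ | n
  · exact ⟨0, Subsingleton.elim _ _⟩
  · have h : Eᴴ * E = ∑ r, star (Matrix.of fun k j => if k = 0 then E r j else 0 :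
        Matrix (Fin (n + 1)) (Fin (n + 1)) A) *
        (Matrix.of fun k j => if k = 0 then E r j else 0) := by
      ext i j
      simp [Matrix.mul_apply, Matrix.sum_apply, apply_ite star]
    rw [h]
    exact Matrix.isPos_sum _ _ fun r _ => ⟨_, rfl⟩

theorem IsPos.apply_zero {R : Type*} [Ring R] [StarRing R] {Z : Matrix (Fin 1) (Fin 1) R}
    (h : IsPos Z) : IsPos (Z 0 0) := by
  obtain ⟨b, rfl⟩ := h
  exact ⟨b 0 0, by simp [Matrix.mul_apply]⟩

end Block

/-! ### Completely positive maps from positive functionals -/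

section CpMap

open Matrix
open scoped ComplexOrder

variable {A : Type u} [CStarAlgebra A] {n : ℕ}

/-- The complexification of a positive functional agrees with it at self-adjoint elements. -/
theorem IsPosFunctional.extendRCLike_eq {R : Type*} [Ring R] [StarRing R] [Algebra ℂ R]
    [StarModule ℂ R] {g : R →ₗ[ℝ] ℝ} (hg : IsPosFunctional g) {x : R} (hx : IsSelfAdjoint x) :
    (Module.Dual.extendRCLike g x : ℂ) = (g x : ℂ) := by
  have h := hg.map_star (Complex.I • x)
  rw [star_smul, hx.star_eq] at h
  simp only [RCLike.star_def, Complex.conj_I, neg_smul, map_neg] at h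
  have h0 : g (Complex.I • x) = 0 := by linarith
  rw [Module.Dual.extendRCLike_apply]
  simp [h0]

/-- The linear map `A → M_n` associated with a functional on `M_n(A)`, whose `(i, j)` entry is
`b ↦ g (E_ij ⊗ b)`. -/
def cpMap (g : Matrix (Fin n) (Fin n) A →ₗ[ℝ] ℝ) : A →ₗ[ℂ] Matrix (Fin n) (Fin n) ℂ where
  toFun b := Matrix.of fun i j => Module.Dual.extendRCLike g (Matrix.single i j b)
  map_add' a b := by ext i j; simp [Matrix.single_add]
  map_smul' c b := by ext i j; simp [← Matrix.smul_single]

theorem cpMap_apply (g : Matrix (Fin n) (Fin n) A →ₗ[ℝ] ℝ) (b : A) (i j : Fin n) :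
    cpMap g b i j = Module.Dual.extendRCLike g (Matrix.single i j b) := rfl

/-- The functional is recovered from its associated map. -/
theorem sum_cpMap_apply (g : Matrix (Fin n) (Fin n) A →ₗ[ℝ] ℝ) (y : Matrix (Fin n) (Fin n) A) :
    ∑ i, ∑ j, cpMap g (y i j) i j = Module.Dual.extendRCLike g y := by
  simp only [cpMap_apply, ← map_sum]
  rw [← Matrix.matrix_eq_sum_single]

theorem cpMap_add (g f : Matrix (Fin n) (Fin n) A →ₗ[ℝ] ℝ) : cpMap (g + f) = cpMap g + cpMap f := by
  ext b i j
  simp [cpMap_apply, Module.Dual.extendRCLike_apply]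
  ring

/-- The map associated with a positive functional on `M_n(A)` is completely positive. -/
theorem IsPosFunctional.cpMap_isPos {g : Matrix (Fin n) (Fin n) A →ₗ[ℝ] ℝ} (hg : IsPosFunctional g)
    {m : ℕ} {x : Matrix (Fin m) (Fin m) A} (hx : IsPos x) : IsPos (x.map (cpMap g)) := by
  rw [isPos_iff_comp_posSemidef]
  refine Matrix.posSemidef_of_forall_dotProduct_nonneg fun v => ?_
  obtain ⟨b, rfl⟩ := hx
  -- The quadratic form of `x.map (cpMap g)` at `v` is the value of `g` at a matrix `Eᴴ E`.
  let E : Matrix (Fin m) (Fin n) A := Matrix.of fun r j => ∑ q, v (q, j) • b r q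
  have hE := isPos_conjTranspose_mul_self E
  have key : star v ⬝ᵥ Matrix.comp _ _ _ _ _ ((star b * b).map (cpMap g)) *ᵥ v
      = (Module.Dual.extendRCLike g (Eᴴ * E) : ℂ) := by
    have h : ∀ i j, cpMap g ((Eᴴ * E) i j) i j =
        ∑ p, ∑ q, star (v (p, i)) * (cpMap g ((star b * b) p q) i j * v (q, j)) := by
      intro i j
      have h1 : (Eᴴ * E) i j = ∑ p, ∑ q, (star (v (p, i)) * v (q, j)) • (star b * b) p q := by
        simp only [Matrix.mul_apply, Matrix.conjTranspose_apply, E, Matrix.of_apply, star_sum,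
          star_smul, Finset.sum_mul, Finset.mul_sum, Finset.smul_sum, smul_mul_smul_comm,
          Matrix.star_apply]
        rw [Finset.sum_comm]
        conv_rhs => rw [Finset.sum_comm]
        refine Finset.sum_congr rfl fun q _ => ?_
        rw [Finset.sum_comm]
      rw [h1, map_sum, Matrix.sum_apply]
      refine Finset.sum_congr rfl fun p _ => ?_
      rw [map_sum, Matrix.sum_apply]
      refine Finset.sum_congr rfl fun q _ => ?_
      rw [map_smul, Matrix.smul_apply, smul_eq_mul]
      ring
    rw [← sum_cpMap_apply]
    simp only [h, dotProduct, mulVec, Fintype.sum_prod_type, Finset.mul_sum]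
    rw [Finset.sum_comm]
    refine Finset.sum_congr rfl fun i _ => ?_
    conv_rhs => rw [Finset.sum_comm]
    refine Finset.sum_congr rfl fun p _ => ?_
    rw [Finset.sum_comm]
    rfl
  rw [key, hg.extendRCLike_eq hE.isSelfAdjoint]
  exact_mod_cast hg.nonneg hE

/-- The functional `x ↦ ∑ i, g (x i i)` on `M_n(A)`. -/
def diagFunctional (n : ℕ) (g : A →ₗ[ℝ] ℝ) : Matrix (Fin n) (Fin n) A →ₗ[ℝ] ℝ where
  toFun x := ∑ i, g (x i i)
  map_add' x y := by simp [Finset.sum_add_distrib]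
  map_smul' c x := by simp [Finset.mul_sum]

theorem IsPosFunctional.diagFunctional {g : A →ₗ[ℝ] ℝ} (hg : IsPosFunctional g) :
    IsPosFunctional (diagFunctional n g) := by
  rintro x ⟨b, hb⟩
  change 0 ≤ ∑ i, g (x i i)
  refine Finset.sum_nonneg fun i _ => hg _ ?_
  have h : x i i + star (x i i) = ∑ k, star (b k i) * b k i := by
    have := congrFun (congrFun hb i) i
    simpa [Matrix.mul_apply, Matrix.star_apply] using this
  rw [h]
  exact isPos_sum _ _ fun k _ => ⟨_, rfl⟩

theorem cpMap_diagFunctional (g : A →ₗ[ℝ] ℝ) (b : A) :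
    cpMap (diagFunctional n g) b = (Module.Dual.extendRCLike g b : ℂ) • 1 := by
  ext i j
  rw [cpMap_apply]
  have h : ∀ b : A, diagFunctional n g (Matrix.single i j b) = if i = j then g b else 0 := by
    intro b
    simp only [diagFunctional, LinearMap.coe_mk, AddHom.coe_mk]
    split_ifs with hij
    · subst hij
      rw [Finset.sum_eq_single i] <;> simp +contextual [eq_comm]
    · refine Finset.sum_eq_zero fun k _ => ?_
      rw [Matrix.single_apply, if_neg, map_zero]
      rintro ⟨rfl, rfl⟩
      exact hij rfl
  rw [Module.Dual.extendRCLike_apply, Matrix.smul_single, h, h]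
  by_cases hij : i = j <;> simp [hij, Module.Dual.extendRCLike_apply]

end CpMap

/-! ### Unital completely positive maps -/

namespace OperatorSystem

open scoped ComplexOrder

variable {A : Type u} [CStarAlgebra A] {n : ℕ}

theorem nontrivial (X : OperatorSystem A) : Nontrivial A := ⟨1, 0, X.one_ne_zero⟩

/-- The C⋆-algebra that contains `X`, as an operator system. -/
def univ (X : OperatorSystem A) : OperatorSystem A where
  carrier := ⊤
  isClosed := isClosed_univ
  star_mem _ _ := trivial
  one_mem := trivial
  one_ne_zero := X.one_ne_zero

/-- The unital completely positive map obtained by restricting to `X` a unital linear map on the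
whole algebra which is completely positive. -/
def UCP.ofLinearMap (X : OperatorSystem A) (Φ : A →ₗ[ℂ] Matrix (Fin n) (Fin n) ℂ) (h1 : Φ 1 = 1)
    (hΦ : ∀ (m : ℕ) (x : Matrix (Fin m) (Fin m) A), IsPos x → IsPos (x.map Φ)) : X.UCP n :=
  ⟨Φ ∘ₗ X.carrier.subtype, h1, fun m _ hx => hΦ m _ hx⟩

/-- The restriction of a unital completely positive map to an operator subsystem. -/
def UCP.restrict {Z : OperatorSystem A} (X : OperatorSystem A) (h : X.carrier ≤ Z.carrier)
    (φ : Z.UCP n) : X.UCP n :=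
  ⟨φ.1 ∘ₗ Submodule.inclusion h, φ.2.1, fun m x hx =>
    φ.2.2 m (x.map (Submodule.inclusion h)) hx⟩

theorem UCP.map_one {X : OperatorSystem A} (φ : X.UCP n) (h : (1 : A) ∈ X.carrier) :
    φ.1 ⟨1, h⟩ = 1 := φ.2.1

theorem UCP.map_real_smul {X : OperatorSystem A} (φ : X.UCP n) {x : A} (r : ℝ) (hx : x ∈ X.carrier)
    (h : r • x ∈ X.carrier) : φ.1 ⟨r • x, h⟩ = r • φ.1 ⟨x, hx⟩ := by
  have : (⟨r • x, h⟩ : X.carrier) = (r : ℂ) • ⟨x, hx⟩ := by ext; simp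
  rw [this, map_smul, Complex.coe_smul]

section IsCP

variable {B : Type v} [CStarAlgebra B] {X : OperatorSystem A} {φ : X.carrier →ₗ[ℂ] B}

theorem IsCP.isPos_map (hφ : X.IsCP φ) {x : X.carrier} (hx : IsPos (x : A)) : IsPos (φ x) := by
  obtain ⟨b, hb⟩ := hx
  have h := hφ 1 (Matrix.of fun _ _ => x) ⟨Matrix.of fun _ _ => b, by
    ext i j; simp [Matrix.mul_apply, Matrix.star_apply, hb]⟩
  exact h.apply_zero

theorem IsCP.isPos_norm_smul_one (hφ : X.IsCP φ) (h1 : φ ⟨1, X.one_mem⟩ = 1) {x : X.carrier}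
    (hx : IsSelfAdjoint (x : A)) :
    IsPos (‖(x : A)‖ • (1 : B) + φ x) ∧ IsPos (‖(x : A)‖ • (1 : B) - φ x) := by
  have h2 : φ ((‖(x : A)‖ : ℂ) • ⟨1, X.one_mem⟩) = ‖(x : A)‖ • 1 := by
    rw [map_smul, h1, Complex.coe_smul]
  rw [← h2, ← map_add, ← map_sub]
  exact ⟨hφ.isPos_map (by simpa using isPos_smul_one_add hx le_rfl),
    hφ.isPos_map (by simpa using isPos_smul_one_sub hx le_rfl)⟩

theorem IsCP.norm_map_le (hφ : X.IsCP φ) (h1 : φ ⟨1, X.one_mem⟩ = 1) {x : X.carrier}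
    (hx : IsSelfAdjoint (x : A)) : ‖φ x‖ ≤ ‖(x : A)‖ :=
  norm_le_of_isPos (norm_nonneg _) (hφ.isPos_norm_smul_one h1 hx).1
    (hφ.isPos_norm_smul_one h1 hx).2

theorem IsCP.isSelfAdjoint_map (hφ : X.IsCP φ) (h1 : φ ⟨1, X.one_mem⟩ = 1) {x : X.carrier}
    (hx : IsSelfAdjoint (x : A)) : IsSelfAdjoint (φ x) := by
  have h3 : IsSelfAdjoint (‖(x : A)‖ • (1 : B)) := (isPos_one.smul (norm_nonneg _)).isSelfAdjoint
  simpa using (hφ.isPos_norm_smul_one h1 hx).1.isSelfAdjoint.sub h3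

end IsCP

theorem UCP.norm_map_le {X : OperatorSystem A} (φ : X.UCP n) {x : X.carrier}
    (hx : IsSelfAdjoint (x : A)) : ‖φ.1 x‖ ≤ ‖(x : A)‖ :=
  φ.2.2.norm_map_le φ.2.1 hx

theorem UCP.isSelfAdjoint_map {X : OperatorSystem A} (φ : X.UCP n) {x : X.carrier}
    (hx : IsSelfAdjoint (x : A)) : IsSelfAdjoint (φ.1 x) :=
  φ.2.2.isSelfAdjoint_map φ.2.1 hx

theorem realPart_mem (X : OperatorSystem A) {x : A} (hx : x ∈ X.carrier) :
    (realPart x : A) ∈ X.sa := by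
  refine ⟨?_, (realPart x).2⟩
  rw [realPart_apply_coe, ← Complex.coe_smul]
  exact X.carrier.smul_mem _ (X.carrier.add_mem hx (X.star_mem _ hx))

theorem imaginaryPart_mem (X : OperatorSystem A) {x : A} (hx : x ∈ X.carrier) :
    (imaginaryPart x : A) ∈ X.sa := by
  refine ⟨?_, (imaginaryPart x).2⟩
  rw [imaginaryPart_apply_coe, ← Complex.coe_smul]
  exact X.carrier.smul_mem _ (X.carrier.smul_mem _ (X.carrier.sub_mem hx (X.star_mem _ hx)))

theorem UCP.map_eq_add {X : OperatorSystem A} (φ : X.UCP n) (x : X.carrier) :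
    φ.1 x = φ.1 ⟨realPart (x : A), (X.realPart_mem x.2).1⟩ +
      Complex.I • φ.1 ⟨imaginaryPart (x : A), (X.imaginaryPart_mem x.2).1⟩ := by
  rw [← map_smul, ← map_add]
  congr 1
  ext
  exact (realPart_add_I_smul_imaginaryPart (x : A)).symm

/-- A contraction on self-adjoint elements has norm at most `2`. The constant is not optimal, but
the proof needs no Schwarz inequality. -/
theorem UCP.norm_map_le_two_mul {X : OperatorSystem A} (φ : X.UCP n) (x : X.carrier) :
    ‖φ.1 x‖ ≤ 2 * ‖(x : A)‖ := by
  rw [φ.map_eq_add, two_mul]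
  refine (norm_add_le _ _).trans (add_le_add ?_ ?_)
  · exact (φ.norm_map_le (x := ⟨_, (X.realPart_mem x.2).1⟩)
      (realPart (x : A)).2).trans (realPart.norm_le (x : A))
  · rw [norm_smul, Complex.norm_I, one_mul]
    exact (φ.norm_map_le (x := ⟨_, (X.imaginaryPart_mem x.2).1⟩)
      (imaginaryPart (x : A)).2).trans (imaginaryPart.norm_le (x : A))

theorem UCP.map_star {X : OperatorSystem A} (φ : X.UCP n) {x : A} (hx : x ∈ X.carrier) :
    φ.1 ⟨star x, X.star_mem x hx⟩ = star (φ.1 ⟨x, hx⟩) := by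
  have h1 := (φ.isSelfAdjoint_map (x := ⟨_, (X.realPart_mem hx).1⟩) (realPart x).2).star_eq
  have h2 :=
    (φ.isSelfAdjoint_map (x := ⟨_, (X.imaginaryPart_mem hx).1⟩) (imaginaryPart x).2).star_eq
  rw [φ.map_eq_add ⟨x, hx⟩, star_add, star_smul, h1, h2, ← map_smul, ← map_add]
  congr 1
  ext
  have h := congrArg star (realPart_add_I_smul_imaginaryPart x)
  rw [star_add, star_smul] at h
  rw [(realPart x).2.star_eq, (imaginaryPart x).2.star_eq] at h
  exact h.symm

/-- A state gives the unital completely positive map `b ↦ g(b) 1` into `M_n`. -/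
theorem exists_ucp_of_state (X : OperatorSystem A) (n : ℕ) {g : A →ₗ[ℝ] ℝ} (hg : IsPosFunctional g)
    (h1 : g 1 = 1) : ∃ φ : X.UCP n, ∀ x : X.carrier, IsSelfAdjoint (x : A) →
      φ.1 x = g x • (1 : Matrix (Fin n) (Fin n) ℂ) := by
  refine ⟨UCP.ofLinearMap X (cpMap (diagFunctional n g)) ?_ fun m x hx =>
    hg.diagFunctional.cpMap_isPos hx, fun x hx => ?_⟩
  · rw [cpMap_diagFunctional, hg.extendRCLike_eq (IsSelfAdjoint.one _), h1]
    simp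
  · change cpMap (diagFunctional n g) (x : A) = _
    rw [cpMap_diagFunctional, hg.extendRCLike_eq hx, Complex.coe_smul]

theorem exists_state (X : OperatorSystem A) : ∃ g : A →ₗ[ℝ] ℝ, IsPosFunctional g ∧ g 1 = 1 := by
  have := X.nontrivial
  obtain ⟨g, hg, h, -⟩ := exists_state_of_isPos (isPos_zero (R := A))
  exact ⟨g, hg, h⟩

/-- Self-adjoint elements of `X` attain their norm at some unital completely positive map into
`M_n`, provided `n ≠ 0`. -/
theorem exists_ucp_norm_le (X : OperatorSystem A) [NeZero n] {x : X.carrier}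
    (hx : IsSelfAdjoint (x : A)) : ∃ φ : X.UCP n, ‖(x : A)‖ ≤ ‖φ.1 x‖ := by
  have := X.nontrivial
  obtain ⟨g, hg, h1, h2⟩ := exists_state_norm_le hx
  obtain ⟨φ, hφ⟩ := X.exists_ucp_of_state n hg h1
  refine ⟨φ, ?_⟩
  rw [hφ x hx, norm_smul, Real.norm_eq_abs, norm_one, mul_one]
  exact h2

/-- **Arveson's extension theorem**, for maps into matrix algebras. A map `φ : X → M_n` corresponds
to the functional `x ↦ ∑ i j, φ(x i j) i j` on `M_n(X)`, and positive functionals extend. -/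
theorem UCP.exists_extension {X : OperatorSystem A} (φ : X.UCP n) :
    ∃ Φ : X.univ.UCP n, ∀ (x : A) (hx : x ∈ X.carrier), Φ.1 ⟨x, trivial⟩ = φ.1 ⟨x, hx⟩ := by
  -- The cone of elements with positive real part, and the subspace `M_n(X)`.
  let s : PointedCone ℝ (Matrix (Fin n) (Fin n) A) :=
    { carrier := {x | IsPos (x + star x)}
      zero_mem' := by simpa using isPos_zero
      add_mem' := fun {x y} hx hy => by
        have := Matrix.isPos_add hx hy
        simpa [add_add_add_comm] using this
      smul_mem' := fun c x hx => by
        have := IsPos.smul hx c.2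
        change IsPos ((c : ℝ) • x + star ((c : ℝ) • x))
        rw [star_smul (c : ℝ) x, star_trivial (c : ℝ), ← smul_add]
        exact this }
  let p : Submodule ℝ (Matrix (Fin n) (Fin n) A) :=
    { carrier := {x | ∀ i j, x i j ∈ X.carrier}
      zero_mem' := fun _ _ => X.carrier.zero_mem
      add_mem' := fun hx hy i j => X.carrier.add_mem (hx i j) (hy i j)
      smul_mem' := fun c x hx i j => by
        rw [Matrix.smul_apply, ← Complex.coe_smul]
        exact X.carrier.smul_mem _ (hx i j) }
  let f : p →ₗ[ℝ] ℝ :=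
    { toFun := fun x => ∑ i, ∑ j, (φ.1 ⟨x.1 i j, x.2 i j⟩ i j).re
      map_add' := fun x y => by
        simp only [← Finset.sum_add_distrib]
        refine Finset.sum_congr rfl fun i _ => Finset.sum_congr rfl fun j _ => ?_
        rw [← Complex.add_re, ← Matrix.add_apply, ← map_add]
        rfl
      map_smul' := fun c x => by
        simp only [smul_eq_mul, RingHom.id_apply, Finset.mul_sum]
        refine Finset.sum_congr rfl fun i _ => Finset.sum_congr rfl fun j _ => ?_
        have := φ.map_real_smul c (x.2 i j) ((c • x).2 i j)
        refine (congrArg (fun M : Matrix (Fin n) (Fin n) ℂ => (M i j).re) this).trans ?_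
        simp }
  have hnonneg : ∀ x : p, (x : Matrix (Fin n) (Fin n) A) ∈ s → 0 ≤ f x := by
    rintro ⟨x, hx⟩ hxs
    have hmem : ∀ i j, (x + star x) i j ∈ X.carrier := fun i j =>
      X.carrier.add_mem (hx i j) (X.star_mem _ (hx j i))
    have hpos := (φ.2.2 n (Matrix.of fun i j => ⟨(x + star x) i j, hmem i j⟩) hxs).sum_nonneg
    have h1 : ∀ i j, φ.1 ⟨(x + star x) i j, hmem i j⟩ =
        φ.1 ⟨x i j, hx i j⟩ + star (φ.1 ⟨x j i, hx j i⟩) := by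
      intro i j
      rw [← φ.map_star (hx j i), ← map_add]
      rfl
    have h2 : ∑ i, ∑ j, (φ.1 ⟨(x + star x) i j, hmem i j⟩ i j).re =
        2 * ∑ i, ∑ j, (φ.1 ⟨x i j, hx i j⟩ i j).re := by
      rw [two_mul]
      conv_rhs => arg 2; rw [Finset.sum_comm]
      simp only [← Finset.sum_add_distrib]
      refine Finset.sum_congr rfl fun i _ => Finset.sum_congr rfl fun j _ => ?_
      rw [h1, Matrix.add_apply, Matrix.star_apply, Complex.add_re, RCLike.star_def, Complex.conj_re]
    have h3 := (Complex.nonneg_iff.1 hpos).1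
    simp only [Complex.re_sum] at h3
    refine nonneg_of_mul_nonneg_right (h3.trans_eq h2) two_pos
  have hdense : ∀ y, ∃ x : p, (x : Matrix (Fin n) (Fin n) A) + y ∈ s := by
    intro y
    obtain ⟨r, hr⟩ := Matrix.exists_isPos_smul_one_add (IsSelfAdjoint.add_star_self y)
    refine ⟨⟨(r / 2) • 1, fun i j => ?_⟩, ?_⟩
    · rw [Matrix.smul_apply, ← Complex.coe_smul, Matrix.one_apply]
      refine X.carrier.smul_mem _ ?_
      split_ifs
      exacts [X.one_mem, X.carrier.zero_mem]
    · change IsPos ((r / 2) • (1 : Matrix (Fin n) (Fin n) A) + y +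
        star ((r / 2) • (1 : Matrix (Fin n) (Fin n) A) + y))
      rw [star_add, star_smul (r / 2), star_trivial (r / 2), star_one, add_add_add_comm, ← add_smul,
        add_halves]
      exact hr
  obtain ⟨g, hgf, hgs⟩ := riesz_extension s ⟨p, f⟩ hnonneg hdense
  have hg : IsPosFunctional g := fun x hx => hgs x hx
  have hgs : ∀ (x : A) (hx : x ∈ X.carrier) (i j : Fin n),
      g (Matrix.single i j x) = (φ.1 ⟨x, hx⟩ i j).re := by
    intro x hx i j
    have hmem : Matrix.single i j x ∈ p := fun a b => by
      rw [Matrix.single_apply]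
      split_ifs
      exacts [hx, X.carrier.zero_mem]
    have h0 : ∀ a b, (φ.1 ⟨Matrix.single i j x a b, hmem a b⟩ a b).re =
        if i = a ∧ j = b then (φ.1 ⟨x, hx⟩ i j).re else 0 := by
      intro a b
      split_ifs with h
      · obtain ⟨rfl, rfl⟩ := h
        rw [show (⟨Matrix.single i j x i j, hmem i j⟩ : X.carrier) = ⟨x, hx⟩ from
          Subtype.ext (Matrix.single_apply_same i j x)]
      · have : (⟨Matrix.single i j x a b, hmem a b⟩ : X.carrier) = 0 := by
          ext
          exact Matrix.single_apply_of_ne _ _ _ _ _ h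
        rw [this, map_zero]
        rfl
    refine (hgf ⟨_, hmem⟩).trans ?_
    change ∑ a, ∑ b, (φ.1 ⟨Matrix.single i j x a b, hmem a b⟩ a b).re = _
    simp only [h0, ite_and]
    simp
  have hgX : ∀ (x : A) (hx : x ∈ X.carrier), cpMap g x = φ.1 ⟨x, hx⟩ := by
    intro x hx
    ext i j
    have hI : φ.1 ⟨Complex.I • x, X.carrier.smul_mem _ hx⟩ = Complex.I • φ.1 ⟨x, hx⟩ := by
      rw [← map_smul]
      rfl
    rw [cpMap_apply, Module.Dual.extendRCLike_apply, Matrix.smul_single, RCLike.I_to_complex,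
      hgs x hx, hgs _ (X.carrier.smul_mem _ hx), hI]
    apply Complex.ext <;> simp
  refine ⟨UCP.ofLinearMap X.univ (cpMap g) ?_ fun m x hx => hg.cpMap_isPos hx, hgX⟩
  rw [hgX 1 X.one_mem, φ.2.1]

/-- Positivity of a matrix over `X` is detected by the unital completely positive maps into matrix
algebras: a positive functional that is negative at `y` gives a completely positive map, which
is made unital by a perturbation and a conjugation. -/
theorem isPos_of_forall_ucp (X : OperatorSystem A) {m : ℕ} {y : Matrix (Fin m) (Fin m) X.carrier}
    (hy : IsSelfAdjoint (y.map (fun a => (a : A))))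
    (h : ∀ ψ : X.UCP m, IsPos (y.map (fun a => ψ.1 a))) : IsPos (y.map (fun a => (a : A))) := by
  by_contra hn
  obtain ⟨g, hg, hgy⟩ := Matrix.exists_posFunctional_neg hy hn
  obtain ⟨τ, hτ, hτ1⟩ := X.exists_state
  set Y := y.map (fun a => (a : A)) with hY
  obtain ⟨δ, hδ, hlt⟩ : ∃ δ : ℝ, 0 < δ ∧ g Y + diagFunctional m (δ • τ) Y < 0 := by
    have hpos : 0 < 2 * (|diagFunctional m τ Y| + 1) := by positivity
    refine ⟨-g Y / (2 * (|diagFunctional m τ Y| + 1)), div_pos (by linarith) hpos, ?_⟩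
    have h1 : ∀ δ : ℝ, diagFunctional m (δ • τ) Y = δ * diagFunctional m τ Y := by
      intro δ
      simp [diagFunctional, Finset.mul_sum]
    rw [h1]
    have h2 : -g Y / (2 * (|diagFunctional m τ Y| + 1)) * diagFunctional m τ Y ≤
        -g Y / (2 * (|diagFunctional m τ Y| + 1)) * (|diagFunctional m τ Y| + 1) :=
      mul_le_mul_of_nonneg_left (by linarith [le_abs_self (diagFunctional m τ Y)])
        (div_pos (by linarith) hpos).le
    have h3 : -g Y / (2 * (|diagFunctional m τ Y| + 1)) * (|diagFunctional m τ Y| + 1) =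
        -g Y / 2 := by
      field_simp
    linarith
  have hτδ : IsPosFunctional (δ • τ) := hτ.smul hδ.le
  have hg' : IsPosFunctional (g + diagFunctional m (δ • τ)) := hg.add hτδ.diagFunctional
  set Φ := cpMap (g + diagFunctional m (δ • τ)) with hΦ
  -- The summand `δ • τ` makes `Φ 1` invertible, so that `Φ` can be normalized to a unital map.
  obtain ⟨C, hC, hCu⟩ : ∃ C : Matrix (Fin m) (Fin m) ℂ, Φ 1 = star C * C ∧ IsUnit C := by
    have h1 : IsPos (cpMap g 1) :=
      (hg.cpMap_isPos (isPos_one (R := Matrix (Fin 1) (Fin 1) A))).apply_zero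
    have h2 : (Φ 1).PosDef := by
      rw [hΦ, cpMap_add, LinearMap.add_apply, cpMap_diagFunctional,
        hτδ.extendRCLike_eq (IsSelfAdjoint.one _), LinearMap.smul_apply, hτ1]
      refine Matrix.PosDef.posSemidef_add (Matrix.isPos_iff_posSemidef.1 h1) ?_
      refine Matrix.PosDef.one.smul ?_
      simpa using hδ
    obtain ⟨C, hC⟩ := Matrix.isPos_iff_posSemidef.2 h2.posSemidef
    refine ⟨C, hC, ?_⟩
    have := h2.isUnit
    rw [hC, Matrix.isUnit_iff_isUnit_det, Matrix.det_mul] at this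
    exact (Matrix.isUnit_iff_isUnit_det _).2 (isUnit_of_mul_isUnit_right this)
  obtain ⟨D, hD⟩ := hCu.exists_right_inv
  obtain ⟨ψ, hψ⟩ : ∃ ψ : X.UCP m, ∀ x : X.carrier, ψ.1 x = star D * Φ x * D := by
    refine ⟨UCP.ofLinearMap X
      (LinearMap.mulRight ℂ D ∘ₗ LinearMap.mulLeft ℂ (star D) ∘ₗ Φ) ?_ ?_, fun x => rfl⟩
    · simp only [LinearMap.comp_apply, LinearMap.mulLeft_apply, LinearMap.mulRight_apply, hC]
      rw [show star D * (star C * C) * D = star (C * D) * (C * D) by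
        rw [star_mul]; simp only [mul_assoc], hD, star_one, one_mul]
    · intro k x hx
      obtain ⟨b, hb⟩ := hg'.cpMap_isPos hx
      refine ⟨b * Matrix.diagonal fun _ => D, ?_⟩
      rw [star_mul, Matrix.star_eq_conjTranspose (Matrix.diagonal _), Matrix.diagonal_conjTranspose,
        mul_assoc, ← mul_assoc (star b), ← hb]
      ext i j : 2
      simp [Matrix.mul_assoc, hΦ]
  have hCD : D * C = 1 := mul_eq_one_comm.1 hD
  have hpos : IsPos (Y.map Φ) := by
    obtain ⟨b, hb⟩ := h ψ
    refine ⟨b * Matrix.diagonal fun _ => C, ?_⟩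
    rw [star_mul, Matrix.star_eq_conjTranspose (Matrix.diagonal _), Matrix.diagonal_conjTranspose,
        mul_assoc, ← mul_assoc (star b), ← hb]
    ext i j : 2
    have : star C * (star D * Φ (y i j) * D) * C = Φ (y i j) := by
      rw [show star C * (star D * Φ (y i j) * D) * C = star (D * C) * Φ (y i j) * (D * C) by
        rw [star_mul]; simp only [mul_assoc], hCD, star_one, one_mul, mul_one]
    simp only [Matrix.map_apply, Matrix.diagonal_mul, Matrix.mul_diagonal, hψ, hY,
      ← Matrix.mul_assoc] at this ⊢
    exact congrFun (congrFun this.symm _) _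
  have h1 := hpos.sum_nonneg
  simp only [Matrix.map_apply] at h1
  rw [hΦ, sum_cpMap_apply, hg'.extendRCLike_eq hy] at h1
  have h2 : 0 ≤ g Y + diagFunctional m (δ • τ) Y := by exact_mod_cast h1
  linarith

end OperatorSystem

/-! ### State spaces of order-unit subspaces -/

namespace OrderUnitState

variable {A : Type u} [CStarAlgebra A] {D : Submodule ℝ A}

theorem map_smul_one (μ : OrderUnitState D) (r : ℝ) (h : r • (1 : A) ∈ D) (h1 : (1 : A) ∈ D) :
    μ.1 ⟨r • 1, h⟩ = r := by
  have : (⟨r • 1, h⟩ : D) = r • ⟨1, h1⟩ := rfl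
  rw [this, map_smul, μ.2.1 ⟨1, h1⟩ rfl, smul_eq_mul, mul_one]

theorem abs_map_le (μ : OrderUnitState D) (h1 : (1 : A) ∈ D) (d : D) (hd : IsSelfAdjoint (d : A)) :
    |μ.1 d| ≤ ‖(d : A)‖ := by
  have hp := μ.2.2 (‖(d : A)‖ • ⟨1, h1⟩ + d) (isPos_smul_one_add hd le_rfl)
  have hm := μ.2.2 (‖(d : A)‖ • ⟨1, h1⟩ - d) (isPos_smul_one_sub hd le_rfl)
  rw [map_add, map_smul, μ.2.1 ⟨1, h1⟩ rfl, smul_eq_mul, mul_one] at hp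
  rw [map_sub, map_smul, μ.2.1 ⟨1, h1⟩ rfl, smul_eq_mul, mul_one] at hm
  exact abs_le.2 ⟨by linarith, by linarith⟩

/-- The restriction of a state of the C⋆-algebra. -/
def ofFunctional (D : Submodule ℝ A) {g : A →ₗ[ℝ] ℝ} (hg : IsPosFunctional g) (h1 : g 1 = 1) :
    OrderUnitState D :=
  ⟨g ∘ₗ D.subtype, fun d hd => by simp [hd, h1], fun _ hd => hg.nonneg hd⟩

theorem exists_norm_le [Nontrivial A] {d : D} (hd : IsSelfAdjoint (d : A)) :
    ∃ μ : OrderUnitState D, ‖(d : A)‖ ≤ |μ.1 d| := by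
  obtain ⟨g, hg, h1, h⟩ := exists_state_norm_le hd
  exact ⟨ofFunctional D hg h1, h⟩

/-- The state space is a closed subset of a product of compact intervals. -/
theorem compactSpace (h1 : (1 : A) ∈ D) (hD : ∀ d ∈ D, IsSelfAdjoint d) :
    @CompactSpace (OrderUnitState D) (weakStar D) := by
  let _ := weakStar D
  have hind : Topology.IsInducing (fun (μ : OrderUnitState D) (d : D) => μ.1 d) := ⟨rfl⟩
  refine ⟨?_⟩
  rw [hind.isCompact_iff, Set.image_univ]
  have hsub : Set.range (fun (μ : OrderUnitState D) (d : D) => μ.1 d) ⊆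
      Set.univ.pi fun d : D => Set.Icc (-‖(d : A)‖) ‖(d : A)‖ := by
    rintro _ ⟨μ, rfl⟩ d -
    exact abs_le.1 (μ.abs_map_le h1 d (hD d d.2))
  refine (isCompact_univ_pi fun d : D => isCompact_Icc).of_isClosed_subset ?_ hsub
  have heq : Set.range (fun (μ : OrderUnitState D) (d : D) => μ.1 d) =
      {f | ∀ d e, f (d + e) = f d + f e} ∩ {f | ∀ (r : ℝ) d, f (r • d) = r * f d} ∩
      {f | ∀ d : D, (d : A) = 1 → f d = 1} ∩ {f | ∀ d : D, IsPos (d : A) → 0 ≤ f d} := by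
    ext f
    constructor
    · rintro ⟨μ, rfl⟩
      exact ⟨⟨⟨fun d e => map_add _ _ _, fun r d => by simp⟩, μ.2.1⟩, μ.2.2⟩
    · rintro ⟨⟨⟨ha, hs⟩, ho⟩, hp⟩
      exact ⟨⟨{ toFun := f, map_add' := ha, map_smul' := by simpa using hs }, ho, hp⟩, rfl⟩
  rw [heq]
  refine ((IsClosed.inter ?_ ?_).inter ?_).inter ?_
  · simp only [Set.ofPred_forall]
    exact isClosed_iInter fun d => isClosed_iInter fun e =>
      isClosed_eq (continuous_apply (d + e)) ((continuous_apply d).add (continuous_apply e))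
  · simp only [Set.ofPred_forall]
    exact isClosed_iInter fun r => isClosed_iInter fun d =>
      isClosed_eq (continuous_apply _) (continuous_const.mul (continuous_apply _))
  · simp only [Set.ofPred_forall]
    exact isClosed_iInter fun d => isClosed_iInter fun _ =>
      isClosed_eq (continuous_apply _) continuous_const
  · simp only [Set.ofPred_forall]
    exact isClosed_iInter fun d => isClosed_iInter fun _ =>
      isClosed_le continuous_const (continuous_apply _)

/-- The convex combination `(1 - s) μ + s ν`. -/
def mix (μ ν : OrderUnitState D) (s : Set.Icc (0 : ℝ) 1) : OrderUnitState D :=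
  ⟨(1 - s.1) • μ.1 + s.1 • ν.1, fun d hd => by simp [μ.2.1 d hd, ν.2.1 d hd], fun d hd =>
    add_nonneg (mul_nonneg (sub_nonneg.2 s.2.2) (μ.2.2 d hd)) (mul_nonneg s.2.1 (ν.2.2 d hd))⟩

end OrderUnitState

/-! ### The unit ball of a Lip-norm -/

namespace LipNorm

variable {A : Type u} [CStarAlgebra A] {X : OperatorSystem A} (L : LipNorm X)

/-- The unit ball `{a ∈ 𝓓(L) : L(a) ≤ 1}`, as a subset of the C⋆-algebra. -/
def ball : Set A := {x : A | ∃ h : x ∈ L.dom, L.L ⟨x, h⟩ ≤ 1}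

variable {L}

theorem dom_subset {x : A} (h : x ∈ L.dom) : x ∈ X.carrier := (L.dom_le h).1

theorem isSelfAdjoint_of_mem_dom {x : A} (h : x ∈ L.dom) : IsSelfAdjoint x := (L.dom_le h).2

theorem le_iff {x : A} (h : x ∈ L.dom) {r : ℝ} (hr : 0 < r) :
    L.L ⟨x, h⟩ ≤ r ↔ r⁻¹ • x ∈ L.ball := by
  have h1 : L.L (r⁻¹ • ⟨x, h⟩) = r⁻¹ * L.L ⟨x, h⟩ := by
    rw [map_smul_eq_mul, Real.norm_of_nonneg (inv_nonneg.2 hr.le)]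
  have h2 : r⁻¹ • x ∈ L.ball ↔ L.L (r⁻¹ • ⟨x, h⟩) ≤ 1 :=
    ⟨fun ⟨_, h⟩ => h, fun h' => ⟨L.dom.smul_mem _ h, h'⟩⟩
  rw [h2, h1, inv_mul_le_iff₀ hr, mul_one]

theorem exists_smul_mem_ball {x : A} (h : x ∈ L.dom) : ∃ t : ℝ, 0 < t ∧ t • x ∈ L.ball :=
  ⟨(L.L ⟨x, h⟩ + 1)⁻¹, by positivity, (le_iff h (by positivity)).1 (by linarith)⟩

theorem convex_ball : Convex ℝ L.ball := by
  rintro x ⟨hx, hx1⟩ y ⟨hy, hy1⟩ a b ha hb hab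
  refine ⟨L.dom.add_mem (L.dom.smul_mem _ hx) (L.dom.smul_mem _ hy), ?_⟩
  calc L.L (a • ⟨x, hx⟩ + b • ⟨y, hy⟩) ≤ a * L.L ⟨x, hx⟩ + b * L.L ⟨y, hy⟩ := by
        refine (map_add_le_add _ _ _).trans_eq ?_
        rw [map_smul_eq_mul, map_smul_eq_mul, Real.norm_of_nonneg ha, Real.norm_of_nonneg hb]
    _ ≤ a * 1 + b * 1 := by gcongr
    _ = 1 := by linarith

theorem smul_mem_ball {x : A} (hx : x ∈ L.ball) {t : ℝ} (ht : |t| ≤ 1) : t • x ∈ L.ball := by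
  refine ⟨L.dom.smul_mem _ hx.1, ?_⟩
  change L.L (t • ⟨x, hx.1⟩) ≤ 1
  rw [map_smul_eq_mul]
  exact mul_le_one₀ ht (apply_nonneg _ _) hx.2

theorem neg_mem_ball {x : A} (hx : x ∈ L.ball) : -x ∈ L.ball := by
  simpa using smul_mem_ball hx (t := -1) (by simp)

theorem smul_one_mem_dom (r : ℝ) : r • (1 : A) ∈ L.dom := L.dom.smul_mem _ L.one_mem

theorem smul_one_mem_ball (r : ℝ) : r • (1 : A) ∈ L.ball :=
  ⟨smul_one_mem_dom r, ((L.eq_zero_iff ⟨_, smul_one_mem_dom r⟩).2 ⟨r, rfl⟩).trans_le zero_le_one⟩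

theorem add_smul_one_mem_ball {x : A} (hx : x ∈ L.ball) (r : ℝ) : x + r • (1 : A) ∈ L.ball := by
  refine ⟨L.dom.add_mem hx.1 (smul_one_mem_dom r), ?_⟩
  have h0 := (L.eq_zero_iff ⟨_, smul_one_mem_dom r⟩).2 ⟨r, rfl⟩
  have := map_add_le_add L.L ⟨x, hx.1⟩ ⟨_, smul_one_mem_dom r⟩
  exact this.trans (by rw [h0, add_zero]; exact hx.2)

theorem sub_smul_one_mem_ball {x : A} (hx : x ∈ L.ball) (r : ℝ) : x - r • (1 : A) ∈ L.ball := by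
  simpa [sub_eq_add_neg] using add_smul_one_mem_ball hx (-r)

/-- Finitely many states approximate all states uniformly on the unit ball: the state space is
weak⋆ compact, and the Lip-norm metric induces the weak⋆ topology. -/
theorem exists_finset_states (L : LipNorm X) {ε : ℝ} (hε : 0 < ε) :
    ∃ t : Finset (OrderUnitState L.dom), ∀ ν : OrderUnitState L.dom, ∃ μ ∈ t,
      ∀ (a : A) (ha : a ∈ L.ball), |ν.1 ⟨a, ha.1⟩ - μ.1 ⟨a, ha.1⟩| ≤ ε := by
  let _ := OrderUnitState.weakStar L.dom
  have := OrderUnitState.compactSpace (D := L.dom) L.one_mem fun d hd => isSelfAdjoint_of_mem_dom hd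
  let ρ := OrderUnitState.rho L.dom L.L
  let U : OrderUnitState L.dom → Set (OrderUnitState L.dom) := fun μ =>
    {ν | ρ.edist ν μ < ENNReal.ofReal ε}
  have hU : ∀ μ, U μ ∈ nhds μ := by
    intro μ
    have h1 : U μ ∈ @nhds _ ρ.toUniformSpace.toTopologicalSpace μ :=
      @Metric.eball_mem_nhds _ ρ μ _ (ENNReal.ofReal_pos.2 hε)
    rw [L.induces_weakStar] at h1
    exact h1
  obtain ⟨t, -, ht⟩ := isCompact_univ.elim_nhds_subcover U fun μ _ => hU μ
  refine ⟨t, fun ν => ?_⟩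
  obtain ⟨μ, hμ, hν⟩ := Set.mem_iUnion₂.1 (ht (Set.mem_univ ν))
  refine ⟨μ, hμ, fun a ha => ?_⟩
  have h2 : edist (ν.1 ⟨a, ha.1⟩) (μ.1 ⟨a, ha.1⟩) ≤ ENNReal.ofReal ε :=
    (le_iSup (fun i : {a : L.dom // L.L a ≤ 1} => edist (ν.1 i.1) (μ.1 i.1))
      ⟨⟨a, ha.1⟩, ha.2⟩).trans hν.le
  rw [edist_dist, ENNReal.ofReal_le_ofReal_iff hε.le, Real.dist_eq] at h2
  exact h2

/-- Any two states are at finite distance: otherwise the segment between them would not be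
continuous. -/
theorem exists_abs_sub_le (μ ν : OrderUnitState L.dom) :
    ∃ C : ℝ, ∀ (a : A) (ha : a ∈ L.ball), |ν.1 ⟨a, ha.1⟩ - μ.1 ⟨a, ha.1⟩| ≤ C := by
  let _ := OrderUnitState.weakStar L.dom
  have hind : Topology.IsInducing (fun (μ : OrderUnitState L.dom) (d : L.dom) => μ.1 d) := ⟨rfl⟩
  let s : ℕ → Set.Icc (0 : ℝ) 1 := fun n => ⟨1 / ((n : ℝ) + 1), by positivity, by
    rw [div_le_one (by positivity)]; linarith [n.cast_nonneg (α := ℝ)]⟩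
  have hs : Filter.Tendsto (fun n => (s n : ℝ)) Filter.atTop (nhds 0) :=
    tendsto_one_div_add_atTop_nhds_zero_nat
  have hlim : Filter.Tendsto (fun n => OrderUnitState.mix μ ν (s n)) Filter.atTop (nhds μ) := by
    rw [hind.tendsto_nhds_iff, tendsto_pi_nhds]
    intro d
    have : Filter.Tendsto (fun n => (1 - (s n : ℝ)) * μ.1 d + (s n : ℝ) * ν.1 d) Filter.atTop
        (nhds ((1 - 0) * μ.1 d + 0 * ν.1 d)) :=
      ((tendsto_const_nhds.sub hs).mul_const _).add (hs.mul_const _)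
    rw [sub_zero, one_mul, zero_mul, add_zero] at this
    exact this
  let ρ := OrderUnitState.rho L.dom L.L
  have h1 : {ν | ρ.edist ν μ < ENNReal.ofReal 1} ∈ @nhds _ ρ.toUniformSpace.toTopologicalSpace μ :=
    @Metric.eball_mem_nhds _ ρ μ _ (ENNReal.ofReal_pos.2 one_pos)
  rw [L.induces_weakStar] at h1
  obtain ⟨n, hn⟩ := (hlim.eventually h1).exists
  refine ⟨n + 1, fun a ha => ?_⟩
  have h2 : edist ((OrderUnitState.mix μ ν (s n)).1 ⟨a, ha.1⟩) (μ.1 ⟨a, ha.1⟩) ≤ ENNReal.ofReal 1 :=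
    (le_iSup (fun i : {a : L.dom // L.L a ≤ 1} =>
      edist ((OrderUnitState.mix μ ν (s n)).1 i.1) (μ.1 i.1)) ⟨⟨a, ha.1⟩, ha.2⟩).trans hn.le
  rw [edist_dist, ENNReal.ofReal_le_ofReal_iff zero_le_one, Real.dist_eq] at h2
  have h3 : (OrderUnitState.mix μ ν (s n)).1 ⟨a, ha.1⟩ - μ.1 ⟨a, ha.1⟩ =
      1 / ((n : ℝ) + 1) * (ν.1 ⟨a, ha.1⟩ - μ.1 ⟨a, ha.1⟩) := by
    change (1 - 1 / ((n : ℝ) + 1)) * μ.1 ⟨a, ha.1⟩ + 1 / ((n : ℝ) + 1) * ν.1 ⟨a, ha.1⟩ - _ = _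
    ring
  rw [h3, abs_mul, abs_of_nonneg (by positivity), one_div, inv_mul_le_iff₀ (by positivity),
    mul_one] at h2
  exact h2

/-- The unit ball of a Lip-norm has finite radius modulo scalars. -/
theorem exists_radius (L : LipNorm X) :
    ∃ C : ℝ, 0 ≤ C ∧ ∀ a ∈ L.ball, ∃ r : ℝ, ‖a - r • (1 : A)‖ ≤ C := by
  have := X.nontrivial
  obtain ⟨g, hg, hg1⟩ := X.exists_state
  let μ₀ := OrderUnitState.ofFunctional L.dom hg hg1
  obtain ⟨t, ht⟩ := L.exists_finset_states one_pos
  choose C hC using fun μ => exists_abs_sub_le (L := L) μ₀ μ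
  refine ⟨1 + ∑ μ ∈ t, |C μ|, by positivity, fun a ha => ⟨μ₀.1 ⟨a, ha.1⟩, ?_⟩⟩
  have hmem := (sub_smul_one_mem_ball ha (μ₀.1 ⟨a, ha.1⟩)).1
  obtain ⟨ν, hν⟩ := OrderUnitState.exists_norm_le (d := ⟨_, hmem⟩) (isSelfAdjoint_of_mem_dom hmem)
  refine hν.trans ?_
  have h1 : ν.1 ⟨_, hmem⟩ = ν.1 ⟨a, ha.1⟩ - μ₀.1 ⟨a, ha.1⟩ := by
    have h := ν.map_smul_one (μ₀.1 ⟨a, ha.1⟩) (smul_one_mem_dom _) L.one_mem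
    refine Eq.trans ?_ (congrArg (fun s => ν.1 ⟨a, ha.1⟩ - s) h)
    rw [← map_sub]
    rfl
  obtain ⟨μ, hμ, hμν⟩ := ht ν
  rw [h1]
  have h2 := (hC μ a ha).trans (le_abs_self _)
  have h3 := Finset.single_le_sum (f := fun μ => |C μ|) (fun _ _ => abs_nonneg _) hμ
  have h4 := abs_sub_le (ν.1 ⟨a, ha.1⟩) (μ.1 ⟨a, ha.1⟩) (μ₀.1 ⟨a, ha.1⟩)
  have h5 := hμν a ha
  linarith

/-- Bounded parts of the unit ball are compact: up to `ε`, an element is determined by its values,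
rounded to multiples of `ε / 4`, at finitely many states. -/
theorem isCompact_ball_inter (L : LipNorm X) (R : ℝ) :
    IsCompact (L.ball ∩ Metric.closedBall 0 R) := by
  have := X.nontrivial
  have hcl : IsClosed (L.ball ∩ Metric.closedBall 0 R) :=
    L.isClosed.inter Metric.isClosed_closedBall
  refine isCompact_iff_totallyBounded_isComplete.2 ⟨?_, hcl.isComplete⟩
  refine Metric.totallyBounded_of_finite_discretization fun ε hε => ?_
  obtain ⟨t, ht⟩ := L.exists_finset_states (ε := ε / 4) (by positivity)
  let F : (L.ball ∩ Metric.closedBall 0 R : Set A) → t →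
      Finset.Icc (⌊-R / (ε / 4)⌋) (⌊R / (ε / 4)⌋) := fun a μ =>
    ⟨⌊μ.1.1 ⟨a.1, a.2.1.1⟩ / (ε / 4)⌋, by
      have h1 := μ.1.abs_map_le L.one_mem ⟨a.1, a.2.1.1⟩ (isSelfAdjoint_of_mem_dom a.2.1.1)
      have h2 : ‖a.1‖ ≤ R := by simpa using a.2.2
      have h3 := abs_le.1 (h1.trans h2)
      rw [Finset.mem_Icc]
      exact ⟨Int.floor_le_floor (by gcongr; exact h3.1),
        Int.floor_le_floor (by gcongr; exact h3.2)⟩⟩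
  refine ⟨_, Fintype.ofFinite _, F, fun a b hab => ?_⟩
  rw [dist_eq_norm]
  have hmem := L.dom.sub_mem a.2.1.1 b.2.1.1
  obtain ⟨ν, hν⟩ := OrderUnitState.exists_norm_le (d := ⟨_, hmem⟩) (isSelfAdjoint_of_mem_dom hmem)
  refine hν.trans_lt ?_
  have h1 : ν.1 ⟨_, hmem⟩ = ν.1 ⟨a.1, a.2.1.1⟩ - ν.1 ⟨b.1, b.2.1.1⟩ := by
    rw [← map_sub]
    rfl
  obtain ⟨μ, hμ, hμν⟩ := ht ν
  have h2 := abs_le.1 (hμν a.1 a.2.1)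
  have h3 := abs_le.1 (hμν b.1 b.2.1)
  have h4 := Int.abs_sub_lt_one_of_floor_eq_floor (congrArg Subtype.val (congrFun hab ⟨μ, hμ⟩))
  rw [← sub_div, abs_div, abs_of_pos (by positivity : 0 < ε / 4), div_lt_one (by positivity)] at h4
  have h5 := abs_lt.1 h4
  simp only at h5
  rw [h1, abs_lt]
  constructor <;> linarith [h2.1, h2.2, h3.1, h3.2, h5.1, h5.2]

end LipNorm

/-! ### Lip-norms from their unit balls -/

section OfBall

variable {A : Type u} [CStarAlgebra A]

theorem isClosed_of_isCompact_inter_closedBall {U : Set A}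
    (h : ∀ R : ℝ, IsCompact (U ∩ Metric.closedBall 0 R)) : IsClosed U := by
  refine isClosed_of_closure_subset fun x hx => ?_
  have h1 : x ∈ closure (Metric.ball (0 : A) (‖x‖ + 1) ∩ U) :=
    Metric.isOpen_ball.inter_closure ⟨by simp, hx⟩
  have h2 := closure_mono (t := U ∩ Metric.closedBall 0 (‖x‖ + 1))
    (fun y hy => ⟨hy.2, Metric.ball_subset_closedBall hy.1⟩) h1
  rw [(h _).isClosed.closure_eq] at h2
  exact h2.1

/-- The data of a Lip-norm on `X` in terms of its domain `D` and its unit ball `U`. The conditions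
`isCompact` and `radius` together say that `U` is closed and compact modulo the scalars, which is
equivalent to the Lip-norm metric inducing the weak⋆ topology. -/
structure LipBall (X : OperatorSystem A) (D : Submodule ℝ A) (U : Set A) : Prop where
  dom_le : D ≤ X.sa
  dense : (X.sa : Set A) ⊆ closure (D : Set A)
  subset : U ⊆ D
  convex : Convex ℝ U
  neg_mem : ∀ x ∈ U, -x ∈ U
  smul_one_mem : ∀ r : ℝ, r • (1 : A) ∈ U
  absorbs : ∀ x ∈ D, ∃ t : ℝ, 0 < t ∧ t • x ∈ U
  isCompact : ∀ R : ℝ, IsCompact (U ∩ Metric.closedBall 0 R)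
  radius : ∃ C : ℝ, ∀ a ∈ U, ∃ r : ℝ, ‖a - r • (1 : A)‖ ≤ C

namespace LipBall

variable {X : OperatorSystem A} {D : Submodule ℝ A} {U : Set A}

theorem zero_mem (h : LipBall X D U) : (0 : A) ∈ U := by simpa using h.smul_one_mem 0

theorem smul_mem (h : LipBall X D U) {x : A} (hx : x ∈ U) {t : ℝ} (ht : |t| ≤ 1) : t • x ∈ U := by
  have key : ∀ y ∈ U, |t| • y ∈ U := fun y hy => h.convex.smul_mem_of_zero_mem h.zero_mem hy
    ⟨abs_nonneg _, ht⟩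
  rcases abs_choice t with h' | h'
  · rw [← h']; exact key x hx
  · have := key _ (h.neg_mem x hx)
    rwa [h', neg_smul_neg] at this

theorem absorbent (h : LipBall X D U) : Absorbent ℝ {d : D | (d : A) ∈ U} := by
  rw [absorbent_iff_eventually_nhdsNE_zero]
  intro x
  obtain ⟨t, ht, hx⟩ := h.absorbs x x.2
  filter_upwards [nhdsWithin_le_nhds (Metric.ball_mem_nhds (0 : ℝ) ht)] with c hc
  have h1 := h.smul_mem hx (t := c / t) (by
    rw [abs_div, abs_of_pos ht, div_le_one ht]
    simpa using (mem_ball_zero_iff.1 hc).le)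
  rwa [smul_smul, div_mul_cancel₀ _ ht.ne'] at h1

theorem convex_coe (h : LipBall X D U) : Convex ℝ {d : D | (d : A) ∈ U} :=
  fun _ hx _ hy _ _ ha hb hab => h.convex hx hy ha hb hab

/-- The Minkowski functional of the unit ball. -/
def seminorm (h : LipBall X D U) : Seminorm ℝ D :=
  gaugeSeminorm (s := {d : D | (d : A) ∈ U})
    (by
      rintro t ht _ ⟨x, hx, rfl⟩
      exact h.smul_mem hx (by simpa using ht))
    h.convex_coe h.absorbent

theorem isClosed (h : LipBall X D U) : IsClosed U :=
  isClosed_of_isCompact_inter_closedBall h.isCompact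

theorem seminorm_le_one_iff (h : LipBall X D U) (d : D) : h.seminorm d ≤ 1 ↔ (d : A) ∈ U := by
  refine ⟨fun hd => ?_, fun hd => gauge_le_one_of_mem (s := {d : D | (d : A) ∈ U}) hd⟩
  have h1 : ∀ r : ℝ, 1 < r → r⁻¹ • (d : A) ∈ U := by
    intro r hr
    by_contra hn
    have h2 : r ≤ gauge {d : D | (d : A) ∈ U} d := by
      refine le_gauge_of_notMem (h.convex_coe.starConvex h.zero_mem) (h.absorbent d) ?_
      rwa [Set.mem_smul_set_iff_inv_smul_mem₀ (zero_lt_one.trans hr).ne']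
    exact absurd (h2.trans hd) (not_le.2 hr)
  have h2 : Filter.Tendsto (fun r : ℝ => r⁻¹ • (d : A)) (nhdsWithin 1 (Set.Ioi 1))
      (nhds ((1 : ℝ)⁻¹ • (d : A))) :=
    (((continuousAt_inv₀ one_ne_zero).tendsto).smul_const _).mono_left nhdsWithin_le_nhds
  rw [inv_one, one_smul] at h2
  exact h.isClosed.mem_of_tendsto h2
    (by filter_upwards [self_mem_nhdsWithin] with r hr using h1 r hr)

theorem smul_mem_of_seminorm_le (h : LipBall X D U) {d : D} {r : ℝ} (hr : 0 < r)
    (hd : h.seminorm d ≤ r) : r⁻¹ • (d : A) ∈ U := by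
  refine (h.seminorm_le_one_iff (r⁻¹ • d)).1 ?_
  rw [map_smul_eq_mul, Real.norm_of_nonneg (inv_nonneg.2 hr.le), inv_mul_le_iff₀ hr, mul_one]
  exact hd

theorem seminorm_eq_zero_iff (h : LipBall X D U) (d : D) :
    h.seminorm d = 0 ↔ ∃ r : ℝ, (d : A) = r • (1 : A) := by
  constructor
  · intro h0
    obtain ⟨C, hC⟩ := h.radius
    have hcl : IsClosed ((Submodule.span ℝ {(1 : A)} : Submodule ℝ A) : Set A) :=
      Submodule.closed_of_finiteDimensional _
    -- All multiples of `d` are in `U`, hence within `C` of the scalars.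
    have hmem : (d : A) ∈ ((Submodule.span ℝ {(1 : A)} : Submodule ℝ A) : Set A) := by
      rw [← hcl.closure_eq, Metric.mem_closure_iff]
      intro ε hε
      have hCp : 0 < |C| + 1 := by positivity
      obtain ⟨r, hr⟩ := hC _ (h.smul_mem_of_seminorm_le (d := d) (r := ε / (|C| + 1))
        (by positivity)
        (h0.trans_le (by positivity)))
      refine ⟨(ε / (|C| + 1) * r) • 1,
        Submodule.smul_mem _ _ (Submodule.mem_span_singleton_self _), ?_⟩
      rw [dist_eq_norm]
      have h2 : (d : A) - (ε / (|C| + 1) * r) • (1 : A) =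
          (ε / (|C| + 1)) • ((ε / (|C| + 1))⁻¹ • (d : A) - r • (1 : A)) := by
        rw [smul_sub, smul_smul, smul_smul, mul_inv_cancel₀ (by positivity), one_smul]
      rw [h2, norm_smul, Real.norm_of_nonneg (by positivity), div_mul_eq_mul_div,
        div_lt_iff₀ hCp]
      have := hr.trans (le_abs_self C)
      gcongr
      linarith
    obtain ⟨r, hr⟩ := Submodule.mem_span_singleton.1 hmem
    exact ⟨r, hr.symm⟩
  · rintro ⟨r, hr⟩
    refine le_antisymm (le_of_forall_pos_le_add fun ε hε => ?_) (apply_nonneg _ _)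
    have h1 : h.seminorm (ε⁻¹ • d) ≤ 1 := by
      rw [seminorm_le_one_iff]
      change ε⁻¹ • (d : A) ∈ U
      rw [hr, smul_smul]
      exact h.smul_one_mem _
    rwa [map_smul_eq_mul, Real.norm_of_nonneg (inv_nonneg.2 hε.le), inv_mul_le_iff₀ hε, mul_one,
      ← zero_add ε] at h1

theorem one_mem (h : LipBall X D U) : (1 : A) ∈ D := by simpa using h.subset (h.smul_one_mem 1)

/-- The Lip-norm metric is finer than the weak⋆ topology as `U` is absorbing, and coarser as a
finite set is dense in `U` up to scalars and a given error, and states agree at scalars. -/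
theorem induces_weakStar (h : LipBall X D U) :
    (OrderUnitState.rho D h.seminorm).toUniformSpace.toTopologicalSpace =
      OrderUnitState.weakStar D := by
  refine le_antisymm ?_ ?_
  · rw [← continuous_iff_le_induced]
    let _ := OrderUnitState.rho D h.seminorm
    refine continuous_pi fun d => ?_
    obtain ⟨t, ht, hd⟩ := h.absorbs d d.2
    have hlip : LipschitzWith (Real.toNNReal t⁻¹) (fun μ : OrderUnitState D => μ.1 d) := by
      intro μ ν
      have h1 : edist (μ.1 (t • d)) (ν.1 (t • d)) ≤ edist μ ν :=
        le_iSup (fun i : {a : D // h.seminorm a ≤ 1} => edist (μ.1 i.1) (ν.1 i.1))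
          ⟨t • d, (h.seminorm_le_one_iff _).2 hd⟩
      rw [map_smul, map_smul, edist_smul₀] at h1
      have h2 : Real.toNNReal t⁻¹ * ‖t‖₊ = 1 := by
        ext
        simp [abs_of_pos ht, max_eq_left (inv_nonneg.2 ht.le), ht.ne']
      calc edist (μ.1 d) (ν.1 d) = (Real.toNNReal t⁻¹ * ‖t‖₊ : NNReal) • edist (μ.1 d) (ν.1 d) := by
            rw [h2, one_smul]
        _ = Real.toNNReal t⁻¹ * (‖t‖₊ • edist (μ.1 d) (ν.1 d)) := by
            rw [mul_smul, ENNReal.smul_def, smul_eq_mul]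
        _ ≤ _ := by gcongr
    exact hlip.continuous
  · refine le_of_nhds_le_nhds fun μ => ?_
    let ρ := OrderUnitState.rho D h.seminorm
    rw [(@Metric.nhds_basis_eball _ ρ μ).ge_iff]
    intro ε hε
    obtain ⟨δ, hδ0, hδ⟩ := ENNReal.lt_iff_exists_nnreal_btwn.1 hε
    have hδ0 : (0 : ℝ) < δ := by exact_mod_cast hδ0
    obtain ⟨C, hC⟩ := h.radius
    obtain ⟨F, hFU, hF, hcov⟩ := (h.isCompact C).finite_cover_balls (e := δ / 3) (by positivity)
    let _ := OrderUnitState.weakStar D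
    have hind : Topology.IsInducing (fun (μ : OrderUnitState D) (d : D) => μ.1 d) := ⟨rfl⟩
    have hev : ∀ d : D, Continuous fun μ : OrderUnitState D => μ.1 d := fun d =>
      (continuous_apply d).comp hind.continuous
    have hnhds : ∀ d : D, ∀ᶠ ν in nhds μ, dist (ν.1 d) (μ.1 d) < δ / 3 := fun d =>
      (hev d).continuousAt.eventually (Metric.ball_mem_nhds _ (by positivity))
    have hall : ∀ᶠ ν in nhds μ, ∀ f : D, (f : A) ∈ F → dist (ν.1 f) (μ.1 f) < δ / 3 := by
      have hF' : ((↑) ⁻¹' F : Set D).Finite := hF.preimage Subtype.val_injective.injOn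
      exact (Filter.eventually_all_finite hF').2 fun d _ => hnhds d
    filter_upwards [hall] with ν hν
    refine lt_of_le_of_lt (iSup_le fun i => ?_) hδ
    obtain ⟨a, ha⟩ := i
    have haU := (h.seminorm_le_one_iff a).1 ha
    obtain ⟨r, hr⟩ := hC _ haU
    -- Subtracting a scalar from `a` does not change `ν a - μ a`.
    have h1D := h.one_mem
    have hstate : ∀ μ : OrderUnitState D, μ.1 (a - r • ⟨1, h1D⟩) = μ.1 a - r := by
      intro μ
      rw [map_sub, map_smul, μ.2.1 ⟨1, h1D⟩ rfl, smul_eq_mul, mul_one]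
    have haU' : ((a - r • ⟨1, h1D⟩ : D) : A) ∈ U := by
      have h0 := (h.seminorm_eq_zero_iff (r • ⟨1, h1D⟩)).2 ⟨r, rfl⟩
      rw [← h.seminorm_le_one_iff]
      exact (map_sub_le_add _ _ _).trans (by rw [h0, add_zero]; exact ha)
    obtain ⟨f, hf, haf⟩ := Set.mem_iUnion₂.1 (hcov ⟨haU', by simpa using hr⟩)
    have hfD := h.subset (hFU hf).1
    have hdiff : ∀ μ : OrderUnitState D, |μ.1 (a - r • ⟨1, h1D⟩) - μ.1 ⟨f, hfD⟩| ≤ δ / 3 := by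
      intro μ
      rw [← map_sub]
      refine (μ.abs_map_le h1D _ (h.dom_le (Subtype.mem _)).2).trans ?_
      rw [Metric.mem_ball, dist_eq_norm] at haf
      exact haf.le
    have h3 := abs_le.1 (hdiff ν)
    have h4 := abs_le.1 (hdiff μ)
    have h5 := abs_lt.1 (Real.dist_eq _ _ ▸ hν ⟨f, hfD⟩ hf)
    rw [hstate] at h3 h4
    rw [edist_dist, ← ENNReal.ofReal_coe_nnreal]
    refine ENNReal.ofReal_le_ofReal ?_
    rw [Real.dist_eq, abs_le]
    constructor <;> linarith [h3.1, h3.2, h4.1, h4.2, h5.1, h5.2]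

/-- The Lip-norm with the given domain and unit ball. -/
def lipNorm (h : LipBall X D U) : LipNorm X where
  dom := D
  dom_le := h.dom_le
  one_mem := h.one_mem
  dense := h.dense
  L := h.seminorm
  eq_zero_iff := h.seminorm_eq_zero_iff
  induces_weakStar := h.induces_weakStar
  isClosed := by
    convert h.isClosed using 1
    ext x
    exact ⟨fun ⟨hx, h1⟩ => (h.seminorm_le_one_iff _).1 h1, fun hx =>
      ⟨h.subset hx, (h.seminorm_le_one_iff ⟨x, h.subset hx⟩).2 hx⟩⟩

theorem ball_lipNorm (h : LipBall X D U) : h.lipNorm.ball = U := by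
  ext x
  exact ⟨fun ⟨hx, h1⟩ => (h.seminorm_le_one_iff _).1 h1, fun hx =>
    ⟨h.subset hx, (h.seminorm_le_one_iff ⟨x, h.subset hx⟩).2 hx⟩⟩

end LipBall

end OfBall

/-! ### Admissible Lip-norms and the complete distance in terms of unit balls -/

namespace LipNorm

/-- A Lip-norm `M` is the quotient of the Lip-norm `L` under `p` if and only if `p` maps the unit
ball of `L` into that of `M`, and onto it up to factors `t < 1`. -/
theorem forall_isGLB_iff {A : Type u} [CStarAlgebra A] {B : Type v} [CStarAlgebra B]
    {X : OperatorSystem A} {Y : OperatorSystem B} (L : LipNorm X) (M : LipNorm Y) (p : A →ₗ[ℝ] B)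
    (hp : ∀ z ∈ L.dom, p z ∈ M.dom) :
    (∀ x : M.dom, IsGLB {r : ℝ | ∃ z : L.dom, p z = x ∧ L.L z = r} (M.L x)) ↔
      (∀ z ∈ L.ball, p z ∈ M.ball) ∧
        ∀ x ∈ M.ball, ∀ t : ℝ, 0 < t → t < 1 → ∃ z ∈ L.ball, p z = t • x := by
  constructor
  · intro h
    refine ⟨fun z hz => ⟨hp z hz.1, ?_⟩, fun x hx t ht0 ht1 => ?_⟩
    · exact ((h ⟨p z, hp z hz.1⟩).1 ⟨⟨z, hz.1⟩, rfl, rfl⟩).trans hz.2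
    · obtain ⟨r, ⟨z, hz, rfl⟩, hlt⟩ := (isGLB_lt_iff (h ⟨x, hx.1⟩)).1
        (hx.2.trans_lt ((one_lt_inv₀ ht0).2 ht1))
      refine ⟨t • (z : A), ?_, by rw [map_smul, hz]⟩
      have := (le_iff z.2 (inv_pos.2 ht0)).1 hlt.le
      rwa [inv_inv] at this
  · rintro ⟨h1, h2⟩ x
    constructor
    · rintro _ ⟨z, hz, rfl⟩
      refine le_of_forall_pos_le_add fun ε hε => ?_
      have hpos : 0 < L.L z + ε := add_pos_of_nonneg_of_pos (apply_nonneg _ _) hε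
      have h3 := h1 _ ((le_iff z.2 hpos).1 (by linarith))
      rw [map_smul, hz] at h3
      exact (le_iff x.2 hpos).2 h3
    · intro b hb
      refine le_of_forall_pos_le_add fun ε hε => ?_
      have h0 : 0 ≤ M.L x := apply_nonneg _ _
      have hs : 0 < M.L x + ε / 2 := by positivity
      have hs' : 0 < M.L x + ε := by positivity
      obtain ⟨z, hz, hzx⟩ := h2 _ ((le_iff x.2 hs).1 (by linarith)) ((M.L x + ε / 2) / (M.L x + ε))
        (by positivity) ((div_lt_one hs').2 (by linarith))
      have hz' : (M.L x + ε) • z ∈ L.dom := L.dom.smul_mem _ hz.1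
      have h3 : L.L ⟨(M.L x + ε) • z, hz'⟩ ≤ M.L x + ε := by
        rw [le_iff hz' hs', smul_smul, inv_mul_cancel₀ hs'.ne', one_smul]
        exact hz
      refine (hb ⟨⟨_, hz'⟩, ?_, rfl⟩).trans h3
      change p ((M.L x + ε) • z) = x
      rw [map_smul, hzx, smul_smul, smul_smul, mul_div_cancel₀ _ hs'.ne', mul_inv_cancel₀ hs.ne',
        one_smul]

variable {A : Type u} [CStarAlgebra A] {B : Type v} [CStarAlgebra B]
  {X : OperatorSystem A} {Y : OperatorSystem B} {LX : LipNorm X} {LY : LipNorm Y}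
  {L : LipNorm (X.prod Y)}

theorem fst_mem {z : A × B} (hz : z ∈ L.ball) : z.1 ∈ X.carrier := (dom_subset hz.1).1

theorem snd_mem {z : A × B} (hz : z ∈ L.ball) : z.2 ∈ Y.carrier := (dom_subset hz.1).2

/-- Admissibility in terms of unit balls. The infima that define quotient semi-norms need not be
attained, whence the factors `t < 1`. -/
theorem mem_admissible_iff :
    L ∈ admissible LX LY ↔ L.dom = LX.dom.prod LY.dom ∧
      ((∀ z ∈ L.ball, z.1 ∈ LX.ball) ∧
        ∀ x ∈ LX.ball, ∀ t : ℝ, 0 < t → t < 1 → ∃ z ∈ L.ball, z.1 = t • x) ∧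
      ((∀ z ∈ L.ball, z.2 ∈ LY.ball) ∧
        ∀ y ∈ LY.ball, ∀ t : ℝ, 0 < t → t < 1 → ∃ z ∈ L.ball, z.2 = t • y) := by
  refine and_congr_right fun hdom => and_congr ?_ ?_
  · exact forall_isGLB_iff L LX (LinearMap.fst ℝ A B) fun z hz => by rw [hdom] at hz; exact hz.1
  · exact forall_isGLB_iff L LY (LinearMap.snd ℝ A B) fun z hz => by rw [hdom] at hz; exact hz.2

/-- The sets `UCP_n(X)` and `UCP_n(Y)` are within Hausdorff distance `ε` for all `n ≥ 1`, in a form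
where the nearby points are attained. -/
def IsClose (L : LipNorm (X.prod Y)) (ε : ℝ) : Prop :=
  ∀ n : ℕ, 0 < n →
    (∀ φ : X.UCP n, ∃ ψ : Y.UCP n, ∀ (z : A × B) (hz : z ∈ L.ball),
      ‖φ.1 ⟨z.1, fst_mem hz⟩ - ψ.1 ⟨z.2, snd_mem hz⟩‖ ≤ ε) ∧
    ∀ ψ : Y.UCP n, ∃ φ : X.UCP n, ∀ (z : A × B) (hz : z ∈ L.ball),
      ‖φ.1 ⟨z.1, fst_mem hz⟩ - ψ.1 ⟨z.2, snd_mem hz⟩‖ ≤ ε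

theorem edist_inl_inr_le_iff {n : ℕ} (φ : X.UCP n) (ψ : Y.UCP n) {ε : ℝ} (hε : 0 ≤ ε) :
    (L.ucpMetric n).edist (φ.inl Y) (ψ.inr X) ≤ ENNReal.ofReal ε ↔
      ∀ (z : A × B) (hz : z ∈ L.ball),
        ‖φ.1 ⟨z.1, fst_mem hz⟩ - ψ.1 ⟨z.2, snd_mem hz⟩‖ ≤ ε := by
  refine iSup_le_iff.trans ⟨fun h z hz => ?_, fun h i => ?_⟩
  · have := h ⟨⟨z, hz.1⟩, hz.2⟩
    rw [edist_dist, ENNReal.ofReal_le_ofReal_iff hε, dist_eq_norm] at this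
    exact this
  · rw [edist_dist, ENNReal.ofReal_le_ofReal_iff hε, dist_eq_norm]
    exact h i.1.1 ⟨i.1.2, i.2⟩

theorem completeDist_le (hL : L ∈ admissible LX LY) {ε : ℝ} (hε : 0 ≤ ε) (h : L.IsClose ε) :
    completeDist LX LY ≤ ENNReal.ofReal ε := by
  refine (iInf₂_le L hL).trans (iSup_le fun n => ?_)
  let _ := L.ucpMetric n
  refine Metric.hausdorffEDist_le_of_mem_edist ?_ ?_
  · rintro _ ⟨φ, rfl⟩
    obtain ⟨ψ, hψ⟩ := (h n n.2).1 φ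
    exact ⟨_, ⟨ψ, rfl⟩, (edist_inl_inr_le_iff φ ψ hε).2 hψ⟩
  · rintro _ ⟨ψ, rfl⟩
    obtain ⟨φ, hφ⟩ := (h n n.2).2 ψ
    refine ⟨_, ⟨φ, rfl⟩, ?_⟩
    rw [edist_comm]
    exact (edist_inl_inr_le_iff φ ψ hε).2 hφ

theorem exists_isClose {ε : ℝ} (hε : 0 ≤ ε) (h : completeDist LX LY < ENNReal.ofReal ε) :
    ∃ L ∈ admissible LX LY, L.IsClose ε := by
  obtain ⟨L, hL, hlt⟩ := by simpa only [completeDist, iInf_lt_iff] using h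
  refine ⟨L, hL, fun n hn => ?_⟩
  have hlt' : ucpHausdorff L n < ENNReal.ofReal ε :=
    (le_iSup (fun n : ℕ+ => ucpHausdorff L n) ⟨n, hn⟩).trans_lt hlt
  rw [ucpHausdorff] at hlt'
  let _ := L.ucpMetric n
  constructor
  · intro φ
    obtain ⟨_, ⟨ψ, rfl⟩, hψ⟩ :=
      Metric.exists_edist_lt_of_hausdorffEDist_lt (Set.mem_range_self φ) hlt'
    exact ⟨ψ, (edist_inl_inr_le_iff φ ψ hε).1 hψ.le⟩
  · intro ψ
    rw [Metric.hausdorffEDist_comm] at hlt'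
    obtain ⟨_, ⟨φ, rfl⟩, hφ⟩ :=
      Metric.exists_edist_lt_of_hausdorffEDist_lt (Set.mem_range_self ψ) hlt'
    rw [edist_comm] at hφ
    exact ⟨φ, (edist_inl_inr_le_iff φ ψ hε).1 hφ.le⟩

/-! ### Bridges -/

theorem mem_prod_sa {z : A × B} : z ∈ (X.prod Y).sa ↔ z.1 ∈ X.sa ∧ z.2 ∈ Y.sa := by
  constructor
  · rintro ⟨⟨h1, h2⟩, h⟩
    exact ⟨⟨h1, congrArg Prod.fst h⟩, ⟨h2, congrArg Prod.snd h⟩⟩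
  · rintro ⟨⟨h1, h⟩, ⟨h2, h'⟩⟩
    exact ⟨⟨h1, h2⟩, Prod.ext h h'⟩

theorem prod_dom_le (LX : LipNorm X) (LY : LipNorm Y) : LX.dom.prod LY.dom ≤ (X.prod Y).sa :=
  fun _ hz => mem_prod_sa.2 ⟨LX.dom_le hz.1, LY.dom_le hz.2⟩

theorem prod_dense (LX : LipNorm X) (LY : LipNorm Y) :
    ((X.prod Y).sa : Set (A × B)) ⊆ closure (LX.dom.prod LY.dom : Set (A × B)) := by
  intro z hz
  rw [Submodule.prod_coe, closure_prod_eq]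
  exact ⟨LX.dense (mem_prod_sa.1 hz).1, LY.dense (mem_prod_sa.1 hz).2⟩

theorem exists_smul_mem_ball_both {x : A} {y : B} (hx : x ∈ LX.dom) (hy : y ∈ LY.dom) :
    ∃ t : ℝ, 0 < t ∧ t • x ∈ LX.ball ∧ t • y ∈ LY.ball := by
  obtain ⟨t, ht, hx⟩ := exists_smul_mem_ball hx
  obtain ⟨s, hs, hy⟩ := exists_smul_mem_ball hy
  have h := lt_min ht hs
  refine ⟨min t s, h, ?_, ?_⟩
  · have := smul_mem_ball hx (t := min t s / t) (by
      rw [abs_of_pos (by positivity), div_le_one ht]; exact min_le_left _ _)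
    rwa [smul_smul, div_mul_cancel₀ _ ht.ne'] at this
  · have := smul_mem_ball hy (t := min t s / s) (by
      rw [abs_of_pos (by positivity), div_le_one hs]; exact min_le_right _ _)
    rwa [smul_smul, div_mul_cancel₀ _ hs.ne'] at this

/-- A bridge between `L_X` and `L_Y`: if `T` is a bounded linear map on `𝓓(L_X) ⊕ 𝓓(L_Y)` which
vanishes at `(1, 1)` but not at `(1, 0)`, then `max (L_X(x), L_Y(y), ‖T(x, y)‖)` is a Lip-norm; it
is admissible if for `L_X(x) ≤ 1` there is `y` such that `L_Y(y) ≤ 1` and `‖T(x, y)‖ ≤ 1`, and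
likewise for `y`. -/
theorem exists_admissible_of_bridge {E : Type w} [NormedAddCommGroup E] [NormedSpace ℝ E]
    (T : LX.dom.prod LY.dom →ₗ[ℝ] E) {c : ℝ} (hc : ∀ z, ‖T z‖ ≤ c * ‖(z : A × B)‖)
    (h1 : T ⟨(1, 1), LX.one_mem, LY.one_mem⟩ = 0)
    (h0 : T ⟨(1, 0), LX.one_mem, LY.dom.zero_mem⟩ ≠ 0)
    (hX : ∀ (x : A) (hx : x ∈ LX.ball), ∃ (y : B) (hy : y ∈ LY.ball),
      ‖T ⟨(x, y), hx.1, hy.1⟩‖ ≤ 1)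
    (hY : ∀ (y : B) (hy : y ∈ LY.ball), ∃ (x : A) (hx : x ∈ LX.ball),
      ‖T ⟨(x, y), hx.1, hy.1⟩‖ ≤ 1) :
    ∃ L ∈ admissible LX LY, ∀ z ∈ L.ball, ∃ (hx : z.1 ∈ LX.ball) (hy : z.2 ∈ LY.ball),
      ‖T ⟨z, hx.1, hy.1⟩‖ ≤ 1 := by
  have := X.nontrivial
  have := Y.nontrivial
  let U : Set (A × B) := {z | ∃ (hx : z.1 ∈ LX.ball) (hy : z.2 ∈ LY.ball),
      ‖T ⟨z, hx.1, hy.1⟩‖ ≤ 1}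
  have hc0 : 0 ≤ c := by
    have := (norm_nonneg _).trans (hc ⟨(1, 1), LX.one_mem, LY.one_mem⟩)
    simpa [Prod.norm_def] using this
  have hU : LipBall (X.prod Y) (LX.dom.prod LY.dom) U :=
    { dom_le := prod_dom_le LX LY
      dense := prod_dense LX LY
      subset := fun z ⟨hx, hy, _⟩ => ⟨hx.1, hy.1⟩
      convex := by
        rintro z ⟨hx, hy, hT⟩ z' ⟨hx', hy', hT'⟩ a b ha hb hab
        refine ⟨convex_ball hx hx' ha hb hab, convex_ball hy hy' ha hb hab, ?_⟩
        have h2 : T (a • ⟨z, hx.1, hy.1⟩ + b • ⟨z', hx'.1, hy'.1⟩) =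
            a • T ⟨z, hx.1, hy.1⟩ + b • T ⟨z', hx'.1, hy'.1⟩ := by
          rw [map_add, map_smul, map_smul]
        refine (congrArg norm h2).trans_le ((norm_add_le _ _).trans ?_)
        rw [norm_smul, norm_smul, Real.norm_of_nonneg ha, Real.norm_of_nonneg hb]
        calc _ ≤ a * 1 + b * 1 := by gcongr
          _ = 1 := by linarith
      neg_mem := by
        rintro z ⟨hx, hy, hT⟩
        refine ⟨neg_mem_ball hx, neg_mem_ball hy, ?_⟩
        have h2 : T (-⟨z, hx.1, hy.1⟩) = - T ⟨z, hx.1, hy.1⟩ := map_neg _ _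
        exact (congrArg norm h2).trans_le (by rwa [norm_neg])
      smul_one_mem := by
        intro r
        refine ⟨smul_one_mem_ball r, smul_one_mem_ball r, ?_⟩
        have h2 : T (r • ⟨(1, 1), LX.one_mem, LY.one_mem⟩) = 0 := by
          rw [map_smul, h1, smul_zero]
        exact (congrArg norm h2).trans_le (by simp)
      absorbs := by
        rintro z hz
        obtain ⟨t, ht, hx, hy⟩ := exists_smul_mem_ball_both hz.1 hz.2
        have hN : 1 ≤ 1 + ‖T (t • ⟨z, hz⟩)‖ := by linarith [norm_nonneg (T (t • ⟨z, hz⟩))]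
        have hN0 : 0 < 1 + ‖T (t • ⟨z, hz⟩)‖ := by linarith
        have habs : |(1 + ‖T (t • ⟨z, hz⟩)‖)⁻¹| ≤ 1 := by
          rw [abs_of_pos (inv_pos.2 hN0)]
          exact inv_le_one_of_one_le₀ hN
        refine ⟨(1 + ‖T (t • ⟨z, hz⟩)‖)⁻¹ * t, by positivity, ?_⟩
        rw [mul_smul]
        refine ⟨smul_mem_ball hx habs, smul_mem_ball hy habs, ?_⟩
        have h2 : T ((1 + ‖T (t • ⟨z, hz⟩)‖)⁻¹ • t • ⟨z, hz⟩) =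
          (1 + ‖T (t • ⟨z, hz⟩)‖)⁻¹ • T (t • ⟨z, hz⟩) := map_smul _ _ _
        refine (congrArg norm h2).trans_le ?_
        rw [norm_smul, Real.norm_of_nonneg (inv_pos.2 hN0).le, inv_mul_le_iff₀ hN0]
        linarith
      isCompact := by
        intro R
        have hK : IsCompact
            ((LX.ball ∩ Metric.closedBall 0 R) ×ˢ (LY.ball ∩ Metric.closedBall 0 R)) :=
          (LX.isCompact_ball_inter R).prod (LY.isCompact_ball_inter R)
        have hT : Continuous T := AddMonoidHomClass.continuous_of_bound T c hc
        have hK' : IsCompact ((↑) ⁻¹' ((LX.ball ∩ Metric.closedBall 0 R) ×ˢ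
            (LY.ball ∩ Metric.closedBall 0 R)) : Set (LX.dom.prod LY.dom)) := by
          rw [Topology.IsInducing.subtypeVal.isCompact_preimage_iff]
          · exact hK
          · rw [Subtype.range_coe]
            exact fun z hz => ⟨hz.1.1.1, hz.2.1.1⟩
        have hK2 := (hK'.inter_right (isClosed_le hT.norm (continuous_const (y := (1 : ℝ))))).image
          continuous_subtype_val
        refine (congrArg IsCompact ?_).mpr hK2
        ext z
        rw [Set.mem_inter_iff, mem_closedBall_zero_iff, Prod.norm_def, max_le_iff]
        constructor
        · rintro ⟨⟨hx, hy, hT⟩, h1, h2⟩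
          exact ⟨⟨z, hx.1, hy.1⟩, ⟨⟨⟨hx, by simpa using h1⟩, hy, by simpa using h2⟩, hT⟩, rfl⟩
        · rintro ⟨z, ⟨⟨⟨hx, h1⟩, hy, h2⟩, hT⟩, rfl⟩
          exact ⟨⟨hx, hy, hT⟩, by simpa using h1, by simpa using h2⟩
      -- If `x` is near `r • 1` and `y` near `s • 1`, then `T (x, y)` is near `(r - s) • T (1, 0)`,
      -- as `T (1, 1) = 0`; hence `r - s` is bounded.
      radius := by
        obtain ⟨C, hC0, hC⟩ := LX.exists_radius
        obtain ⟨C', hC0', hC'⟩ := LY.exists_radius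
        set τ := ‖T ⟨(1, 0), LX.one_mem, LY.dom.zero_mem⟩‖ with hτ
        have hτ0 : 0 < τ := norm_pos_iff.2 h0
        refine ⟨max C (C' + (1 + c * max C C') / τ), ?_⟩
        rintro z ⟨hx, hy, hT⟩
        obtain ⟨r, hr⟩ := hC _ hx
        obtain ⟨s, hs⟩ := hC' _ hy
        have hz' : z - (r • 1, s • 1) ∈ LX.dom.prod LY.dom :=
          ⟨(sub_smul_one_mem_ball hx r).1, (sub_smul_one_mem_ball hy s).1⟩
        have h2 : T ⟨z, hx.1, hy.1⟩ = T ⟨_, hz'⟩ +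
            (r - s) • T ⟨(1, 0), LX.one_mem, LY.dom.zero_mem⟩ := by
          have h3 : s • T ⟨(1, 1), LX.one_mem, LY.one_mem⟩ = 0 := by rw [h1, smul_zero]
          rw [← add_zero (T ⟨_, hz'⟩ + _), ← h3, ← map_smul, ← map_smul, ← map_add, ← map_add]
          congr 1
          ext
          · change z.1 = z.1 - r • 1 + (r - s) • 1 + s • 1
            rw [sub_smul]; abel
          · change z.2 = z.2 - s • 1 + (r - s) • 0 + s • 1
            rw [smul_zero]; abel
        have h3 : ‖T ⟨_, hz'⟩‖ ≤ c * max C C' := by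
          refine (hc _).trans (mul_le_mul_of_nonneg_left ?_ hc0)
          exact max_le_max hr hs
        have h4 : |r - s| * τ ≤ 1 + c * max C C' := by
          rw [hτ, ← Real.norm_eq_abs, ← norm_smul]
          rw [eq_sub_of_add_eq' h2.symm]
          exact (norm_sub_le _ _).trans (add_le_add hT h3)
        rw [← le_div_iff₀ hτ0] at h4
        refine ⟨r, max_le_max hr ?_⟩
        change ‖z.2 - r • 1‖ ≤ _
        rw [show z.2 - r • 1 = (z.2 - s • 1) - (r - s) • 1 by rw [sub_smul]; abel]
        refine (norm_sub_le _ _).trans (add_le_add hs ?_)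
        rw [norm_smul, norm_one, mul_one]
        exact h4 }
  refine ⟨hU.lipNorm, ?_, fun z hz => by rwa [hU.ball_lipNorm] at hz⟩
  rw [mem_admissible_iff, hU.ball_lipNorm]
  refine ⟨rfl, ⟨fun z hz => hz.1, fun x hx t ht0 ht1 => ?_⟩, fun z hz => hz.2.1,
    fun y hy t ht0 ht1 => ?_⟩
  · have hx' := smul_mem_ball hx (t := t) (abs_le.2 ⟨by linarith, ht1.le⟩)
    obtain ⟨y, hy, hT⟩ := hX _ hx'
    exact ⟨(t • x, y), ⟨hx', hy, hT⟩, rfl⟩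
  · have hy' := smul_mem_ball hy (t := t) (abs_le.2 ⟨by linarith, ht1.le⟩)
    obtain ⟨x, hx, hT⟩ := hY _ hy'
    exact ⟨(x, t • y), ⟨hx, hy', hT⟩, rfl⟩

end LipNorm

/-! ### Finiteness, symmetry and the triangle inequality -/

namespace LipNorm

variable {A : Type u} [CStarAlgebra A] {B : Type v} [CStarAlgebra B]
  {X : OperatorSystem A} {Y : OperatorSystem B} {LX : LipNorm X} {LY : LipNorm Y}
  {L : LipNorm (X.prod Y)}

theorem _root_.IsPosFunctional.abs_le {g : A →ₗ[ℝ] ℝ} (hg : IsPosFunctional g) (h1 : g 1 = 1)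
    {a : A} (ha : IsSelfAdjoint a) : |g a| ≤ ‖a‖ :=
  (OrderUnitState.ofFunctional ⊤ hg h1).abs_map_le trivial ⟨a, trivial⟩ ha

theorem exists_norm_sub_state_le (LX : LipNorm X) {g : A →ₗ[ℝ] ℝ} (hg : IsPosFunctional g)
    (h1 : g 1 = 1) : ∃ C : ℝ, 0 ≤ C ∧ ∀ a ∈ LX.ball, ‖a - g a • (1 : A)‖ ≤ C := by
  have := X.nontrivial
  obtain ⟨C, hC0, hC⟩ := LX.exists_radius
  refine ⟨C + C, by positivity, fun a ha => ?_⟩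
  obtain ⟨r, hr⟩ := hC a ha
  have h2 : |g (a - r • 1)| ≤ C :=
    (hg.abs_le h1 (isSelfAdjoint_of_mem_dom (sub_smul_one_mem_ball ha r).1)).trans hr
  rw [map_sub, map_smul, h1, smul_eq_mul, mul_one] at h2
  rw [show a - g a • (1 : A) = (a - r • 1) - (g a - r) • 1 by rw [sub_smul]; abel]
  refine (norm_sub_le _ _).trans (add_le_add hr ?_)
  rwa [norm_smul, norm_one, mul_one]

theorem norm_map_sub_le {n : ℕ} (φ : X.UCP n) {x : A} (hx : x ∈ LX.dom) (r : ℝ) :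
    ‖φ.1 ⟨x, dom_subset hx⟩ - r • (1 : Matrix (Fin n) (Fin n) ℂ)‖ ≤ ‖x - r • (1 : A)‖ := by
  have hmem := LX.dom.sub_mem hx (smul_one_mem_dom r)
  have h := φ.norm_map_le (x := ⟨_, dom_subset hmem⟩) (isSelfAdjoint_of_mem_dom hmem)
  have h1 : φ.1 ⟨_, dom_subset hmem⟩ =
      φ.1 ⟨x, dom_subset hx⟩ - φ.1 ⟨r • 1, dom_subset (smul_one_mem_dom (L := LX) r)⟩ := by
    rw [← map_sub]
    rfl
  rw [φ.map_real_smul r X.one_mem, φ.map_one] at h1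
  rwa [h1] at h

/-- The bridge `(x, y) ↦ g x - h y` for states `g` and `h` gives an admissible Lip-norm, and all
matrix states of `X` and `Y` are at bounded distance from `g` and `h`. -/
theorem completeDist_lt_top (LX : LipNorm X) (LY : LipNorm Y) : completeDist LX LY < ⊤ := by
  have := X.nontrivial
  have := Y.nontrivial
  obtain ⟨g, hg, hg1⟩ := X.exists_state
  obtain ⟨h, hh, hh1⟩ := Y.exists_state
  obtain ⟨C, hC0, hC⟩ := LX.exists_norm_sub_state_le hg hg1
  obtain ⟨C', hC0', hC'⟩ := LY.exists_norm_sub_state_le hh hh1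
  let T : LX.dom.prod LY.dom →ₗ[ℝ] ℝ :=
    (g ∘ₗ LinearMap.fst ℝ A B - h ∘ₗ LinearMap.snd ℝ A B) ∘ₗ Submodule.subtype _
  have hT : ∀ z, T z = g (z : A × B).1 - h (z : A × B).2 := fun z => rfl
  obtain ⟨L, hL, hball⟩ := exists_admissible_of_bridge (LX := LX) (LY := LY) T (c := 2)
    (fun z => by
      rw [hT, two_mul]
      refine (norm_sub_le _ _).trans (add_le_add ?_ ?_)
      · exact (hg.abs_le hg1 (isSelfAdjoint_of_mem_dom z.2.1)).trans (norm_fst_le _)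
      · exact (hh.abs_le hh1 (isSelfAdjoint_of_mem_dom z.2.2)).trans (norm_snd_le _))
    (by rw [hT, hg1, hh1, sub_self]) (by rw [hT, hg1, map_zero, sub_zero]; exact one_ne_zero)
    (fun x hx => ⟨g x • 1, smul_one_mem_ball _, by simp [hT, hh1]⟩)
    (fun y hy => ⟨h y • 1, smul_one_mem_ball _, by simp [hT, hg1]⟩)
  refine (completeDist_le hL (ε := C + C' + 1) (by positivity) fun n hn => ?_).trans_lt
    ENNReal.ofReal_lt_top
  have : NeZero n := ⟨hn.ne'⟩
  constructor
  · intro φ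
    obtain ⟨ψ, hψ⟩ := Y.exists_ucp_of_state n hh hh1
    refine ⟨ψ, fun z hz => ?_⟩
    obtain ⟨hx, hy, hz1⟩ := hball z hz
    rw [hT, Real.norm_eq_abs] at hz1
    rw [hψ _ (isSelfAdjoint_of_mem_dom hy.1)]
    have h2 := (norm_map_sub_le φ hx.1 (g z.1)).trans (hC _ hx)
    have h3 := norm_sub_le_norm_sub_add_norm_sub (φ.1 ⟨z.1, fst_mem hz⟩)
      (g z.1 • (1 : Matrix (Fin n) (Fin n) ℂ)) (h z.2 • 1)
    rw [← sub_smul, norm_smul, norm_one, mul_one, Real.norm_eq_abs] at h3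
    linarith
  · intro ψ
    obtain ⟨φ, hφ⟩ := X.exists_ucp_of_state n hg hg1
    refine ⟨φ, fun z hz => ?_⟩
    obtain ⟨hx, hy, hz1⟩ := hball z hz
    rw [hT, Real.norm_eq_abs] at hz1
    rw [hφ _ (isSelfAdjoint_of_mem_dom hx.1)]
    have h2 := (norm_map_sub_le ψ hy.1 (h z.2)).trans (hC' _ hy)
    have h3 := norm_sub_le_norm_sub_add_norm_sub (g z.1 • (1 : Matrix (Fin n) (Fin n) ℂ))
      (h z.2 • (1 : Matrix (Fin n) (Fin n) ℂ)) (ψ.1 ⟨z.2, snd_mem hz⟩)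
    rw [← sub_smul, norm_smul, norm_one, mul_one, Real.norm_eq_abs,
      norm_sub_rev (h z.2 • (1 : Matrix (Fin n) (Fin n) ℂ))] at h3
    exact h3.trans (by linarith)

theorem exists_isClose_toReal_add (LX : LipNorm X) (LY : LipNorm Y) {ε : ℝ} (hε : 0 < ε) :
    ∃ L ∈ admissible LX LY, L.IsClose ((completeDist LX LY).toReal + ε) := by
  refine exists_isClose (by positivity) ?_
  rw [ENNReal.ofReal_add ENNReal.toReal_nonneg hε.le,
    ENNReal.ofReal_toReal (completeDist_lt_top LX LY).ne]
  exact ENNReal.lt_add_right (completeDist_lt_top LX LY).ne (ENNReal.ofReal_pos.2 hε).ne'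

/-- The flip `X ⊕ Y ≃ Y ⊕ X` carries admissible Lip-norms to admissible Lip-norms. -/
theorem exists_admissible_swap (hL : L ∈ admissible LX LY) {ε : ℝ} (hcl : L.IsClose ε) :
    ∃ L' ∈ admissible LY LX, L'.IsClose ε ∧ L'.ball = {z | z.swap ∈ L.ball} := by
  obtain ⟨hdom, ⟨h1, h2⟩, h3, h4⟩ := mem_admissible_iff.1 hL
  have hU : LipBall (Y.prod X) (LY.dom.prod LX.dom) {z | z.swap ∈ L.ball} :=
    { dom_le := prod_dom_le LY LX
      dense := prod_dense LY LX
      subset := fun z hz => ⟨(h3 _ hz).1, (h1 _ hz).1⟩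
      convex := fun z hz z' hz' a b ha hb hab => convex_ball (L := L) hz hz' ha hb hab
      neg_mem := fun z hz => neg_mem_ball (L := L) hz
      smul_one_mem := fun r => smul_one_mem_ball (L := L) r
      absorbs := fun z hz => exists_smul_mem_ball (L := L) (x := z.swap) (by
        rw [hdom]; exact ⟨hz.2, hz.1⟩)
      isCompact := fun R => by
        have := (L.isCompact_ball_inter R).image continuous_swap
        refine (congrArg IsCompact ?_).mpr this
        rw [Set.image_swap_eq_preimage_swap]
        ext z
        simp [Prod.norm_def, max_comm, Prod.swap, and_comm]
      radius := by
        obtain ⟨C, -, hC⟩ := L.exists_radius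
        refine ⟨C, fun z hz => ?_⟩
        obtain ⟨r, hr⟩ := hC _ hz
        refine ⟨r, le_trans (le_of_eq ?_) hr⟩
        exact max_comm _ _ }
  have hmem : hU.lipNorm ∈ admissible LY LX := by
    rw [mem_admissible_iff, hU.ball_lipNorm]
    refine ⟨rfl, ⟨fun z hz => h3 _ hz, fun y hy t ht0 ht1 => ?_⟩, fun z hz => h1 _ hz,
      fun x hx t ht0 ht1 => ?_⟩
    · obtain ⟨z, hz, hzy⟩ := h4 y hy t ht0 ht1
      exact ⟨z.swap, hz, hzy⟩
    · obtain ⟨z, hz, hzx⟩ := h2 x hx t ht0 ht1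
      exact ⟨z.swap, hz, hzx⟩
  refine ⟨hU.lipNorm, hmem, fun n hn => ⟨fun ψ => ?_, fun φ => ?_⟩, hU.ball_lipNorm⟩
  · obtain ⟨φ, hφ⟩ := (hcl n hn).2 ψ
    refine ⟨φ, fun z hz => ?_⟩
    rw [norm_sub_rev]
    exact hφ z.swap (by rwa [hU.ball_lipNorm] at hz)
  · obtain ⟨ψ, hψ⟩ := (hcl n hn).1 φ
    refine ⟨ψ, fun z hz => ?_⟩
    rw [norm_sub_rev]
    exact hψ z.swap (by rwa [hU.ball_lipNorm] at hz)

theorem completeDist_swap_le (LX : LipNorm X) (LY : LipNorm Y) :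
    completeDist LY LX ≤ completeDist LX LY := by
  refine ENNReal.le_of_forall_pos_le_add fun ε hε hfin => ?_
  obtain ⟨L, hL, hcl⟩ := exists_isClose_toReal_add LX LY (ε := ε) hε
  obtain ⟨L', hL', hcl', -⟩ := exists_admissible_swap hL hcl
  refine (completeDist_le hL' (by positivity) hcl').trans (le_of_eq ?_)
  rw [ENNReal.ofReal_add ENNReal.toReal_nonneg ε.coe_nonneg, ENNReal.ofReal_toReal hfin.ne,
    ENNReal.ofReal_coe_nnreal]

theorem completeDist_comm (LX : LipNorm X) (LY : LipNorm Y) :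
    completeDist LX LY = completeDist LY LX :=
  le_antisymm (completeDist_swap_le _ _) (completeDist_swap_le _ _)

variable {C : Type w} [CStarAlgebra C] {Z : OperatorSystem C} {LZ : LipNorm Z}

/-- The composition of two admissible Lip-norms: the unit ball is the composition of the unit balls
as relations. -/
theorem exists_admissible_comp {L : LipNorm (X.prod Y)} {M : LipNorm (Y.prod Z)}
    (hL : L ∈ admissible LX LY) (hM : M ∈ admissible LY LZ) :
    ∃ N ∈ admissible LX LZ, ∀ p ∈ N.ball, ∃ y : B, (p.1, y) ∈ L.ball ∧ (y, p.2) ∈ M.ball := by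
  have := X.nontrivial
  have := Y.nontrivial
  have := Z.nontrivial
  obtain ⟨hdom, ⟨h1, h2⟩, h3, h4⟩ := mem_admissible_iff.1 hL
  obtain ⟨hdom', ⟨k1, k2⟩, k3, k4⟩ := mem_admissible_iff.1 hM
  obtain ⟨R₁, hR₁, hr₁⟩ := L.exists_radius
  obtain ⟨R₂, hR₂, hr₂⟩ := M.exists_radius
  let U : Set (A × C) := {p | ∃ y : B, (p.1, y) ∈ L.ball ∧ (y, p.2) ∈ M.ball}
  have hU : LipBall (X.prod Z) (LX.dom.prod LZ.dom) U :=
    { dom_le := prod_dom_le LX LZ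
      dense := prod_dense LX LZ
      subset := fun p ⟨y, hy, hy'⟩ => ⟨(h1 _ hy).1, (k3 _ hy').1⟩
      convex := fun p ⟨y, hy, hy'⟩ q ⟨y', hq, hq'⟩ a b ha hb hab =>
        ⟨a • y + b • y', convex_ball (L := L) hy hq ha hb hab,
          convex_ball (L := M) hy' hq' ha hb hab⟩
      neg_mem := fun p ⟨y, hy, hy'⟩ => ⟨-y, neg_mem_ball (L := L) hy, neg_mem_ball (L := M) hy'⟩
      smul_one_mem := fun r => ⟨r • 1, smul_one_mem_ball (L := L) r, smul_one_mem_ball (L := M) r⟩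
      absorbs := fun p hp => by
        obtain ⟨t, ht, hx, hy⟩ := exists_smul_mem_ball_both (LX := L) (LY := M) (x := (p.1, 0))
          (y := (0, p.2)) (by rw [hdom]; exact ⟨hp.1, LY.dom.zero_mem⟩)
          (by rw [hdom']; exact ⟨LY.dom.zero_mem, hp.2⟩)
        refine ⟨t, ht, 0, ?_, ?_⟩
        · simpa using hx
        · simpa using hy
      -- If `(p.1, y)` is in the first ball and `‖p.1‖ ≤ R`, then `‖y‖ ≤ R + 2 R₁`; hence the
      -- bounded part of `U` is the projection of a compact set.
      isCompact := fun R => by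
        have hcl : IsClosed {q : (A × B) × (B × C) | q.1.2 = q.2.1} :=
          isClosed_eq (by fun_prop) (by fun_prop)
        have hK := ((((L.isCompact_ball_inter (R + R₁ + R₁)).prod
          (M.isCompact_ball_inter (R + R₁ + R₁))).inter_right hcl).image
          (f := fun q => (q.1.1, q.2.2)) (by fun_prop)).inter_right
          (Metric.isClosed_closedBall (x := (0 : A × C)) (ε := R))
        refine (congrArg IsCompact ?_).mpr hK
        ext p
        constructor
        · rintro ⟨⟨y, hy, hy'⟩, hp⟩
          refine ⟨⟨((p.1, y), (y, p.2)), ⟨⟨⟨hy, ?_⟩, ⟨hy', ?_⟩⟩, rfl⟩, rfl⟩, hp⟩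
          all_goals
            rw [mem_closedBall_zero_iff, Prod.norm_def, max_le_iff] at hp
            obtain ⟨r, hr⟩ := hr₁ _ hy
            have hr' := max_le_iff.1 hr
            have e1 : ‖p.1 - r • 1‖ ≤ R₁ := hr'.1
            have e2 : ‖y - r • 1‖ ≤ R₁ := hr'.2
            have e3 : |r| ≤ R + R₁ := by
              have := norm_sub_le p.1 (p.1 - r • 1)
              rw [sub_sub_cancel, norm_smul, norm_one, mul_one, Real.norm_eq_abs] at this
              linarith [hp.1]
            have e4 : ‖y‖ ≤ R + R₁ + R₁ := by
              have := norm_add_le (y - r • 1) (r • (1 : B))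
              rw [sub_add_cancel, norm_smul, norm_one, mul_one, Real.norm_eq_abs] at this
              linarith
            rw [mem_closedBall_zero_iff, Prod.norm_def, max_le_iff]
            constructor <;> simp only <;> linarith [hp.1, hp.2]
        · rintro ⟨⟨⟨⟨x, y⟩, y', z⟩, ⟨⟨hL, hM⟩, hy⟩, rfl⟩, hp⟩
          obtain rfl : y = y' := hy
          exact ⟨⟨y, hL.1, hM.1⟩, hp⟩
      radius := by
        refine ⟨max R₁ (R₂ + (R₁ + R₂)), ?_⟩
        rintro p ⟨y, hy, hy'⟩
        obtain ⟨r, hr⟩ := hr₁ _ hy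
        obtain ⟨s, hs⟩ := hr₂ _ hy'
        have hr' := max_le_iff.1 hr
        have hs' := max_le_iff.1 hs
        refine ⟨r, max_le_max hr'.1 ?_⟩
        have e1 : ‖y - r • 1‖ ≤ R₁ := hr'.2
        have e2 : ‖y - s • 1‖ ≤ R₂ := hs'.1
        have e3 : ‖p.2 - s • 1‖ ≤ R₂ := hs'.2
        change ‖p.2 - r • 1‖ ≤ _
        have e4 : |r - s| ≤ R₁ + R₂ := by
          have := norm_sub_le (y - s • 1) (y - r • 1)
          rw [show y - s • 1 - (y - r • 1) = (r - s) • (1 : B) by rw [sub_smul]; abel, norm_smul,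
            norm_one, mul_one, Real.norm_eq_abs] at this
          linarith
        rw [show p.2 - r • 1 = (p.2 - s • 1) - (r - s) • 1 by rw [sub_smul]; abel]
        refine (norm_sub_le _ _).trans (add_le_add e3 ?_)
        rwa [norm_smul, norm_one, mul_one] }
  -- Each of the two projections loses a factor less than `1`; both are taken to be `√t`.
  have hscale : ∀ t : ℝ, 0 < t → t < 1 → 0 < √t ∧ √t < 1 ∧ |√t| ≤ 1 := fun t h0 h1 =>
    have h : √t < 1 := (Real.sqrt_lt' one_pos).2 (by simpa using h1)
    ⟨Real.sqrt_pos.2 h0, h, by rw [abs_of_nonneg (Real.sqrt_nonneg _)]; exact h.le⟩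
  refine ⟨hU.lipNorm, ?_, fun p hp => by rwa [hU.ball_lipNorm] at hp⟩
  rw [mem_admissible_iff, hU.ball_lipNorm]
  refine ⟨rfl, ⟨fun p ⟨y, hy, hy'⟩ => h1 _ hy, fun x hx t ht0 ht1 => ?_⟩,
    fun p ⟨y, hy, hy'⟩ => k3 _ hy', fun z hz t ht0 ht1 => ?_⟩
  · obtain ⟨hs0, hs1, hs⟩ := hscale t ht0 ht1
    obtain ⟨⟨x', y⟩, hxy, hx'⟩ := h2 x hx _ hs0 hs1
    obtain ⟨⟨y', z⟩, hyz, hy'⟩ := k2 y (h3 _ hxy) _ hs0 hs1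
    refine ⟨(√t • x', z), ⟨y', ?_, hyz⟩, ?_⟩
    · rw [show y' = √t • y from hy']
      exact smul_mem_ball hxy hs
    · rw [show x' = √t • x from hx', smul_smul, Real.mul_self_sqrt ht0.le]
  · obtain ⟨hs0, hs1, hs⟩ := hscale t ht0 ht1
    obtain ⟨⟨y, z'⟩, hyz, hz'⟩ := k4 z hz _ hs0 hs1
    obtain ⟨⟨x, y'⟩, hxy, hy'⟩ := h4 y (k1 _ hyz) _ hs0 hs1
    refine ⟨(x, √t • z'), ⟨y', hxy, ?_⟩, ?_⟩
    · rw [show y' = √t • y from hy']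
      exact smul_mem_ball hyz hs
    · rw [show z' = √t • z from hz', smul_smul, Real.mul_self_sqrt ht0.le]

theorem completeDist_triangle (LX : LipNorm X) (LY : LipNorm Y) (LZ : LipNorm Z) :
    completeDist LX LZ ≤ completeDist LX LY + completeDist LY LZ := by
  refine ENNReal.le_of_forall_pos_le_add fun ε hε _ => ?_
  have hε2 : (0 : ℝ) < ε / 2 := half_pos (by exact_mod_cast hε)
  obtain ⟨L, hL, hcl⟩ := exists_isClose_toReal_add LX LY hε2
  obtain ⟨M, hM, hcl'⟩ := exists_isClose_toReal_add LY LZ hε2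
  obtain ⟨N, hN, hball⟩ := exists_admissible_comp hL hM
  set d := (completeDist LX LY).toReal with hd
  set e := (completeDist LY LZ).toReal with he
  have hd0 : 0 ≤ d := ENNReal.toReal_nonneg
  have he0 : 0 ≤ e := ENNReal.toReal_nonneg
  refine (completeDist_le hN (ε := (d + ε / 2) + (e + ε / 2)) (by positivity)
    fun n hn => ⟨fun φ => ?_, fun χ => ?_⟩).trans (le_of_eq ?_)
  · obtain ⟨ψ, hψ⟩ := (hcl n hn).1 φ
    obtain ⟨χ, hχ⟩ := (hcl' n hn).1 ψ
    refine ⟨χ, fun p hp => ?_⟩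
    obtain ⟨y, hy, hy'⟩ := hball p hp
    exact (norm_sub_le_norm_sub_add_norm_sub _ (ψ.1 ⟨y, snd_mem hy⟩) _).trans
      (add_le_add (hψ _ hy) (hχ _ hy'))
  · obtain ⟨ψ, hψ⟩ := (hcl' n hn).2 χ
    obtain ⟨φ, hφ⟩ := (hcl n hn).2 ψ
    refine ⟨φ, fun p hp => ?_⟩
    obtain ⟨y, hy, hy'⟩ := hball p hp
    exact (norm_sub_le_norm_sub_add_norm_sub _ (ψ.1 ⟨y, snd_mem hy⟩) _).trans
      (add_le_add (hφ _ hy) (hψ _ hy'))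
  · rw [show d + ε / 2 + (e + ε / 2) = d + e + (ε : ℝ) by ring,
      ENNReal.ofReal_add (by positivity) ε.coe_nonneg, ENNReal.ofReal_add hd0 he0, hd, he,
      ENNReal.ofReal_toReal (completeDist_lt_top LX LY).ne,
      ENNReal.ofReal_toReal (completeDist_lt_top LY LZ).ne, ENNReal.ofReal_coe_nnreal]

end LipNorm

/-! ### Isomorphic systems have distance zero -/

namespace LipNormedOperatorSystem

/-- The composition of a unital completely positive map with a unital completely positive map
between operator systems. -/
def _root_.OperatorSystem.UCP.comp {A : Type u} [CStarAlgebra A] {B : Type v} [CStarAlgebra B]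
    {X : OperatorSystem A} {Y : OperatorSystem B} {n : ℕ} (ψ : Y.UCP n)
    (Φ : X.carrier →ₗ[ℂ] Y.carrier) (h1 : Φ ⟨1, X.one_mem⟩ = ⟨1, Y.one_mem⟩)
    (h : X.IsCP (Y.carrier.subtype ∘ₗ Φ)) : X.UCP n :=
  ⟨ψ.1 ∘ₗ Φ, by rw [LinearMap.comp_apply, h1, ψ.2.1], fun m x hx => ψ.2.2 m (x.map Φ) (h m x hx)⟩

theorem Iso.completeDist_eq_zero {S T : LipNormedOperatorSystem.{u}} (h : S.Iso T) :
    completeDist S.L T.L = 0 := by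
  obtain ⟨Φ, h1, hΦ, hΨ, hdom, hdom'⟩ := h
  have h1' : Φ.symm ⟨1, T.X.one_mem⟩ = ⟨1, S.X.one_mem⟩ := by rw [← h1, Φ.symm_apply_apply]
  have := T.X.nontrivial
  have hnorm : ∀ x : S.X.carrier, IsSelfAdjoint (x : S.algebra) →
      ‖(Φ x : T.algebra)‖ ≤ ‖(x : S.algebra)‖ := fun x hx =>
    hΦ.norm_map_le (congrArg Subtype.val h1) hx
  have hball : ∀ (x : S.X.carrier), (x : S.algebra) ∈ S.L.ball → (Φ x : T.algebra) ∈ T.L.ball := by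
    rintro x ⟨hx, hx1⟩
    obtain ⟨hy, he⟩ := hdom x hx
    exact ⟨hy, he.trans_le hx1⟩
  have hball' : ∀ (y : T.X.carrier), (y : T.algebra) ∈ T.L.ball →
      (Φ.symm y : S.algebra) ∈ S.L.ball := by
    rintro y ⟨hy, hy1⟩
    obtain ⟨hx, he⟩ := hdom' y hy
    exact ⟨hx, he.trans_le hy1⟩
  refine le_antisymm (ENNReal.le_of_forall_pos_le_add fun ε hε _ => ?_) zero_le
  have hε' : (0 : ℝ) < ε := by exact_mod_cast hε
  -- The bridge `(x, y) ↦ ε⁻¹ (Φ x - y)`.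
  let F : S.L.dom.prod T.L.dom →ₗ[ℝ] T.algebra :=
    { toFun := fun z => (ε : ℝ)⁻¹ • ((Φ ⟨z.1.1, LipNorm.dom_subset z.2.1⟩ : T.algebra) - z.1.2)
      map_add' := fun z z' => by
        rw [← smul_add]
        congr 1
        have : Φ ⟨(z + z').1.1, LipNorm.dom_subset (z + z').2.1⟩ =
            Φ ⟨z.1.1, LipNorm.dom_subset z.2.1⟩ + Φ ⟨z'.1.1, LipNorm.dom_subset z'.2.1⟩ := by
          rw [← map_add]
          rfl
        rw [this]
        change _ - (z.1.2 + z'.1.2) = _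
        rw [Submodule.coe_add]
        abel
      map_smul' := fun r z => by
        have : Φ ⟨(r • z).1.1, LipNorm.dom_subset (r • z).2.1⟩ =
            (r : ℂ) • Φ ⟨z.1.1, LipNorm.dom_subset z.2.1⟩ := by
          rw [← map_smul]
          congr 1
        rw [this]
        change _ • (_ - r • z.1.2) = r • _
        rw [Submodule.coe_smul, Complex.coe_smul, ← smul_sub, smul_comm] }
  have hF : ∀ z, F z = (ε : ℝ)⁻¹ • ((Φ ⟨z.1.1, LipNorm.dom_subset z.2.1⟩ : T.algebra) - z.1.2) :=
    fun z => rfl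
  obtain ⟨L, hL, hLball⟩ := LipNorm.exists_admissible_of_bridge F (c := (ε : ℝ)⁻¹ * 2)
    (fun z => by
      rw [hF, norm_smul, Real.norm_of_nonneg (inv_nonneg.2 hε'.le), mul_assoc, two_mul]
      gcongr
      refine (norm_sub_le _ _).trans (add_le_add ?_ (norm_snd_le _))
      exact (hnorm _ (LipNorm.isSelfAdjoint_of_mem_dom z.2.1)).trans (norm_fst_le _))
    (by rw [hF, h1, sub_self, smul_zero])
    (by
      rw [hF, h1]
      simp [hε'.ne'])
    (fun x hx => ⟨Φ ⟨x, LipNorm.dom_subset hx.1⟩, hball _ hx, by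
      rw [hF, sub_self, smul_zero, norm_zero]; exact zero_le_one⟩)
    (fun y hy => ⟨Φ.symm ⟨y, LipNorm.dom_subset hy.1⟩, hball' _ hy, by
      rw [hF]
      simp⟩)
  have key : ∀ (n : ℕ) (ψ : T.X.UCP n) (z : S.algebra × T.algebra) (hz : z ∈ L.ball),
      ‖ψ.1 (Φ ⟨z.1, LipNorm.fst_mem hz⟩) - ψ.1 ⟨z.2, LipNorm.snd_mem hz⟩‖ ≤ ε := by
    intro n ψ z hz
    obtain ⟨hx, hy, hz1⟩ := hLball z hz
    rw [hF, norm_smul, Real.norm_of_nonneg (inv_nonneg.2 hε'.le), inv_mul_le_iff₀ hε', mul_one]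
      at hz1
    rw [← map_sub]
    refine (ψ.norm_map_le ?_).trans hz1
    exact (LipNorm.isSelfAdjoint_of_mem_dom (hball _ hx).1).sub
      (LipNorm.isSelfAdjoint_of_mem_dom hy.1)
  refine (LipNorm.completeDist_le hL (ε := ε) hε'.le fun n _ => ⟨fun φ => ?_, fun ψ => ?_⟩).trans ?_
  · refine ⟨φ.comp Φ.symm.toLinearMap h1' hΨ, fun z hz => ?_⟩
    have h := key n (φ.comp Φ.symm.toLinearMap h1' hΨ) z hz
    have h2 : (φ.comp Φ.symm.toLinearMap h1' hΨ).1 (Φ ⟨z.1, LipNorm.fst_mem hz⟩) =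
        φ.1 ⟨z.1, LipNorm.fst_mem hz⟩ := congrArg φ.1 (Φ.symm_apply_apply _)
    rwa [h2] at h
  · exact ⟨ψ.comp Φ.toLinearMap h1 hΦ, fun z hz => key n ψ z hz⟩
  · rw [zero_add, ENNReal.ofReal_coe_nnreal]

end LipNormedOperatorSystem

/-! ### Systems at distance zero are isomorphic -/

namespace LipNorm

open Filter Topology

variable {A : Type u} [CStarAlgebra A] {B : Type v} [CStarAlgebra B]
  {X : OperatorSystem A} {Y : OperatorSystem B} {LX : LipNorm X} {LY : LipNorm Y}

theorem _root_.OperatorSystem.UCP.map_realPart {X : OperatorSystem A} {n : ℕ} (ψ : X.UCP n)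
    {w : A} (hw : w ∈ X.carrier) :
    ψ.1 ⟨realPart w, (X.realPart_mem hw).1⟩ = realPart (ψ.1 ⟨w, hw⟩) := by
  have h : (⟨realPart w, (X.realPart_mem hw).1⟩ : X.carrier) =
      (((2⁻¹ : ℝ) : ℂ)) • (⟨w, hw⟩ + ⟨star w, X.star_mem _ hw⟩) :=
    Subtype.ext (by
      rw [realPart_apply_coe, ← Complex.coe_smul]
      rfl)
  rw [h, map_smul, map_add, ψ.map_star hw, realPart_apply_coe, ← Complex.coe_smul]

theorem _root_.OperatorSystem.UCP.map_imaginaryPart {X : OperatorSystem A} {n : ℕ} (ψ : X.UCP n)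
    {w : A} (hw : w ∈ X.carrier) :
    ψ.1 ⟨imaginaryPart w, (X.imaginaryPart_mem hw).1⟩ = imaginaryPart (ψ.1 ⟨w, hw⟩) := by
  have h1 := ψ.map_eq_add ⟨w, hw⟩
  rw [ψ.map_realPart hw] at h1
  have h2 := realPart_add_I_smul_imaginaryPart (ψ.1 ⟨w, hw⟩)
  exact (smul_right_injective _ Complex.I_ne_zero (add_left_cancel (h2.trans h1))).symm

/-- Up to the factor `2`, the norm is detected by the states. -/
theorem _root_.OperatorSystem.norm_le_of_forall_ucp {X : OperatorSystem A} {w : A}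
    (hw : w ∈ X.carrier) {c : ℝ} (h : ∀ ψ : X.UCP 1, ‖ψ.1 ⟨w, hw⟩‖ ≤ c) : ‖w‖ ≤ 2 * c := by
  obtain ⟨φ, hφ⟩ := X.exists_ucp_norm_le (n := 1) (x := ⟨realPart w, (X.realPart_mem hw).1⟩)
    (realPart w).2
  obtain ⟨ψ, hψ⟩ := X.exists_ucp_norm_le (n := 1)
    (x := ⟨imaginaryPart w, (X.imaginaryPart_mem hw).1⟩) (imaginaryPart w).2
  rw [φ.map_realPart hw] at hφ
  rw [ψ.map_imaginaryPart hw] at hψ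
  rw [← realPart_add_I_smul_imaginaryPart w, two_mul]
  refine (norm_add_le _ _).trans (add_le_add ?_ ?_)
  · exact hφ.trans ((realPart.norm_le _).trans (h φ))
  · rw [norm_smul, Complex.norm_I, one_mul]
    exact hψ.trans ((imaginaryPart.norm_le _).trans (h ψ))

/-- The limits along an ultrafilter of sequences `z k` of elements of the unit balls of `L k`. -/
def limitBall (L : ℕ → LipNorm (X.prod Y)) : Set (A × B) :=
  {p | ∃ z : ℕ → A × B, (∀ k, z k ∈ (L k).ball) ∧ Tendsto z (hyperfilter ℕ) (𝓝 p)}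

/-- The closed complex subspace spanned by the limits of elements of the unit balls of `L k`. If
the Hausdorff distances for `L k` tend to zero, it is the graph of an isomorphism. -/
def limitGraph (L : ℕ → LipNorm (X.prod Y)) : Submodule ℂ (A × B) :=
  (Submodule.span ℂ (limitBall L)).topologicalClosure

variable {L : ℕ → LipNorm (X.prod Y)}

theorem subset_limitGraph : limitBall L ⊆ limitGraph L :=
  Submodule.subset_span.trans (Submodule.le_topologicalClosure _)

theorem limitGraph_le {N : Submodule ℂ (A × B)} (hN : IsClosed (N : Set (A × B)))
    (h : limitBall L ⊆ N) : limitGraph L ≤ N :=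
  Submodule.topologicalClosure_minimal _ (Submodule.span_le.2 h) hN

theorem limitGraph_le_carrier : limitGraph L ≤ (X.prod Y).carrier := by
  refine limitGraph_le (X.prod Y).isClosed ?_
  rintro p ⟨z, hz, hlim⟩
  exact (X.prod Y).isClosed.mem_of_tendsto hlim (Eventually.of_forall fun k => dom_subset (hz k).1)

theorem limitGraph_swap_le {L' : ℕ → LipNorm (Y.prod X)}
    (h : ∀ k, (L' k).ball = {z | z.swap ∈ (L k).ball}) {p : A × B} (hp : p ∈ limitGraph L) :
    p.swap ∈ limitGraph L' := by
  have hle : limitGraph L ≤ (limitGraph L').comap (LinearEquiv.prodComm ℂ A B).toLinearMap := by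
    refine limitGraph_le ?_ ?_
    · exact (Submodule.isClosed_topologicalClosure _).preimage continuous_swap
    · rintro p ⟨z, hz, hlim⟩
      refine subset_limitGraph ⟨fun k => (z k).swap, fun k => ?_, ?_⟩
      · rw [h k]
        exact hz k
      · exact (continuous_swap.tendsto p).comp hlim
  exact hle hp

/-- Every unital completely positive map `ψ` on `Y` is, along the limit graph, the limit of unital
completely positive maps on `X`. -/
theorem exists_tendsto_ucp {ε : ℕ → ℝ} (hε : Tendsto ε atTop (𝓝 0))
    (hcl : ∀ k, (L k).IsClose (ε k)) {n : ℕ} (hn : 0 < n) (ψ : Y.UCP n) :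
    ∃ φ : ℕ → X.UCP n, ∀ (p : A × B) (hp : p ∈ limitGraph L),
      Tendsto (fun k => (φ k).1 ⟨p.1, (limitGraph_le_carrier hp).1⟩) (hyperfilter ℕ)
        (𝓝 (ψ.1 ⟨p.2, (limitGraph_le_carrier hp).2⟩)) := by
  choose φ hφ using fun k => (hcl k n hn).2 ψ
  refine ⟨φ, ?_⟩
  let F : ℕ → (X.prod Y).carrier →ₗ[ℂ] Matrix (Fin n) (Fin n) ℂ := fun k =>
    ((φ k).inl Y).1 - (ψ.inr X).1
  have hF : ∀ k q, ‖F k q‖ ≤ 4 * ‖(q : A × B)‖ := by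
    intro k q
    refine (norm_sub_le _ _).trans ?_
    have h1 := ((φ k).inl Y).norm_map_le_two_mul q
    have h2 := (ψ.inr X).norm_map_le_two_mul q
    linarith
  let N : Submodule ℂ (X.prod Y).carrier :=
    { carrier := {q | Tendsto (fun k => F k q) (hyperfilter ℕ) (𝓝 0)}
      zero_mem' := by simp
      add_mem' := fun {a b} ha hb => by simpa using Tendsto.add ha hb
      smul_mem' := fun c a ha => by simpa using Tendsto.const_smul ha c }
  have hNcl : IsClosed (N : Set (X.prod Y).carrier) := by
    refine isClosed_of_closure_subset fun q hq => ?_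
    refine Metric.tendsto_nhds.2 fun δ hδ => ?_
    obtain ⟨q', hq', hqq'⟩ := Metric.mem_closure_iff.1 hq (δ / 8) (by positivity)
    filter_upwards [Metric.tendsto_nhds.1 hq' (δ / 2) (by positivity)] with k hk
    rw [dist_zero_right] at hk ⊢
    have h1 : ‖F k (q - q')‖ ≤ 4 * ‖((q - q' : (X.prod Y).carrier) : A × B)‖ := hF k _
    have h2 : ‖((q - q' : (X.prod Y).carrier) : A × B)‖ < δ / 8 := by
      rwa [dist_eq_norm] at hqq'
    rw [map_sub] at h1
    have h3 := norm_add_le (F k q - F k q') (F k q')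
    rw [sub_add_cancel] at h3
    linarith
  have hle : limitGraph L ≤ N.map (X.prod Y).carrier.subtype := by
    refine limitGraph_le ?_ ?_
    · exact (X.prod Y).isClosed.isClosedEmbedding_subtypeVal.isClosedMap _ hNcl
    · rintro p ⟨z, hz, hlim⟩
      have hp := limitGraph_le_carrier (subset_limitGraph ⟨z, hz, hlim⟩)
      refine ⟨⟨p, hp⟩, ?_, rfl⟩
      change Tendsto _ _ _
      have hbound : ∀ k, ‖F k ⟨p, hp⟩‖ ≤ 4 * ‖p - z k‖ + ε k := by
        intro k
        have h1 := hF k (⟨p, hp⟩ - ⟨z k, dom_subset (hz k).1⟩)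
        rw [map_sub] at h1
        have h2 : ‖F k ⟨z k, dom_subset (hz k).1⟩‖ ≤ ε k := hφ k (z k) (hz k)
        have h3 := norm_add_le (F k ⟨p, hp⟩ - F k ⟨z k, dom_subset (hz k).1⟩)
          (F k ⟨z k, dom_subset (hz k).1⟩)
        rw [sub_add_cancel] at h3
        have h4 : ‖((⟨p, hp⟩ - ⟨z k, dom_subset (hz k).1⟩ : (X.prod Y).carrier) : A × B)‖ =
          ‖p - z k‖ := rfl
        linarith
      refine squeeze_zero_norm hbound ?_
      have h5 : Tendsto (fun k => ‖p - z k‖) (hyperfilter ℕ) (𝓝 0) := by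
        have := (tendsto_const_nhds (x := p)).sub hlim
        rw [sub_self] at this
        simpa using this.norm
      simpa using (h5.const_mul 4).add (hε.mono_left Nat.hyperfilter_le_atTop)
  intro p hp
  obtain ⟨q, hq, rfl⟩ := hle hp
  have h1 : Tendsto (fun k => F k q) (hyperfilter ℕ) (𝓝 0) := hq
  have h2 := h1.add_const ((ψ.inr X).1 q)
  rw [zero_add] at h2
  refine h2.congr fun k => ?_
  exact sub_add_cancel _ _

/-- In particular the limit graph is functional, in the first and (by symmetry) in the second
variable. -/
theorem norm_snd_le_of_mem_limitGraph {ε : ℕ → ℝ} (hε : Tendsto ε atTop (𝓝 0))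
    (hcl : ∀ k, (L k).IsClose (ε k)) {p : A × B} (hp : p ∈ limitGraph L) : ‖p.2‖ ≤ 4 * ‖p.1‖ := by
  have h := OperatorSystem.norm_le_of_forall_ucp (limitGraph_le_carrier hp).2 (c := 2 * ‖p.1‖)
    fun ψ => by
      obtain ⟨φ, hφ⟩ := exists_tendsto_ucp hε hcl one_pos ψ
      exact le_of_tendsto (hφ p hp).norm
        (Eventually.of_forall fun k => (φ k).norm_map_le_two_mul ⟨p.1, _⟩)
  linarith

/-- Elements `x` of the unit ball of `L_X` lift to the unit balls of `L k`, up to factors tending to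
`1`. The second coordinates are bounded, since matrix states of `Y` are close to matrix states of
`X`, and have a limit by compactness. -/
theorem exists_mem_limitGraph_of_mem_ball {ε : ℕ → ℝ} (hε : Tendsto ε atTop (𝓝 0))
    (hcl : ∀ k, (L k).IsClose (ε k)) (hL : ∀ k, L k ∈ admissible LX LY) {x : A} (hx : x ∈ LX.ball) :
    ∃ y ∈ LY.ball, (x, y) ∈ limitGraph L := by
  let t : ℕ → ℝ := fun k => 1 - 1 / ((k : ℝ) + 2)
  have ht : Tendsto t atTop (𝓝 1) := by
    have h : Tendsto (fun k : ℕ => 1 / ((k : ℝ) + 2)) atTop (𝓝 0) :=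
      tendsto_const_nhds.div_atTop (tendsto_natCast_atTop_atTop.atTop_add tendsto_const_nhds)
    have h1 := h.const_sub 1
    rwa [sub_zero] at h1
  have ht0 : ∀ k, 0 < t k := fun k => by
    have h : 1 / ((k : ℝ) + 2) < 1 := by
      rw [div_lt_one (by positivity)]
      linarith [(Nat.cast_nonneg k : (0 : ℝ) ≤ k)]
    exact sub_pos.2 h
  have ht1 : ∀ k, t k < 1 := fun k => sub_lt_self _ (by positivity)
  choose z hz hzx using fun k =>
    ((mem_admissible_iff.1 (hL k)).2.1.2 x hx (t k) (ht0 k) (ht1 k))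
  have hy : ∀ k, (z k).2 ∈ LY.ball := fun k => (mem_admissible_iff.1 (hL k)).2.2.1 _ (hz k)
  obtain ⟨E, hE⟩ := hε.bddAbove_range
  have hE' : ∀ k, ε k ≤ E := fun k => hE ⟨k, rfl⟩
  have hbound : ∀ k, ‖(z k).2‖ ≤ ‖x‖ + E := by
    intro k
    obtain ⟨ψ, hψ⟩ := Y.exists_ucp_norm_le (n := 1) (x := ⟨(z k).2, snd_mem (hz k)⟩)
      (isSelfAdjoint_of_mem_dom (hy k).1)
    obtain ⟨φ, hφ⟩ := (hcl k 1 one_pos).2 ψ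
    have h1 := hφ (z k) (hz k)
    have hx' : (z k).1 ∈ LX.ball := (mem_admissible_iff.1 (hL k)).2.1.1 _ (hz k)
    have h2 := φ.norm_map_le (x := ⟨(z k).1, fst_mem (hz k)⟩) (isSelfAdjoint_of_mem_dom hx'.1)
    have h3 : ‖(z k).1‖ ≤ ‖x‖ := by
      rw [hzx, norm_smul, Real.norm_of_nonneg (ht0 k).le]
      exact mul_le_of_le_one_left (norm_nonneg _) (ht1 k).le
    have h4 := norm_sub_norm_le (ψ.1 ⟨(z k).2, snd_mem (hz k)⟩) (φ.1 ⟨(z k).1, fst_mem (hz k)⟩)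
    rw [norm_sub_rev] at h4
    have := hE' k
    simp only at h2 hψ
    linarith
  obtain ⟨y, hyK, hlim⟩ := (LY.isCompact_ball_inter (‖x‖ + E)).ultrafilter_le_nhds
    ((hyperfilter ℕ).map fun k => (z k).2) (by
      rw [le_principal_iff]
      exact mem_map.2 (Eventually.of_forall fun k => ⟨hy k, by simpa using hbound k⟩))
  refine ⟨y, hyK.1, subset_limitGraph ⟨z, hz, ?_⟩⟩
  refine Tendsto.prodMk_nhds ?_ hlim
  have h1 : Tendsto (fun k => t k • x) (hyperfilter ℕ) (𝓝 ((1 : ℝ) • x)) :=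
    (ht.mono_left Nat.hyperfilter_le_atTop).smul_const x
  rw [one_smul] at h1
  exact h1.congr fun k => (hzx k).symm

/-- The limit graph projects onto `X`: by the norm estimate, the image of the projection is closed,
and it contains the domain of `L_X`. -/
theorem exists_mem_limitGraph {ε : ℕ → ℝ} (hε : Tendsto ε atTop (𝓝 0))
    (hcl : ∀ k, (L k).IsClose (ε k)) (hL : ∀ k, L k ∈ admissible LX LY) {x : A}
    (hx : x ∈ X.carrier) : ∃ y, (x, y) ∈ limitGraph L := by
  let f : limitGraph L → A := fun p => p.1.1
  have hcomplete : CompleteSpace (limitGraph L) :=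
    (Submodule.isClosed_topologicalClosure _).completeSpace_coe
  have hanti : AntilipschitzWith 4 f := by
    refine AntilipschitzWith.of_le_mul_dist fun p q => ?_
    have h1 := norm_snd_le_of_mem_limitGraph hε hcl (p - q).2
    rw [Subtype.dist_eq, dist_eq_norm, dist_eq_norm, Prod.norm_def]
    refine max_le ?_ h1
    change ‖p.1.1 - q.1.1‖ ≤ 4 * ‖p.1.1 - q.1.1‖
    linarith [norm_nonneg (p.1.1 - q.1.1)]
  have hclosed : IsClosed (((limitGraph L).map (LinearMap.fst ℂ A B) : Submodule ℂ A) : Set A) := by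
    have hc : UniformContinuous f := uniformContinuous_fst.comp uniformContinuous_subtype_val
    convert hanti.isClosed_range hc using 1
    ext a
    simp [f]
  have hdom : (LX.dom : Set A) ⊆ (limitGraph L).map (LinearMap.fst ℂ A B) := by
    intro a ha
    obtain ⟨t, ht, hta⟩ := exists_smul_mem_ball ha
    obtain ⟨y, -, hy⟩ := exists_mem_limitGraph_of_mem_ball hε hcl hL hta
    refine ⟨((t : ℂ)⁻¹) • (t • a, y), Submodule.smul_mem _ _ hy, ?_⟩
    change (t : ℂ)⁻¹ • t • a = a
    rw [← Complex.coe_smul, smul_smul, inv_mul_cancel₀ (by exact_mod_cast ht.ne'), one_smul]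
  have hsa : (X.sa : Set A) ⊆ (limitGraph L).map (LinearMap.fst ℂ A B) :=
    LX.dense.trans (closure_minimal hdom hclosed)
  have hmem : x ∈ (limitGraph L).map (LinearMap.fst ℂ A B) := by
    rw [← realPart_add_I_smul_imaginaryPart x]
    exact Submodule.add_mem _ (hsa (X.realPart_mem hx))
      (Submodule.smul_mem _ _ (hsa (X.imaginaryPart_mem hx)))
  obtain ⟨p, hp, rfl⟩ := hmem
  exact ⟨p.2, hp⟩

/-- The limit graph is completely positive. Self-adjointness of `y` is checked at states, then
positivity at matrix states. -/
theorem isPos_of_mem_limitGraph {ε : ℕ → ℝ} (hε : Tendsto ε atTop (𝓝 0))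
    (hcl : ∀ k, (L k).IsClose (ε k)) {m : ℕ} (x : Matrix (Fin m) (Fin m) X.carrier)
    (y : Matrix (Fin m) (Fin m) Y.carrier)
    (hxy : ∀ i j, ((x i j : A), (y i j : B)) ∈ limitGraph L) (hx : IsPos (x.map fun a => (a : A))) :
    IsPos (y.map fun a => (a : B)) := by
  rcases m with _ | m
  · exact ⟨0, Subsingleton.elim _ _⟩
  have hsa : IsSelfAdjoint (y.map fun a => (a : B)) := by
    ext i j
    have hxij : star (x j i : A) = x i j := congrFun (congrFun hx.isSelfAdjoint i) j
    have hmem : star (y j i : B) - y i j ∈ Y.carrier :=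
      Y.carrier.sub_mem (Y.star_mem _ (y j i).2) (y i j).2
    have h0 : ‖star (y j i : B) - y i j‖ ≤ 2 * 0 := by
      refine OperatorSystem.norm_le_of_forall_ucp hmem fun ψ => ?_
      obtain ⟨φ, hφ⟩ := exists_tendsto_ucp hε hcl one_pos ψ
      have h1 : ψ.1 ⟨_, hmem⟩ = star (ψ.1 (y j i)) - ψ.1 (y i j) := by
        rw [← ψ.map_star (y j i).2, ← map_sub]
        rfl
      have h2 : Tendsto (fun k => star ((φ k).1 (x j i)) - (φ k).1 (x i j)) (hyperfilter ℕ)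
          (𝓝 (star (ψ.1 (y j i)) - ψ.1 (y i j))) :=
        (hφ _ (hxy j i)).star.sub (hφ _ (hxy i j))
      have h3 : ∀ k, star ((φ k).1 (x j i)) - (φ k).1 (x i j) = 0 := by
        intro k
        rw [← (φ k).map_star (x j i).2, sub_eq_zero]
        congr 1
        exact Subtype.ext hxij
      simp only [h3] at h2
      rw [h1, tendsto_nhds_unique h2 tendsto_const_nhds, norm_zero]
    rw [mul_zero, norm_le_zero_iff, sub_eq_zero] at h0
    exact h0
  refine Y.isPos_of_forall_ucp hsa fun ψ => ?_
  obtain ⟨φ, hφ⟩ := exists_tendsto_ucp hε hcl m.succ_pos ψ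
  have hlim : Tendsto (fun k => x.map fun a => (φ k).1 a) (hyperfilter ℕ)
      (𝓝 (y.map fun a => ψ.1 a)) := by
    refine tendsto_pi_nhds.2 fun i => tendsto_pi_nhds.2 fun j => ?_
    exact hφ _ (hxy i j)
  exact Matrix.isClosed_isPos.mem_of_tendsto hlim
    (Eventually.of_forall fun k => (φ k).2.2 _ x hx)

end LipNorm

/-- A linear relation between `V` and `W` that is functional and total in both directions is the
graph of a linear equivalence. -/
theorem exists_linearEquiv_of_graph {V W : Type*} [AddCommGroup V] [Module ℂ V] [AddCommGroup W]
    [Module ℂ W] (H : Submodule ℂ (V × W)) (hV : ∀ x, ∃ y, (x, y) ∈ H) (hW : ∀ y, ∃ x, (x, y) ∈ H)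
    (h1 : ∀ p ∈ H, p.1 = 0 → p.2 = 0) (h2 : ∀ p ∈ H, p.2 = 0 → p.1 = 0) :
    ∃ Φ : V ≃ₗ[ℂ] W, ∀ x y, (x, y) ∈ H ↔ Φ x = y := by
  let f : H →ₗ[ℂ] V := LinearMap.fst ℂ V W ∘ₗ H.subtype
  let g : H →ₗ[ℂ] W := LinearMap.snd ℂ V W ∘ₗ H.subtype
  have hf : Function.Bijective f :=
    ⟨(injective_iff_map_eq_zero f).2 fun p hp => Subtype.ext (Prod.ext hp (h1 p p.2 hp)),
      fun x => (hV x).elim fun y hy => ⟨⟨(x, y), hy⟩, rfl⟩⟩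
  have hg : Function.Bijective g :=
    ⟨(injective_iff_map_eq_zero g).2 fun p hp => Subtype.ext (Prod.ext (h2 p p.2 hp) hp),
      fun y => (hW y).elim fun x hx => ⟨⟨(x, y), hx⟩, rfl⟩⟩
  let Φ := (LinearEquiv.ofBijective f hf).symm.trans (LinearEquiv.ofBijective g hg)
  have key : ∀ p : H, Φ p.1.1 = p.1.2 := by
    intro p
    have h : (LinearEquiv.ofBijective f hf).symm p.1.1 = p :=
      (LinearEquiv.symm_apply_eq _).2 rfl
    change LinearEquiv.ofBijective g hg ((LinearEquiv.ofBijective f hf).symm p.1.1) = p.1.2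
    rw [h]
    rfl
  refine ⟨Φ, fun x y => ⟨fun h => key ⟨_, h⟩, ?_⟩⟩
  rintro rfl
  obtain ⟨y, hy⟩ := hV x
  rwa [key ⟨_, hy⟩]

namespace LipNormedOperatorSystem

open Filter Topology

/-- A linear map between operator systems that maps the unit ball into the unit ball decreases the
Lip-norms. -/
theorem _root_.LipNorm.le_of_forall_mem_ball {A : Type u} [CStarAlgebra A] {B : Type v}
    [CStarAlgebra B] {X : OperatorSystem A} {Y : OperatorSystem B} {LX : LipNorm X}
    {LY : LipNorm Y} (Φ : X.carrier →ₗ[ℂ] Y.carrier)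
    (h : ∀ x : X.carrier, (x : A) ∈ LX.ball → (Φ x : B) ∈ LY.ball) (x : X.carrier)
    (hx : (x : A) ∈ LX.dom) : ∃ hy : (Φ x : B) ∈ LY.dom, LY.L ⟨Φ x, hy⟩ ≤ LX.L ⟨x, hx⟩ := by
  have hsmul : ∀ t : ℝ, (t • (x : A)) ∈ LX.ball → (t • (Φ x : B)) ∈ LY.ball := by
    intro t ht
    have h1 := h ((t : ℂ) • x) (by
      rw [Submodule.coe_smul, Complex.coe_smul]
      exact ht)
    rwa [map_smul, Submodule.coe_smul, Complex.coe_smul] at h1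
  have hy : (Φ x : B) ∈ LY.dom := by
    obtain ⟨t, ht, hxt⟩ := LipNorm.exists_smul_mem_ball hx
    exact (LY.dom.smul_mem_iff ht.ne').1 (hsmul t hxt).1
  refine ⟨hy, le_of_forall_gt_imp_ge_of_dense fun r hr => ?_⟩
  have hr0 : 0 < r := (apply_nonneg LX.L _).trans_lt hr
  exact (LipNorm.le_iff hy hr0).2 (hsmul _ ((LipNorm.le_iff hx hr0).1 hr.le))

/-- The limit graph of admissible Lip-norms for which the Hausdorff distances tend to zero is the
graph of an isomorphism. -/
theorem iso_of_completeDist_eq_zero {S T : LipNormedOperatorSystem.{u}}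
    (h : completeDist S.L T.L = 0) : S.Iso T := by
  let ε : ℕ → ℝ := fun k => 1 / ((k : ℝ) + 1)
  have hε0 : ∀ k, 0 < ε k := fun k => by positivity
  have hε : Tendsto ε atTop (𝓝 0) := tendsto_one_div_add_atTop_nhds_zero_nat
  choose L hL hcl using fun k => LipNorm.exists_isClose (LX := S.L) (LY := T.L) (hε0 k).le
    (by rw [h]; exact ENNReal.ofReal_pos.2 (hε0 k))
  choose L' hL' hcl' hball using fun k => LipNorm.exists_admissible_swap (hL k) (hcl k)
  have hball' : ∀ k, (L k).ball = {z | z.swap ∈ (L' k).ball} := fun k => by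
    rw [hball k]
    rfl
  let H := LipNorm.limitGraph L
  let H' := LipNorm.limitGraph L'
  have hswap : ∀ p ∈ H, p.swap ∈ H' := fun p hp => LipNorm.limitGraph_swap_le hball hp
  have hswap' : ∀ p ∈ H', p.swap ∈ H := fun p hp => LipNorm.limitGraph_swap_le hball' hp
  let ι : S.X.carrier × T.X.carrier →ₗ[ℂ] S.algebra × T.algebra :=
    S.X.carrier.subtype.prodMap T.X.carrier.subtype
  obtain ⟨Φ, hΦ⟩ := exists_linearEquiv_of_graph (H.comap ι)
    (fun x => by
      obtain ⟨y, hy⟩ := LipNorm.exists_mem_limitGraph hε hcl hL x.2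
      exact ⟨⟨y, (LipNorm.limitGraph_le_carrier hy).2⟩, hy⟩)
    (fun y => by
      obtain ⟨x, hx⟩ := LipNorm.exists_mem_limitGraph hε hcl' hL' y.2
      exact ⟨⟨x, (LipNorm.limitGraph_le_carrier hx).2⟩, hswap' _ hx⟩)
    (fun p hp h0 => by
      have h1 := LipNorm.norm_snd_le_of_mem_limitGraph hε hcl hp
      have h2 : (ι p).1 = 0 := congrArg Subtype.val h0
      rw [h2, norm_zero, mul_zero, norm_le_zero_iff] at h1
      exact Subtype.ext h1)
    (fun p hp h0 => by
      have h1 := LipNorm.norm_snd_le_of_mem_limitGraph hε hcl' (hswap _ hp)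
      have h2 : (ι p).swap.1 = 0 := congrArg Subtype.val h0
      rw [h2, norm_zero, mul_zero, norm_le_zero_iff] at h1
      exact Subtype.ext h1)
  have hgraph : ∀ x : S.X.carrier, ((x : S.algebra), (Φ x : T.algebra)) ∈ H := fun x =>
    (hΦ x (Φ x)).2 rfl
  have hgraph' : ∀ y : T.X.carrier, ((y : T.algebra), (Φ.symm y : S.algebra)) ∈ H' := fun y =>
    hswap _ ((hΦ (Φ.symm y) y).2 (Φ.apply_symm_apply y))
  have hΦball : ∀ x : S.X.carrier, (x : S.algebra) ∈ S.L.ball → (Φ x : T.algebra) ∈ T.L.ball := by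
    intro x hx
    obtain ⟨y, hy, hxy⟩ := LipNorm.exists_mem_limitGraph_of_mem_ball hε hcl hL hx
    have h1 := (hΦ x ⟨y, LipNorm.dom_subset hy.1⟩).1 hxy
    rwa [h1]
  have hΨball : ∀ y : T.X.carrier, (y : T.algebra) ∈ T.L.ball →
      (Φ.symm y : S.algebra) ∈ S.L.ball := by
    intro y hy
    obtain ⟨x, hx, hxy⟩ := LipNorm.exists_mem_limitGraph_of_mem_ball hε hcl' hL' hy
    have h1 := (hΦ ⟨x, LipNorm.dom_subset hx.1⟩ y).1 (hswap' _ hxy)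
    rwa [← h1, Φ.symm_apply_apply]
  refine ⟨Φ, ?_, ?_, ?_, fun x hx => ?_, fun y hy => ?_⟩
  · refine (hΦ _ _).1 (LipNorm.subset_limitGraph ⟨fun _ => 1, fun k => ?_, tendsto_const_nhds⟩)
    have := LipNorm.smul_one_mem_ball (L := L k) 1
    rwa [one_smul] at this
  · exact fun m x hx => LipNorm.isPos_of_mem_limitGraph hε hcl x (x.map Φ) (fun i j => hgraph _) hx
  · exact fun m y hy =>
      LipNorm.isPos_of_mem_limitGraph hε hcl' y (y.map Φ.symm) (fun i j => hgraph' _) hy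
  · obtain ⟨hy, hle⟩ := LipNorm.le_of_forall_mem_ball Φ.toLinearMap hΦball x hx
    obtain ⟨hx', hle'⟩ := LipNorm.le_of_forall_mem_ball Φ.symm.toLinearMap hΨball (Φ x) hy
    have h1 : (⟨Φ.symm (Φ x), hx'⟩ : S.L.dom) = ⟨x, hx⟩ :=
      Subtype.ext (by simp)
    exact ⟨hy, le_antisymm hle ((congrArg S.L.L h1).symm.trans_le hle')⟩
  · obtain ⟨hx, hle⟩ := LipNorm.le_of_forall_mem_ball Φ.symm.toLinearMap hΨball y hy
    obtain ⟨hy', hle'⟩ := LipNorm.le_of_forall_mem_ball Φ.toLinearMap hΦball (Φ.symm y) hx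
    have h1 : (⟨Φ (Φ.symm y), hy'⟩ : T.L.dom) = ⟨y, hy⟩ :=
      Subtype.ext (by simp)
    exact ⟨hx, le_antisymm hle ((congrArg T.L.L h1).symm.trans_le hle')⟩

end LipNormedOperatorSystem

/-! ### The metric on isomorphism classes -/

namespace LipSpace

/-- The complete distance on isomorphism classes, as an extended metric. -/
@[reducible] def emetric : EMetricSpace LipSpace.{u} where
  edist := Quotient.lift₂ (fun S T => completeDist S.L T.L) (by
    have h : ∀ S T S' T' : LipNormedOperatorSystem.{u}, S.Iso S' → T.Iso T' →
        completeDist S.L T.L ≤ completeDist S'.L T'.L := fun S T S' T' hS hT =>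
      calc completeDist S.L T.L
          ≤ completeDist S.L S'.L + (completeDist S'.L T'.L + completeDist T'.L T.L) :=
            (LipNorm.completeDist_triangle _ S'.L _).trans
              (add_le_add_right (LipNorm.completeDist_triangle _ _ _) _)
        _ = completeDist S'.L T'.L := by
            rw [hS.completeDist_eq_zero, hT.symm.completeDist_eq_zero, zero_add, add_zero]
    exact fun S T S' T' hS hT => le_antisymm (h _ _ _ _ hS hT) (h _ _ _ _ hS.symm hT.symm))
  edist_self := by
    rintro ⟨S⟩
    exact (LipNormedOperatorSystem.Iso.refl S).completeDist_eq_zero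
  edist_comm := by
    rintro ⟨S⟩ ⟨T⟩
    exact LipNorm.completeDist_comm _ _
  edist_triangle := by
    rintro ⟨S⟩ ⟨T⟩ ⟨U⟩
    exact LipNorm.completeDist_triangle _ _ _
  eq_of_edist_eq_zero := by
    rintro ⟨S⟩ ⟨T⟩ h
    exact Quotient.sound (LipNormedOperatorSystem.iso_of_completeDist_eq_zero h)

/-- The complete distance on isomorphism classes, as a metric. -/
@[reducible] def metric : MetricSpace LipSpace.{u} :=
  letI := emetric.{u}
  EMetricSpace.toMetricSpace (by
    rintro ⟨S⟩ ⟨T⟩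
    exact (LipNorm.completeDist_lt_top _ _).ne)

end LipSpace

/-! ### Separability of the finitely approximable systems -/

open TopologicalSpace

/-- A pseudo-metric space is separable if, for every `ε > 0`, it is a countable union of sets of
diameter at most `ε`. -/
theorem separableSpace_of_forall_exists_code {α : Type*} [PseudoEMetricSpace α]
    (h : ∀ ε : ℝ, 0 < ε → ∃ (ι : Type) (_ : Countable ι) (code : α → ι),
      ∀ p q, code p = code q → edist p q ≤ ENNReal.ofReal ε) : SeparableSpace α := by
  obtain ⟨t, -, htc, ht⟩ := EMetric.subset_countable_closure_of_almost_dense_set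
    (Set.univ : Set α) fun ε hε => by
      obtain ⟨δ, hδ, hδε⟩ := ENNReal.lt_iff_exists_nnreal_btwn.1 hε
      obtain ⟨ι, _, code, hcode⟩ := h δ (by exact_mod_cast hδ)
      refine ⟨Set.range (Set.rangeSplitting code), Set.countable_range _, fun p _ => ?_⟩
      refine Set.mem_biUnion ⟨⟨code p, p, rfl⟩, rfl⟩ ?_
      refine (hcode _ _ (Set.apply_rangeSplitting code ⟨code p, p, rfl⟩).symm).trans ?_
      rw [ENNReal.ofReal_coe_nnreal]
      exact hδε.le
  exact ⟨t, htc, dense_iff_closure_eq.2 (Set.univ_subset_iff.1 ht)⟩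

namespace LipNorm

open scoped NNReal

variable {A : Type u} [CStarAlgebra A] {X Y : OperatorSystem A}

/-- The part of norm at most `R` of the unit ball of a Lip-norm, as a nonempty compact set. -/
def ballCompacts (L : LipNorm X) (R : ℝ≥0) : NonemptyCompacts A :=
  ⟨⟨L.ball ∩ Metric.closedBall 0 R, L.isCompact_ball_inter R⟩, 0, by
    have h := smul_one_mem_ball (L := L) 0
    rwa [zero_smul] at h, by simp⟩

theorem exists_mem_ball_norm_sub_le {LX : LipNorm X} {LY : LipNorm Y} {R : ℝ≥0} {δ : ℝ}
    (hX : ∀ a ∈ LX.ball, ∃ r : ℝ, ‖a - r • (1 : A)‖ ≤ R)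
    (h : edist (LX.ballCompacts R) (LY.ballCompacts R) < ENNReal.ofReal δ) {x : A}
    (hx : x ∈ LX.ball) : ∃ y ∈ LY.ball, ‖x - y‖ ≤ δ := by
  obtain ⟨r, hr⟩ := hX x hx
  have hmem : x - r • (1 : A) ∈ (LX.ballCompacts R : Set A) :=
    ⟨sub_smul_one_mem_ball hx r, by simpa using hr⟩
  obtain ⟨y, hy, hxy⟩ := Metric.exists_edist_lt_of_hausdorffEDist_lt hmem h
  refine ⟨y + r • 1, add_smul_one_mem_ball hy.1 r, ?_⟩
  rw [edist_dist, ENNReal.ofReal_lt_ofReal_iff_of_nonneg dist_nonneg, dist_eq_norm] at hxy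
  rw [sub_add_eq_sub_sub_swap]
  exact hxy.le

/-- For two operator subsystems of the same C⋆-algebra, the complete distance is controlled by the
Hausdorff distance of the unit balls: matrix states extend to the C⋆-algebra and can be restricted
from there to the other subsystem. -/
theorem completeDist_le_of_edist_ballCompacts_lt {LX : LipNorm X} {LY : LipNorm Y} {R : ℝ≥0}
    {δ : ℝ} (hδ : 0 < δ) (hX : ∀ a ∈ LX.ball, ∃ r : ℝ, ‖a - r • (1 : A)‖ ≤ R)
    (hY : ∀ a ∈ LY.ball, ∃ r : ℝ, ‖a - r • (1 : A)‖ ≤ R)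
    (h : edist (LX.ballCompacts R) (LY.ballCompacts R) < ENNReal.ofReal δ) :
    completeDist LX LY ≤ ENNReal.ofReal δ := by
  have := X.nontrivial
  let T : LX.dom.prod LY.dom →ₗ[ℝ] A :=
    δ⁻¹ • ((LinearMap.fst ℝ A A - LinearMap.snd ℝ A A) ∘ₗ Submodule.subtype _)
  have hT : ∀ z, ‖T z‖ = δ⁻¹ * ‖(z : A × A).1 - (z : A × A).2‖ := fun z => by
    change ‖δ⁻¹ • ((z : A × A).1 - (z : A × A).2)‖ = _
    rw [norm_smul, Real.norm_of_nonneg (inv_nonneg.2 hδ.le)]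
  have hle : ∀ z, ‖T z‖ ≤ 1 ↔ ‖(z : A × A).1 - (z : A × A).2‖ ≤ δ := fun z => by
    rw [hT, inv_mul_le_iff₀ hδ, mul_one]
  obtain ⟨L, hL, hball⟩ := exists_admissible_of_bridge T (c := δ⁻¹ * 2)
    (fun z => by
      rw [hT, mul_assoc, two_mul]
      gcongr
      exact (norm_sub_le _ _).trans (add_le_add (norm_fst_le _) (norm_snd_le _)))
    (by rw [← norm_eq_zero, hT, sub_self, norm_zero, mul_zero])
    (by
      rw [← norm_ne_zero_iff, hT, sub_zero]
      exact mul_ne_zero (inv_ne_zero hδ.ne') (norm_ne_zero_iff.2 one_ne_zero))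
    (fun x hx => by
      obtain ⟨y, hy, hxy⟩ := exists_mem_ball_norm_sub_le hX h hx
      exact ⟨y, hy, (hle _).2 hxy⟩)
    (fun y hy => by
      rw [edist_comm] at h
      obtain ⟨x, hx, hxy⟩ := exists_mem_ball_norm_sub_le hY h hy
      exact ⟨x, hx, (hle _).2 (by rwa [norm_sub_rev])⟩)
  have key : ∀ {n : ℕ} (Φ : X.univ.UCP n), ∀ z ∈ L.ball,
      ‖Φ.1 ⟨z.1, trivial⟩ - Φ.1 ⟨z.2, trivial⟩‖ ≤ δ := by
    intro n Φ z hz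
    obtain ⟨hx, hy, hz1⟩ := hball z hz
    rw [← map_sub]
    exact (Φ.norm_map_le ((isSelfAdjoint_of_mem_dom hx.1).sub
      (isSelfAdjoint_of_mem_dom hy.1))).trans ((hle _).1 hz1)
  refine completeDist_le hL hδ.le fun n _ => ⟨fun φ => ?_, fun ψ => ?_⟩
  · obtain ⟨Φ, hΦ⟩ := φ.exists_extension
    refine ⟨Φ.restrict Y le_top, fun z hz => ?_⟩
    rw [← hΦ]
    exact key Φ z hz
  · obtain ⟨Ψ, hΨ⟩ := ψ.exists_extension
    refine ⟨OperatorSystem.UCP.restrict (Z := X.univ) X le_top Ψ, fun z hz => ?_⟩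
    rw [← hΨ]
    exact key Ψ z hz

end LipNorm

namespace LipSpace

open scoped NNReal

theorem separableSpace_fa :
    letI := metric.{u}
    SeparableSpace fa.{u} := by
  let _ := metric.{u}
  refine separableSpace_of_forall_exists_code fun ε hε => ?_
  obtain ⟨δ, hδ, hδε⟩ : ∃ δ : ℝ, 0 < δ ∧ δ + 2 * δ + δ = ε := ⟨ε / 4, by positivity, by ring⟩
  choose D hDc hD using fun k : ℕ =>
    exists_countable_dense (NonemptyCompacts (Matrix (Fin k) (Fin k) ℂ))
  have : ∀ k, Countable (D k) := fun k => (hDc k).to_subtype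
  -- A code of `p` is a size `k`, a radius `R`, and a point of the dense set that is close to the
  -- unit ball of a Lip-normed operator subsystem of `M_k` which approximates `p`.
  have hcode : ∀ p : fa.{u}, ∃ c : Σ k : ℕ, ℕ × D k, ∃ (S : LipNormedOperatorSystem.{u})
      (Y : OperatorSystem (Matrix (Fin c.1) (Fin c.1) ℂ)) (LY : LipNorm Y), mk S = p ∧
      completeDist S.L LY ≤ ENNReal.ofReal δ ∧
      (∀ a ∈ LY.ball, ∃ r : ℝ, ‖a - r • (1 : Matrix (Fin c.1) (Fin c.1) ℂ)‖ ≤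
        ((c.2.1 : ℝ≥0) : ℝ)) ∧
      edist (LY.ballCompacts c.2.1) c.2.2 < ENNReal.ofReal δ := by
    rintro ⟨_, S, rfl, hS⟩
    have hafn := hS δ hδ
    simp only [afn, ne_eq, iInf_eq_top, not_forall] at hafn
    obtain ⟨k, ⟨Y, LY, hY⟩, -⟩ := hafn
    obtain ⟨C, -, hC⟩ := LY.exists_radius
    obtain ⟨R, hR⟩ := exists_nat_ge C
    obtain ⟨d, hd, hd'⟩ := EMetric.mem_closure_iff.1 (hD k (LY.ballCompacts R))
      (ENNReal.ofReal δ) (ENNReal.ofReal_pos.2 hδ)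
    exact ⟨⟨k, R, d, hd⟩, S, Y, LY, rfl, hY, fun a ha => (hC a ha).imp fun r hr =>
      hr.trans (by simpa using hR), hd'⟩
  choose code hcode using hcode
  refine ⟨_, inferInstance, code, fun p q hpq => ?_⟩
  obtain ⟨S, Y, LY, hp, hSY, hY, hYd⟩ := hcode p
  have hcode' := hcode q
  rw [← hpq] at hcode'
  obtain ⟨S', Y', LY', hq, hSY', hY', hYd'⟩ := hcode'
  have hdist : edist (LY.ballCompacts (code p).2.1) (LY'.ballCompacts (code p).2.1) <
      ENNReal.ofReal (2 * δ) := by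
    rw [two_mul, ENNReal.ofReal_add hδ.le hδ.le]
    rw [edist_comm] at hYd'
    exact (edist_triangle _ _ _).trans_lt (ENNReal.add_lt_add hYd hYd')
  have hYY' := LipNorm.completeDist_le_of_edist_ballCompacts_lt (by positivity) hY hY' hdist
  have h : edist (p : LipSpace.{u}) q = completeDist S.L S'.L := by
    rw [← hp, ← hq]
    rfl
  rw [Subtype.edist_eq, h, ← hδε, ENNReal.ofReal_add (by positivity) hδ.le,
    ENNReal.ofReal_add hδ.le (by positivity)]
  refine (LipNorm.completeDist_triangle _ LY' _).trans (add_le_add ?_ ?_)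
  · exact (LipNorm.completeDist_triangle _ LY _).trans (add_le_add hSY hYY')
  · rw [LipNorm.completeDist_comm]
    exact hSY'

end LipSpace

end

/-- Complete distance is a metric on the set `𝓡` of Lip-normed operator systems, and its subspace
`𝓡_fa` is separable. -/
theorem mainTheorem5 :
    ∃ _ : MetricSpace LipSpace.{u},
      (∀ S T : LipNormedOperatorSystem.{u},
        edist (LipSpace.mk S) (LipSpace.mk T) = completeDist S.L T.L) ∧
      TopologicalSpace.SeparableSpace LipSpace.fa.{u} :=
  ⟨LipSpace.metric, fun _ _ => rfl, LipSpace.separableSpace_fa⟩
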